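/- Let $\Omega_0\subset\mathbb{R}^2$ be a simply-connected polygon (the interior of a simple closed polygonal curve $\Gamma_0$), and let $\Omega_1,\dots,\Omega_J\subset\Omega_0$ ($J\ge 0$) be pairwise disjoint simply-connected polygons with boundary curves $\Gamma_1,\dots,\Gamma_J$ such that $\mathrm{dist}(\Gamma_i,\Gamma_j)>0$ for all $0\le i\ne j\le J$. Put $\Omega=\Omega_0\setminus\bigcup_{j=1}^J\overline{\Omega_j}$. Let $\mathcal{G}_h$ be a conforming triangulation of $\Omega$: finitely many nondegenerate closed triangles whose union is $\overline\Omega$, any two distinct ones meeting in the empty set, a common vertex or a common edge. For a field $\tau=(\tau_1,\tau_2)$ let $\mathrm{rot}\,\tau=\partial_1\tau_2-\partial_2\tau_1$ (in the weak sense), and for $x=(x_1,x_2)$ let $x^\perp=(-x_2,x_1)$. Define $$H(\mathrm{rot},\Omega)=\{\tau\in L^2(\Omega)^2:\ \mathrm{rot}\,\tau\in L^2(\Omega)\},\qquad H_0(\mathrm{rot},\Omega)=\{\tau\in H(\mathrm{rot},\Omega):\ \tau\cdot t=0\ \text{on}\ \partial\Omega\},$$ where $t$ is the unit tangent to $\partial\Omega$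 and $\tau\cdot t$ is the tangential trace (defined by Green's formula), $$H^1_C(\Omega)=\{w\in H^1(\Omega):\ w|_{\Gamma_0}=0,\ w|_{\Gamma_j}=\text{constant},\ 1\le j\le J\}$$ (in the sense of traces; the constants may depend on $j$ and $w$), and the finite element spaces $$\mathsf{L}_{hC}=\{w\in H^1_C(\Omega):\ w|_K\in P_1(K)\ \ \forall K\in\mathcal{G}_h\},$$ $$\mathbb{R}_{h0}=\{\tau\in H_0(\mathrm{rot},\Omega):\ \tau|_K\in\{u+v\,x^\perp:\ u\in\mathbb{R}^2,\ v\in\mathbb{R}\}\ \ \forall K\in\mathcal{G}_h\},$$ $$\mathcal{L}^0_{h0}=\Big\{q\in L^2(\Omega):\ q|_K\ \text{is constant}\ \ \forall K\in\mathcal{G}_h,\ \int_\Omega q\,dx=0\Big\}.$$ **Lemma.** The weak gradient maps $\mathsf{L}_{hC}$ into $\mathbb{R}_{h0}$, the weak rot maps $\mathbb{R}_{h0}$ into $\mathcal{L}^0_{h0}$, and the sequence $$0\longrightarrow \mathsf{L}_{hC}\xrightarrow{\ \nabla\ }\mathbb{R}_{h0}\xrightarrow{\ \mathrm{rot}\ }\mathcal{L}^0_{h0}\longrightarrow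 0$$ is exact: $\nabla$ is injective on $\mathsf{L}_{hC}$, its image is exactly $\{\tau\in\mathbb{R}_{h0}:\ \mathrm{rot}\,\tau=0\}$, and $\mathrm{rot}\,\mathbb{R}_{h0}=\mathcal{L}^0_{h0}$. -/

import Mathlib

open MeasureTheory Filter Topology
open scoped ContDiff ENNReal

noncomputable section

namespace PlateComplex

/-- The Euclidean plane. -/
abbrev Plane : Type := EuclideanSpace ℝ (Fin 2)

/-! ### The domain -/

/-- A simple closed polygonal curve: at least three vertices, pairwise distinct, and two different
edges meet at most in common endpoints. -/
structure IsSimplePolygon {n : ℕ} (P : Polygon Plane n) : Prop where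
  three_le : 3 ≤ n
  injective : Function.Injective P.vertices
  edge_inter : ∀ i j : Fin n, i ≠ j →
    P.edgeSet ℝ i ∩ P.edgeSet ℝ j ⊆
      {P.vertices i, P.vertices (finRotate n i)} ∩ {P.vertices j, P.vertices (finRotate n j)}

/-- `U` is an (open) simply-connected polygon, i.e. the interior of a simple closed polygonal
curve: a bounded connected open set whose topological boundary is such a curve. -/
structure IsPolygonInterior (U : Set Plane) : Prop where
  isOpen : IsOpen U
  isConnected : IsConnected U
  isBounded : Bornology.IsBounded U
  frontier_eq : ∃ (n : ℕ) (P : Polygon Plane n), IsSimplePolygon P ∧ frontier U = P.boundary ℝ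

/-- The data of a multiply-connected polygon: a simply-connected polygon `outer` and
simply-connected polygons `hole j ⊆ outer`. The boundary curves are compact, so that having
positive distance is the same as being disjoint. -/
structure MultiplyConnectedPolygon (J : ℕ) where
  outer : Set Plane
  hole : Fin J → Set Plane
  outer_polygon : IsPolygonInterior outer
  hole_polygon : ∀ j, IsPolygonInterior (hole j)
  hole_subset : ∀ j, hole j ⊆ outer
  hole_disjoint : ∀ i j, i ≠ j → Disjoint (hole i) (hole j)
  frontier_outer_disjoint : ∀ j, Disjoint (frontier outer) (frontier (hole j))
  frontier_hole_disjoint : ∀ i j, i ≠ j → Disjoint (frontier (hole i)) (frontier (hole j))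

/-- The domain `Ω`: the outer polygon with the closed holes removed. -/
def MultiplyConnectedPolygon.domain {J : ℕ} (D : MultiplyConnectedPolygon J) : Set Plane :=
  D.outer \ ⋃ j, closure (D.hole j)

/-- A (conforming) triangulation of `Ω`: finitely many nondegenerate closed triangles, each given
by its set of three vertices, which cover exactly the closure of `Ω`, any two of which meet in the
convex hull of their common vertices (nothing, a vertex or a full edge, for different ones). -/
structure Triangulation (Ω : Set Plane) where
  cells : Finset (Finset Plane)
  card_eq : ∀ K ∈ cells, K.card = 3
  affineIndependent : ∀ K ∈ cells, AffineIndependent ℝ ((↑) : K → Plane)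
  cover : closure Ω = ⋃ K ∈ cells, convexHull ℝ (K : Set Plane)
  conforming : ∀ K ∈ cells, ∀ L ∈ cells,
    convexHull ℝ (K : Set Plane) ∩ convexHull ℝ (L : Set Plane) =
      convexHull ℝ ((K : Set Plane) ∩ (L : Set Plane))

/-! ### Sobolev spaces -/

/-- Scalar `L²(Ω)`. -/
abbrev L2 (Ω : Set Plane) := Lp ℝ 2 (volume.restrict Ω)

/-- Vector valued `L²(Ω)`. -/
abbrev L2Vec (Ω : Set Plane) := Lp Plane 2 (volume.restrict Ω)

/-- The partial derivative `∂ᵢ φ`. -/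
def partialD (i : Fin 2) (φ : Plane → ℝ) (x : Plane) : ℝ :=
  fderiv ℝ φ x (EuclideanSpace.single i 1)

/-- `φ ∈ C_c^∞(U)`. -/
structure IsTest (U : Set Plane) (φ : Plane → ℝ) : Prop where
  contDiff : ContDiff ℝ ∞ φ
  compact : HasCompactSupport φ
  subset : tsupport φ ⊆ U

/-- `g = ∇ w` weakly in `Ω`. -/
def HasWeakGrad (Ω : Set Plane) (w : L2 Ω) (g : L2Vec Ω) : Prop :=
  ∀ φ, IsTest Ω φ → ∀ i : Fin 2,
    ∫ x in Ω, w x * partialD i φ x = -∫ x in Ω, g x i * φ x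

/-- Green's formula `∫_Ω (τ₀ ∂₁φ - τ₁ ∂₀φ) = ∫_Ω r φ` for all `φ ∈ C_c^∞(U)`. -/
def GreenRot (Ω U : Set Plane) (τ : L2Vec Ω) (r : L2 Ω) : Prop :=
  ∀ φ, IsTest U φ →
    ∫ x in Ω, (τ x 0 * partialD 1 φ x - τ x 1 * partialD 0 φ x) = ∫ x in Ω, r x * φ x

/-- `r = rot τ = ∂₀τ₁ - ∂₁τ₀` weakly in `Ω`. -/
def HasWeakRot (Ω : Set Plane) (τ : L2Vec Ω) (r : L2 Ω) : Prop := GreenRot Ω Ω τ r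

/-- `w ∈ H¹(Ω)` has the trace `γ` on the curve `S ⊆ ∂Ω`: some smooth functions converge to `w` in
`H¹(Ω)` while their restrictions to `S` converge to `γ` in `L²(S)`, with respect to arc length. -/
def HasTrace (Ω : Set Plane) (w : L2 Ω) (S : Set Plane) (γ : Plane → ℝ) : Prop :=
  ∃ g : L2Vec Ω, HasWeakGrad Ω w g ∧ ∃ φ : ℕ → Plane → ℝ,
    (∀ n, ContDiff ℝ ∞ (φ n)) ∧
    Tendsto (fun n => eLpNorm (fun x => φ n x - w x) 2 (volume.restrict Ω)) atTop (𝓝 0) ∧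
    Tendsto (fun n => eLpNorm (fun x => gradient (φ n) x - g x) 2 (volume.restrict Ω))
      atTop (𝓝 0) ∧
    Tendsto (fun n => eLpNorm (fun x => φ n x - γ x) 2 ((Measure.hausdorffMeasure 1).restrict S))
      atTop (𝓝 0)

section helpers

variable {Ω U : Set Plane} {φ : Plane → ℝ}

lemma partialD_eq (i : Fin 2) (hφ : ContDiff ℝ ∞ φ) : Continuous (partialD i φ) :=
  (hφ.continuous_fderiv (by simp)).clm_apply continuous_const

lemma IsTest.memLp (h : IsTest U φ) : MemLp φ 2 (volume.restrict Ω) :=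
  (h.contDiff.continuous.memLp_of_hasCompactSupport h.compact).restrict Ω

lemma IsTest.memLp_partialD (h : IsTest U φ) (i : Fin 2) :
    MemLp (partialD i φ) 2 (volume.restrict Ω) :=
  ((partialD_eq i h.contDiff).memLp_of_hasCompactSupport
    (h.compact.fderiv_apply (𝕜 := ℝ) _)).restrict Ω

lemma memLp_coord (g : L2Vec Ω) (i : Fin 2) : MemLp (fun x => g x i) 2 (volume.restrict Ω) :=
  (EuclideanSpace.proj (𝕜 := ℝ) i).comp_memLp' (Lp.memLp g)

lemma integrable_mul_of_memLp {f g : Plane → ℝ} (hf : MemLp f 2 (volume.restrict Ω))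
    (hg : MemLp g 2 (volume.restrict Ω)) : Integrable (fun x => f x * g x) (volume.restrict Ω) :=
  hf.integrable_mul hg

lemma HasWeakGrad.add {w w' : L2 Ω} {g g' : L2Vec Ω} (h : HasWeakGrad Ω w g)
    (h' : HasWeakGrad Ω w' g') : HasWeakGrad Ω (w + w') (g + g') := by
  intro φ hφ i
  have e1 : ∫ x in Ω, (w + w' : L2 Ω) x * partialD i φ x =
      ∫ x in Ω, (w x * partialD i φ x + w' x * partialD i φ x) := by
    refine integral_congr_ae ?_
    filter_upwards [Lp.coeFn_add w w'] with x hx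
    rw [hx, Pi.add_apply, add_mul]
  have e2 : ∫ x in Ω, (g + g' : L2Vec Ω) x i * φ x =
      ∫ x in Ω, (g x i * φ x + g' x i * φ x) := by
    refine integral_congr_ae ?_
    filter_upwards [Lp.coeFn_add g g'] with x hx
    rw [hx, Pi.add_apply, PiLp.add_apply, add_mul]
  rw [e1, e2, integral_add, integral_add, h φ hφ i, h' φ hφ i]
  · ring
  · exact integrable_mul_of_memLp (memLp_coord g i) hφ.memLp
  · exact integrable_mul_of_memLp (memLp_coord g' i) hφ.memLp
  · exact integrable_mul_of_memLp (Lp.memLp w) (hφ.memLp_partialD i)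
  · exact integrable_mul_of_memLp (Lp.memLp w') (hφ.memLp_partialD i)

lemma HasWeakGrad.smul {w : L2 Ω} {g : L2Vec Ω} (c : ℝ) (h : HasWeakGrad Ω w g) :
    HasWeakGrad Ω (c • w) (c • g) := by
  intro φ hφ i
  have e1 : ∫ x in Ω, (c • w : L2 Ω) x * partialD i φ x =
      ∫ x in Ω, c * (w x * partialD i φ x) := by
    refine integral_congr_ae ?_
    filter_upwards [Lp.coeFn_smul c w] with x hx
    rw [hx, Pi.smul_apply, smul_eq_mul, mul_assoc]
  have e2 : ∫ x in Ω, (c • g : L2Vec Ω) x i * φ x = ∫ x in Ω, c * (g x i * φ x) := by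
    refine integral_congr_ae ?_
    filter_upwards [Lp.coeFn_smul c g] with x hx
    rw [hx, Pi.smul_apply, PiLp.smul_apply, smul_eq_mul, mul_assoc]
  rw [e1, e2, integral_const_mul, integral_const_mul, h φ hφ i]
  ring

lemma HasWeakGrad.zero : HasWeakGrad Ω 0 0 := by
  intro φ _ i
  have e1 : ∫ x in Ω, (0 : L2 Ω) x * partialD i φ x = 0 := by
    refine integral_eq_zero_of_ae ?_
    filter_upwards [Lp.coeFn_zero ℝ 2 (volume.restrict Ω)] with x hx
    rw [hx]
    simp
  have e2 : ∫ x in Ω, (0 : L2Vec Ω) x i * φ x = 0 := by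
    refine integral_eq_zero_of_ae ?_
    filter_upwards [Lp.coeFn_zero Plane 2 (volume.restrict Ω)] with x hx
    rw [hx]
    simp
  rw [e1, e2, neg_zero]

lemma GreenRot.integrable (hφ : IsTest U φ) (τ : L2Vec Ω) :
    Integrable (fun x => τ x 0 * partialD 1 φ x - τ x 1 * partialD 0 φ x)
      (volume.restrict Ω) :=
  (integrable_mul_of_memLp (memLp_coord τ 0) (hφ.memLp_partialD 1)).sub
    (integrable_mul_of_memLp (memLp_coord τ 1) (hφ.memLp_partialD 0))

lemma GreenRot.add {τ τ' : L2Vec Ω} {r r' : L2 Ω} (h : GreenRot Ω U τ r)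
    (h' : GreenRot Ω U τ' r') : GreenRot Ω U (τ + τ') (r + r') := by
  intro φ hφ
  have e1 : ∫ x in Ω, ((τ + τ' : L2Vec Ω) x 0 * partialD 1 φ x
        - (τ + τ' : L2Vec Ω) x 1 * partialD 0 φ x) =
      ∫ x in Ω, ((τ x 0 * partialD 1 φ x - τ x 1 * partialD 0 φ x)
        + (τ' x 0 * partialD 1 φ x - τ' x 1 * partialD 0 φ x)) := by
    refine integral_congr_ae ?_
    filter_upwards [Lp.coeFn_add τ τ'] with x hx
    rw [hx, Pi.add_apply, PiLp.add_apply, PiLp.add_apply]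
    ring
  have e2 : ∫ x in Ω, (r + r' : L2 Ω) x * φ x = ∫ x in Ω, (r x * φ x + r' x * φ x) := by
    refine integral_congr_ae ?_
    filter_upwards [Lp.coeFn_add r r'] with x hx
    rw [hx, Pi.add_apply, add_mul]
  rw [e1, e2, integral_add (GreenRot.integrable hφ τ) (GreenRot.integrable hφ τ'), h φ hφ,
    h' φ hφ, integral_add (integrable_mul_of_memLp (Lp.memLp r) hφ.memLp)
      (integrable_mul_of_memLp (Lp.memLp r') hφ.memLp)]

lemma GreenRot.smul {τ : L2Vec Ω} {r : L2 Ω} (c : ℝ) (h : GreenRot Ω U τ r) :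
    GreenRot Ω U (c • τ) (c • r) := by
  intro φ hφ
  have e1 : ∫ x in Ω, ((c • τ : L2Vec Ω) x 0 * partialD 1 φ x
        - (c • τ : L2Vec Ω) x 1 * partialD 0 φ x) =
      ∫ x in Ω, c * (τ x 0 * partialD 1 φ x - τ x 1 * partialD 0 φ x) := by
    refine integral_congr_ae ?_
    filter_upwards [Lp.coeFn_smul c τ] with x hx
    rw [hx, Pi.smul_apply, PiLp.smul_apply, PiLp.smul_apply]
    simp only [smul_eq_mul]
    ring
  have e2 : ∫ x in Ω, (c • r : L2 Ω) x * φ x = ∫ x in Ω, c * (r x * φ x) := by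
    refine integral_congr_ae ?_
    filter_upwards [Lp.coeFn_smul c r] with x hx
    rw [hx, Pi.smul_apply, smul_eq_mul, mul_assoc]
  rw [e1, e2, integral_const_mul, integral_const_mul, h φ hφ]

lemma GreenRot.zero : GreenRot Ω U 0 0 := by
  intro φ _
  have e1 : ∫ x in Ω, ((0 : L2Vec Ω) x 0 * partialD 1 φ x
      - (0 : L2Vec Ω) x 1 * partialD 0 φ x) = 0 := by
    refine integral_eq_zero_of_ae ?_
    filter_upwards [Lp.coeFn_zero Plane 2 (volume.restrict Ω)] with x hx
    rw [hx]
    simp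
  have e2 : ∫ x in Ω, (0 : L2 Ω) x * φ x = 0 := by
    refine integral_eq_zero_of_ae ?_
    filter_upwards [Lp.coeFn_zero ℝ 2 (volume.restrict Ω)] with x hx
    rw [hx]
    simp
  rw [e1, e2]

lemma tendsto_eLpNorm_add {E : Type*} [NormedAddCommGroup E] {μ : Measure Plane}
    {u v : ℕ → Plane → E} (hu : ∀ n, AEStronglyMeasurable (u n) μ)
    (hv : ∀ n, AEStronglyMeasurable (v n) μ)
    (h : Tendsto (fun n => eLpNorm (u n) 2 μ) atTop (𝓝 0))
    (h' : Tendsto (fun n => eLpNorm (v n) 2 μ) atTop (𝓝 0)) :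
    Tendsto (fun n => eLpNorm (u n + v n) 2 μ) atTop (𝓝 0) := by
  have := h.add h'
  rw [add_zero] at this
  exact tendsto_of_tendsto_of_tendsto_of_le_of_le tendsto_const_nhds this
    (fun _ => zero_le) (fun n => eLpNorm_add_le (hu n) (hv n) (by norm_num))

lemma tendsto_eLpNorm_smul {E : Type*} [NormedAddCommGroup E] [NormedSpace ℝ E]
    {μ : Measure Plane} {u : ℕ → Plane → E} (c : ℝ)
    (h : Tendsto (fun n => eLpNorm (u n) 2 μ) atTop (𝓝 0)) :
    Tendsto (fun n => eLpNorm (c • u n) 2 μ) atTop (𝓝 0) := by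
  have := ENNReal.Tendsto.const_mul (a := ‖c‖ₑ) h (Or.inr (by simp))
  rw [mul_zero] at this
  refine this.congr fun n => ?_
  rw [eLpNorm_const_smul]

lemma gradient_continuous (hφ : ContDiff ℝ ∞ φ) : Continuous (gradient φ) :=
  (InnerProductSpace.toDual ℝ Plane).symm.continuous.comp (hφ.continuous_fderiv (by simp))

lemma HasTrace.add {w w' : L2 Ω} {S : Set Plane} {c c' : ℝ}
    (h : HasTrace Ω w S fun _ => c) (h' : HasTrace Ω w' S fun _ => c') :
    HasTrace Ω (w + w') S fun _ => c + c' := by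
  obtain ⟨g, hg, φ, hφ, h1, h2, h3⟩ := h
  obtain ⟨g', hg', φ', hφ', h1', h2', h3'⟩ := h'
  refine ⟨g + g', hg.add hg', fun n x => φ n x + φ' n x, fun n => (hφ n).add (hφ' n), ?_, ?_, ?_⟩
  · refine (tendsto_eLpNorm_add
      (fun n => (hφ n).continuous.aestronglyMeasurable.sub (Lp.aestronglyMeasurable w))
      (fun n => (hφ' n).continuous.aestronglyMeasurable.sub (Lp.aestronglyMeasurable w'))
      h1 h1').congr fun n => eLpNorm_congr_ae ?_
    filter_upwards [Lp.coeFn_add w w'] with x hx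
    simp only [hx, Pi.add_apply, Pi.sub_apply]
    ring
  · refine (tendsto_eLpNorm_add
      (fun n => (gradient_continuous (hφ n)).aestronglyMeasurable.sub (Lp.aestronglyMeasurable g))
      (fun n => (gradient_continuous (hφ' n)).aestronglyMeasurable.sub
        (Lp.aestronglyMeasurable g'))
      h2 h2').congr fun n => eLpNorm_congr_ae ?_
    filter_upwards [Lp.coeFn_add g g'] with x hx
    have e : gradient (fun y => φ n y + φ' n y) x = gradient (φ n) x + gradient (φ' n) x := by
      have hd := ((hφ n).differentiable (by simp)) x
      have hd' := ((hφ' n).differentiable (by simp)) x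
      simp only [gradient]
      rw [fderiv_fun_add hd hd', map_add]
    simp only [hx, e, Pi.add_apply, Pi.sub_apply]
    abel
  · refine (tendsto_eLpNorm_add
      (fun n => ((hφ n).continuous.sub continuous_const).aestronglyMeasurable)
      (fun n => ((hφ' n).continuous.sub continuous_const).aestronglyMeasurable)
      h3 h3').congr fun n => ?_
    congr 1
    ext x
    simp only [Pi.add_apply, Pi.sub_apply]
    ring

lemma HasTrace.smul {w : L2 Ω} {S : Set Plane} {c : ℝ} (a : ℝ)
    (h : HasTrace Ω w S fun _ => c) : HasTrace Ω (a • w) S fun _ => a * c := by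
  obtain ⟨g, hg, φ, hφ, h1, h2, h3⟩ := h
  refine ⟨a • g, hg.smul a, fun n x => a * φ n x, fun n => contDiff_const.mul (hφ n), ?_, ?_, ?_⟩
  · refine (tendsto_eLpNorm_smul a h1).congr fun n => eLpNorm_congr_ae ?_
    filter_upwards [Lp.coeFn_smul a w] with x hx
    simp only [hx, Pi.smul_apply, smul_eq_mul]
    ring
  · refine (tendsto_eLpNorm_smul a h2).congr fun n => eLpNorm_congr_ae ?_
    filter_upwards [Lp.coeFn_smul a g] with x hx
    have e : gradient (fun y => a * φ n y) x = a • gradient (φ n) x := by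
      have hd := ((hφ n).differentiable (by simp)) x
      simp only [gradient]
      rw [fderiv_const_mul hd, map_smulₛₗ]
      simp
    simp only [hx, e, Pi.smul_apply, smul_sub]
  · refine (tendsto_eLpNorm_smul a h3).congr fun n => ?_
    congr 1
    ext x
    simp only [Pi.smul_apply, smul_eq_mul]
    ring

lemma HasTrace.zero (S : Set Plane) : HasTrace Ω 0 S fun _ => 0 := by
  refine ⟨0, HasWeakGrad.zero, fun _ _ => 0, fun _ => contDiff_const, ?_, ?_, ?_⟩
  · refine tendsto_const_nhds.congr fun n => ?_
    rw [eq_comm, eLpNorm_congr_ae (g := fun _ => (0 : ℝ)), eLpNorm_zero']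
    filter_upwards [Lp.coeFn_zero ℝ 2 (volume.restrict Ω)] with x hx
    rw [hx]
    simp
  · refine tendsto_const_nhds.congr fun n => ?_
    rw [eq_comm, eLpNorm_congr_ae (g := fun _ => (0 : Plane)), eLpNorm_zero']
    filter_upwards [Lp.coeFn_zero Plane 2 (volume.restrict Ω)] with x hx
    rw [hx]
    simp [gradient]
  · simp

end helpers

/-- `H¹(Ω)`. -/
def H1 (Ω : Set Plane) : Submodule ℝ (L2 Ω) where
  carrier := {w | ∃ g, HasWeakGrad Ω w g}
  add_mem' := fun ⟨g, hg⟩ ⟨g', hg'⟩ => ⟨g + g', hg.add hg'⟩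
  zero_mem' := ⟨0, HasWeakGrad.zero⟩
  smul_mem' := fun c _ ⟨g, hg⟩ => ⟨c • g, hg.smul c⟩

/-- `H(rot, Ω)`. -/
def HRot (Ω : Set Plane) : Submodule ℝ (L2Vec Ω) where
  carrier := {τ | ∃ r, HasWeakRot Ω τ r}
  add_mem' := fun ⟨r, hr⟩ ⟨r', hr'⟩ => ⟨r + r', GreenRot.add hr hr'⟩
  zero_mem' := ⟨0, GreenRot.zero⟩
  smul_mem' := fun c _ ⟨r, hr⟩ => ⟨c • r, GreenRot.smul c hr⟩

/-- `H₀(rot, Ω)` (for a bounded Lipschitz domain): the fields with vanishing tangential trace. The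
trace of `τ` is the functional `φ ↦ ∫_Ω rot τ φ - ∫_Ω (τ₀ ∂₁φ - τ₁ ∂₀φ)` on smooth functions up to
the boundary; it vanishes iff Green's formula holds for all of `C_c^∞(ℝ²)`. -/
def HRot0 (Ω : Set Plane) : Submodule ℝ (L2Vec Ω) where
  carrier := {τ | ∃ r, HasWeakRot Ω τ r ∧ GreenRot Ω Set.univ τ r}
  add_mem' := fun ⟨r, hr, hb⟩ ⟨r', hr', hb'⟩ => ⟨r + r', GreenRot.add hr hr', hb.add hb'⟩
  zero_mem' := ⟨0, GreenRot.zero, GreenRot.zero⟩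
  smul_mem' := fun c _ ⟨r, hr, hb⟩ => ⟨c • r, GreenRot.smul c hr, hb.smul c⟩

namespace MultiplyConnectedPolygon

variable {J : ℕ} (D : MultiplyConnectedPolygon J)

instance isFiniteMeasure_restrict : IsFiniteMeasure (volume.restrict D.domain) := by
  have h : Bornology.IsBounded D.domain := D.outer_polygon.isBounded.subset Set.sdiff_subset
  exact ⟨by simpa using h.measure_lt_top⟩

/-- `H¹_C(Ω)`: the functions in `H¹(Ω)` with trace zero on the outer boundary curve and constant
trace on the boundary curve of each hole. -/
def H1C : Submodule ℝ (L2 D.domain) where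
  carrier := {w | w ∈ H1 D.domain ∧ HasTrace D.domain w (frontier D.outer) (fun _ => 0) ∧
    ∀ j, ∃ c : ℝ, HasTrace D.domain w (frontier (D.hole j)) fun _ => c}
  add_mem' := by
    rintro w w' ⟨h, h0, hj⟩ ⟨h', h0', hj'⟩
    refine ⟨(H1 D.domain).add_mem h h', by simpa using h0.add h0', fun j => ?_⟩
    obtain ⟨c, hc⟩ := hj j
    obtain ⟨c', hc'⟩ := hj' j
    exact ⟨c + c', hc.add hc'⟩
  zero_mem' := ⟨(H1 D.domain).zero_mem, HasTrace.zero _, fun _ => ⟨0, HasTrace.zero _⟩⟩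
  smul_mem' := by
    rintro a w ⟨h, h0, hj⟩
    refine ⟨(H1 D.domain).smul_mem a h, by simpa using h0.smul a, fun j => ?_⟩
    obtain ⟨c, hc⟩ := hj j
    exact ⟨a * c, hc.smul a⟩

/-- `L²₀(Ω)`: mean value zero. -/
def L2Zero : Submodule ℝ (L2 D.domain) where
  carrier := {q | ∫ x in D.domain, q x = 0}
  add_mem' := by
    intro q q' h h'
    simp only [Set.mem_ofPred_eq] at h h' ⊢
    rw [integral_congr_ae (Lp.coeFn_add q q')]
    simp only [Pi.add_apply]
    rw [integral_add ((Lp.memLp q).integrable (by norm_num))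
      ((Lp.memLp q').integrable (by norm_num)), h, h', add_zero]
  zero_mem' := by
    simp only [Set.mem_ofPred_eq]
    rw [integral_congr_ae (Lp.coeFn_zero ℝ 2 _)]
    simp
  smul_mem' := by
    intro c q h
    simp only [Set.mem_ofPred_eq] at h ⊢
    rw [integral_congr_ae (Lp.coeFn_smul c q)]
    simp only [Pi.smul_apply]
    rw [integral_smul, h, smul_zero]

end MultiplyConnectedPolygon

/-! ### Finite element spaces -/

namespace Triangulation

variable {Ω : Set Plane} (T : Triangulation Ω)

/-- The functions that are affine (`P₁`) on each triangle. -/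
def piecewiseP1 : Submodule ℝ (L2 Ω) where
  carrier := {w | ∀ K ∈ T.cells, ∃ (a : ℝ) (b : Plane), ∀ᵐ x ∂(volume.restrict Ω),
    x ∈ convexHull ℝ (K : Set Plane) → w x = a + (b 0 * x 0 + b 1 * x 1)}
  add_mem' := by
    intro w w' h h' K hK
    obtain ⟨a, b, hb⟩ := h K hK
    obtain ⟨a', b', hb'⟩ := h' K hK
    refine ⟨a + a', b + b', ?_⟩
    filter_upwards [hb, hb', Lp.coeFn_add w w'] with x h1 h2 h3 hx
    rw [h3, Pi.add_apply, h1 hx, h2 hx, PiLp.add_apply, PiLp.add_apply]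
    ring
  zero_mem' := by
    intro K _
    refine ⟨0, 0, ?_⟩
    filter_upwards [Lp.coeFn_zero ℝ 2 (volume.restrict Ω)] with x hx _
    rw [hx]
    simp
  smul_mem' := by
    intro c w h K hK
    obtain ⟨a, b, hb⟩ := h K hK
    refine ⟨c * a, c • b, ?_⟩
    filter_upwards [hb, Lp.coeFn_smul c w] with x h1 h2 hx
    rw [h2, Pi.smul_apply, h1 hx, PiLp.smul_apply, PiLp.smul_apply]
    simp only [smul_eq_mul]
    ring

/-- The fields of the form `u + v x^⊥`, `x^⊥ = (-x₁, x₀)`, on each triangle. -/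
def piecewiseE : Submodule ℝ (L2Vec Ω) where
  carrier := {τ | ∀ K ∈ T.cells, ∃ (u : Plane) (v : ℝ), ∀ᵐ x ∂(volume.restrict Ω),
    x ∈ convexHull ℝ (K : Set Plane) → τ x = u + v • (!₂[-x 1, x 0] : Plane)}
  add_mem' := by
    intro τ τ' h h' K hK
    obtain ⟨u, v, hb⟩ := h K hK
    obtain ⟨u', v', hb'⟩ := h' K hK
    refine ⟨u + u', v + v', ?_⟩
    filter_upwards [hb, hb', Lp.coeFn_add τ τ'] with x h1 h2 h3 hx
    rw [h3, Pi.add_apply, h1 hx, h2 hx, add_smul]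
    abel
  zero_mem' := by
    intro K _
    refine ⟨0, 0, ?_⟩
    filter_upwards [Lp.coeFn_zero Plane 2 (volume.restrict Ω)] with x hx _
    rw [hx]
    simp
  smul_mem' := by
    intro c τ h K hK
    obtain ⟨u, v, hb⟩ := h K hK
    refine ⟨c • u, c * v, ?_⟩
    filter_upwards [hb, Lp.coeFn_smul c τ] with x h1 h2 hx
    rw [h2, Pi.smul_apply, h1 hx, smul_add, smul_smul]

/-- The space of piecewise constants. -/
def piecewiseP0 : Submodule ℝ (L2 Ω) where
  carrier := {q | ∀ K ∈ T.cells, ∃ a : ℝ, ∀ᵐ x ∂(volume.restrict Ω),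
    x ∈ convexHull ℝ (K : Set Plane) → q x = a}
  add_mem' := by
    intro q q' h h' K hK
    obtain ⟨a, hb⟩ := h K hK
    obtain ⟨a', hb'⟩ := h' K hK
    refine ⟨a + a', ?_⟩
    filter_upwards [hb, hb', Lp.coeFn_add q q'] with x h1 h2 h3 hx
    rw [h3, Pi.add_apply, h1 hx, h2 hx]
  zero_mem' := by
    intro K _
    refine ⟨0, ?_⟩
    filter_upwards [Lp.coeFn_zero ℝ 2 (volume.restrict Ω)] with x hx _
    rw [hx]
    simp
  smul_mem' := by
    intro c q h K hK
    obtain ⟨a, hb⟩ := h K hK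
    refine ⟨c * a, ?_⟩
    filter_upwards [hb, Lp.coeFn_smul c q] with x h1 h2 hx
    rw [h2, Pi.smul_apply, h1 hx, smul_eq_mul]

/-- The conforming `P₁` space `L_h`. -/
def Lh : Submodule ℝ (L2 Ω) := H1 Ω ⊓ T.piecewiseP1

/-- The lowest order rotated Raviart-Thomas space `R_h`. -/
def Rh : Submodule ℝ (L2Vec Ω) := HRot Ω ⊓ T.piecewiseE

/-- `R_{h0} = R_h ∩ H₀(rot, Ω)`. -/
def Rh0 : Submodule ℝ (L2Vec Ω) := T.Rh ⊓ HRot0 Ω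

end Triangulation

/-- `L_{hC} = L_h ∩ H¹_C(Ω)`. -/
def LhC {J : ℕ} (D : MultiplyConnectedPolygon J) (T : Triangulation D.domain) :
    Submodule ℝ (L2 D.domain) := T.Lh ⊓ D.H1C

/-- `L⁰_{h0}`: the piecewise constants with mean value zero. -/
def L0h0 {J : ℕ} (D : MultiplyConnectedPolygon J) (T : Triangulation D.domain) :
    Submodule ℝ (L2 D.domain) := T.piecewiseP0 ⊓ D.L2Zero

end PlateComplex

end

open MeasureTheory Filter Topology
open scoped ContDiff ENNReal

noncomputable section

namespace PlateComplex

open Metric Set AffineMap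

section

/-! ### Half planes and segments -/

/-! One integral identity carries the analysis. On a triangle with vertices `p`, `a`, `b`, the
divergence theorem for `(x - p) φ` sees only the edge opposite `p`, since the field is tangent to
the other two edges (`setIntegral_triangle_radial`). Turned by a right angle, it says that `(x -
p)^⊥` has constant rotation and a tangential trace living on a single edge. Linear combinations give
Green's formula for constant fields (`setIntegral_const_field`), and inserting `ψ²` gives the trace
inequality (`edgeMean_sq_le`).

Surjectivity of rot: for two triangles with a common edge, the normalized Whitney fields belonging
to that edge have the same boundary contribution. Their difference therefore lies in `R_{h0}` and
has rotation `1_K/|K| - 1_L/|L|` (`cellUnit_sub_mem`). The domain stays connected when the vertices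
are removed, so any two cells are linked through common edges, and these differences span the
piecewise constants of mean zero. Conversely, testing with a cutoff that is 1 on the domain shows
that every rotation has mean zero.

Kernel of rot: an irrotational field in `R_{h0}` is constant on each triangle, and its zero
tangential trace makes the extension by zero irrotational in the whole plane. There the holes cause
no periods, and mollification together with the Poincaré lemma yields a Lipschitz potential
(`exists_lipschitz_potential`). The potential is affine on each cell and constant on each hole and
on the exterior, because these are connected and the extended field vanishes there. Normalized to 0
in the exterior, it restricts to an element of `L_{hC}` (`exists_grad_eq`).

The gradient lands in `R_{h0}`: testing a piecewise constant gradient gives a sum over edges of a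
coefficient times the mean of the test function. The coefficient vanishes at edges that enter the
domain, because a weak gradient is irrotational there. It vanishes at the other edges because the
function is affine along them and its traces allow only finitely many values (`grad_mem`).

Injectivity: a function with zero gradient is constant on the connected domain, and its trace
vanishes on the outer curve, which has positive length (`eq_zero_of_grad_eq_zero`).

The topology comes from two facts about a simple polygon. Removing all edges but one does not
disconnect an open connected set around it (`isPreconnected_diff_edges`). The winding number jumps
by one across an edge, so a polygon interior lies on exactly one side of each edge (`one_side`).
Hence closed polygons do not separate, the domain and the exterior are connected, and every boundary
point of a polygon is a limit of exterior points. -/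

/-- The determinant of two plane vectors. -/
def cross (u v : Plane) : ℝ := u 0 * v 1 - u 1 * v 0

/-- The open half plane to the left of the line through `a` with direction `v`. -/
def leftOf (a v : Plane) : Set Plane := {y | 0 < cross v (y - a)}

lemma continuous_coord (i : Fin 2) : Continuous fun x : Plane => x i :=
  (EuclideanSpace.proj (𝕜 := ℝ) i).continuous

lemma convex_leftOf (a v : Plane) : Convex ℝ (leftOf a v) := by
  intro x hx y hy s t hs ht hst
  simp only [leftOf, mem_ofPred_eq, cross, PiLp.sub_apply, PiLp.add_apply, PiLp.smul_apply,
    smul_eq_mul] at *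
  have : v 0 * (s * x 1 + t * y 1 - a 1) - v 1 * (s * x 0 + t * y 0 - a 0) =
      s * (v 0 * (x 1 - a 1) - v 1 * (x 0 - a 0)) +
      t * (v 0 * (y 1 - a 1) - v 1 * (y 0 - a 0)) := by
    linear_combination (v 0 * a 1 - v 1 * a 0) * hst
  rw [this]
  rcases hs.eq_or_lt with rfl | hs
  · have : t = 1 := by linarith
    subst this
    linarith
  · have := mul_pos hs hx
    have := mul_nonneg ht hy.le
    linarith

lemma plane_ext {x y : Plane} (h0 : x 0 = y 0) (h1 : x 1 = y 1) : x = y := by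
  ext i
  fin_cases i
  · exact h0
  · exact h1

lemma lineMap_coord (a b : Plane) (t : ℝ) (i : Fin 2) :
    lineMap a b t i = a i + t * (b i - a i) := by
  simp [lineMap_apply]
  ring

lemma cross_lineMap (a b : Plane) (t : ℝ) : cross (b - a) (lineMap a b t - a) = 0 := by
  simp only [cross, PiLp.sub_apply, lineMap_coord]
  ring

lemma sq_add_sq_pos_of_ne {a b : Plane} (h : a ≠ b) :
    0 < (b 0 - a 0) ^ 2 + (b 1 - a 1) ^ 2 := by
  by_contra hc
  refine h (plane_ext ?_ ?_) <;> nlinarith [sq_nonneg (b 0 - a 0), sq_nonneg (b 1 - a 1)]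

/-- Moving `x` a little along the left normal of `v` strictly increases the determinant and stays in
the open set `Y`. -/
lemma mem_closure_leftOf {a v x : Plane} (hv : v ≠ 0) (hx : 0 ≤ cross v (x - a)) {Y : Set Plane}
    (hY : IsOpen Y) (hxY : x ∈ Y) : x ∈ closure (Y ∩ leftOf a v) := by
  have hv' : 0 < v 0 ^ 2 + v 1 ^ 2 := by
    have := sq_add_sq_pos_of_ne hv.symm
    simpa using this
  have hc : Tendsto (fun t : ℝ => x + t • (!₂[-v 1, v 0] : Plane)) (𝓝[>] 0) (𝓝 x) := by
    have : Continuous (fun t : ℝ => x + t • (!₂[-v 1, v 0] : Plane)) := by fun_prop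
    have := this.tendsto 0
    simp only [zero_smul, add_zero] at this
    exact this.mono_left nhdsWithin_le_nhds
  refine mem_closure_of_tendsto hc ?_
  filter_upwards [hc (hY.mem_nhds hxY), self_mem_nhdsWithin] with t ht ht0
  refine ⟨ht, ?_⟩
  have ht0 : 0 < t := ht0
  simp only [leftOf, mem_ofPred_eq, cross, PiLp.sub_apply, PiLp.add_apply, PiLp.smul_apply,
    smul_eq_mul, Matrix.cons_val_zero, Matrix.cons_val_one] at *
  nlinarith [mul_pos ht0 hv']

/-- A point of `Y` on the line is approached from both sides, so dropping the line costs nothing in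
the closure. Questions about closures thus reduce to one side of an edge at a time. -/
lemma closure_subset_closure_leftOf {a v : Plane} (hv : v ≠ 0) {Y : Set Plane} (hY : IsOpen Y) :
    closure Y ⊆ closure (Y ∩ leftOf a v) ∪ closure (Y ∩ leftOf a (-v)) := by
  rw [← closure_union]
  refine closure_minimal (fun y hy => ?_) isClosed_closure
  rw [closure_union]
  rcases le_total 0 (cross v (y - a)) with h | h
  · exact Or.inl (mem_closure_leftOf hv h hY hy)
  · refine Or.inr (mem_closure_leftOf (neg_ne_zero.2 hv) ?_ hY hy)
    simp only [cross, PiLp.neg_apply] at *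
    linarith

lemma lineMap_notMem_leftOf (a b : Plane) (t : ℝ) : lineMap a b t ∉ leftOf a (b - a) := by
  simp [leftOf, cross_lineMap]

lemma lineMap_notMem_leftOf_neg (a b : Plane) (t : ℝ) :
    lineMap a b t ∉ leftOf a (-(b - a)) := by
  have := cross_lineMap a b t
  simp only [leftOf, cross, mem_ofPred_eq, PiLp.neg_apply] at *
  linarith

lemma lineMap_injective_of_ne {a b : Plane} (h : a ≠ b) :
    Function.Injective (fun t : ℝ => lineMap a b t) := fun s t hst => by
  have h0 := congrArg (fun x : Plane => x 0) hst
  have h1 := congrArg (fun x : Plane => x 1) hst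
  simp only [lineMap_coord] at h0 h1
  have := sq_add_sq_pos_of_ne h
  have : (s - t) * ((b 0 - a 0) ^ 2 + (b 1 - a 1) ^ 2) = 0 := by
    linear_combination (b 0 - a 0) * h0 + (b 1 - a 1) * h1
  rcases mul_eq_zero.1 this with h | h <;> linarith

lemma mem_segment_iff_lineMap {a b x : Plane} :
    x ∈ segment ℝ a b ↔ ∃ t ∈ Icc (0 : ℝ) 1, lineMap a b t = x := by
  rw [segment_eq_image_lineMap]
  rfl

lemma isCompact_segment (a b : Plane) : IsCompact (segment ℝ a b) := by
  rw [segment_eq_image_lineMap]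
  exact isCompact_Icc.image lineMap_continuous

lemma isClosed_segment (a b : Plane) : IsClosed (segment ℝ a b) := (isCompact_segment a b).isClosed

/-! ### Walking along a curve -/

/-- An open set is preconnected iff it is not the union of two disjoint nonempty open sets. -/
lemma isPreconnected_of_isOpen {M : Set Plane} (hM : IsOpen M)
    (h : ∀ X Y : Set Plane, IsOpen X → IsOpen Y → Disjoint X Y → X ∪ Y = M →
      X = ∅ ∨ Y = ∅) : IsPreconnected M := by
  rw [isPreconnected_iff_subset_of_disjoint]
  intro X Y hX hY hXY hd
  have hcov : (M ∩ X) ∪ (M ∩ Y) = M := by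
    rw [← inter_union_distrib_left]
    exact inter_eq_left.2 hXY
  have hdis : Disjoint (M ∩ X) (M ∩ Y) := by
    rw [Set.disjoint_iff_inter_eq_empty, ← hd]
    ext x
    simp only [mem_inter_iff]
    tauto
  rcases h _ _ (hM.inter hX) (hM.inter hY) hdis hcov with h | h
  · right
    rw [h, empty_union] at hcov
    exact inter_eq_left.1 hcov
  · left
    rw [h, union_empty] at hcov
    exact inter_eq_left.1 hcov

/-- Walking along a curve on one side of which the plane is split into two open sets `X`, `Y`:
`Y` touches the curve from this side everywhere or nowhere. -/
lemma closure_inter_all_or_none {I : Set ℝ} (hI : IsPreconnected I) {γ : ℝ → Plane}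
    (hγ : Continuous γ) {X Y S : Set Plane} (hX : IsOpen X) (hY : IsOpen Y) (hXY : Disjoint X Y)
    (hS : Convex ℝ S) (hγS : ∀ t ∈ I, γ t ∈ closure S)
    (hb : ∀ t ∈ I, ∃ ε > 0, ball (γ t) ε ∩ S ⊆ X ∪ Y) :
    (∀ t ∈ I, γ t ∈ closure (Y ∩ S)) ∨ ∀ t ∈ I, γ t ∉ closure (Y ∩ S) := by
  -- `G` is open, and along the curve it consists of the points that `Y` touches from `S`: the
  -- convex set `ball ∩ S` lies in `X ∪ Y`, hence in `Y` once it meets `Y`. Touching is therefore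
  -- both an open and a closed condition on `I`.
  set G : Set Plane := {x | ∃ ε > 0, ball x ε ∩ S ⊆ Y}
  have hG : IsOpen G := by
    rw [Metric.isOpen_iff]
    rintro x ⟨ε, hε, h⟩
    refine ⟨ε / 2, half_pos hε, fun y hy => ⟨ε / 2, half_pos hε, fun z hz => h ⟨?_, hz.2⟩⟩⟩
    have h1 := mem_ball.1 hy
    have h2 := mem_ball.1 hz.1
    have := dist_triangle z y x
    exact mem_ball.2 (by linarith)
  have key : ∀ t ∈ I, γ t ∈ closure (Y ∩ S) ↔ γ t ∈ G := by
    intro t ht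
    constructor
    · intro h
      obtain ⟨ε, hε, hsub⟩ := hb t ht
      obtain ⟨y, hy, hyd⟩ := Metric.mem_closure_iff.1 h ε hε
      have hyb : y ∈ ball (γ t) ε ∩ S := ⟨by rwa [mem_ball, dist_comm], hy.2⟩
      have hpre : IsPreconnected (ball (γ t) ε ∩ S) := ((convex_ball _ _).inter hS).isPreconnected
      exact ⟨ε, hε, hpre.subset_right_of_subset_union hX hY hXY hsub ⟨y, hyb, hy.1⟩⟩
    · rintro ⟨ε, hε, h⟩
      have := hγS t ht
      rw [Metric.mem_closure_iff] at this ⊢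
      intro δ hδ
      obtain ⟨y, hy, hyd⟩ := this (min ε δ) (lt_min hε hδ)
      refine ⟨y, ⟨h ⟨?_, hy⟩, hy⟩, hyd.trans_le (min_le_right _ _)⟩
      rw [mem_ball, dist_comm]
      exact hyd.trans_le (min_le_left _ _)
  have := isPreconnected_iff_subset_of_disjoint.1 hI (γ ⁻¹' G) (γ ⁻¹' (closure (Y ∩ S))ᶜ)
    (hG.preimage hγ) (isClosed_closure.isOpen_compl.preimage hγ)
    (fun t ht => by
      by_cases h : γ t ∈ closure (Y ∩ S)
      · exact Or.inl ((key t ht).1 h)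
      · exact Or.inr h)
    (by
      ext t
      simp only [mem_inter_iff, mem_preimage, mem_compl_iff, mem_empty_iff_false, iff_false]
      rintro ⟨ht, h1, h2⟩
      exact h2 ((key t ht).2 h1))
  rcases this with h | h
  · exact Or.inl fun t ht => (key t ht).2 (h ht)
  · exact Or.inr fun t ht => h ht

/-- Because `ε ≤ dist p q`, the ball is slit along a full radius. The slit ball is star-shaped about
any of its points on the prolongation of the segment beyond `p`. -/
lemma isPreconnected_ball_diff_segment {p q : Plane} {ε : ℝ} (hε : 0 < ε) (h : ε ≤ dist p q) :
    IsPreconnected (ball p ε \ segment ℝ q p) := by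
  have hpq : p ≠ q := fun h' => by simp [h'] at h; linarith
  have hd : 0 < dist p q := dist_pos.2 hpq
  set η : ℝ := ε / (2 * dist p q)
  have hη : 0 < η := by positivity
  -- With this `η` the centre of the star lies at distance `ε / 2` beyond `p`.
  set c : Plane := lineMap q p (1 + η)
  have hdist : ∀ t : ℝ, dist (lineMap q p t) p = |1 - t| * dist p q := by
    intro t
    rw [dist_lineMap_right, Real.norm_eq_abs, dist_comm q p]
  have hcb : c ∈ ball p ε := by
    rw [mem_ball, hdist, show 1 - (1 + η) = -η by ring, abs_neg, abs_of_pos hη]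
    have : η * dist p q = ε / 2 := by simp only [η]; field_simp
    linarith
  have hcs : c ∉ segment ℝ q p := by
    rw [mem_segment_iff_lineMap]
    rintro ⟨t, ht, h⟩
    have := lineMap_injective_of_ne hpq.symm h
    linarith [ht.2]
  have hstar : StarConvex ℝ c (ball p ε \ segment ℝ q p) := by
    intro y hy s t hs ht hst
    refine ⟨(convex_ball p ε) hcb hy.1 hs ht hst, fun hz => hy.2 ?_⟩
    obtain ⟨r, hr, hrz⟩ := mem_segment_iff_lineMap.1 hz
    rcases ht.eq_or_lt with h0 | h0
    · subst h0
      have : s = 1 := by linarith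
      subst this
      simp only [one_smul, zero_smul, add_zero] at hz
      exact absurd hz hcs
    -- The point `s c + t y` has parameter `r` on the segment, so `y` is on the same line with the
    -- parameter obtained by solving for it. That parameter is nonnegative because `y` is in the
    -- ball and at most 1 because `c` lies beyond `p`, which puts `y` on the removed segment.
    · have hy' : lineMap q p ((r - s * (1 + η)) / t) = y := by
        have e : ∀ i : Fin 2, lineMap q p ((r - s * (1 + η)) / t) i = y i := by
          intro i
          have h1 := congrArg (fun x : Plane => x i) hrz
          simp only [c, lineMap_coord, PiLp.add_apply, PiLp.smul_apply, smul_eq_mul] at h1 ⊢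
          field_simp
          linear_combination h1 + q i * hst
        exact plane_ext (e 0) (e 1)
      refine mem_segment_iff_lineMap.2 ⟨_, ⟨?_, ?_⟩, hy'⟩
      · have := mem_ball.1 hy.1
        rw [← hy', hdist] at this
        have h2 : |1 - (r - s * (1 + η)) / t| < 1 := by
          by_contra hc
          push Not at hc
          have := mul_le_mul_of_nonneg_right hc hd.le
          linarith
        linarith [(abs_lt.1 h2).2]
      · rw [div_le_one h0]
        nlinarith [hr.2, mul_nonneg hs hη.le]
  exact (hstar.isPathConnected ⟨hcb, hcs⟩).isConnected.isPreconnected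

/-- The punctured ball is the union of two balls slit along opposite radii; the point `p + w`, in an
orthogonal direction, lies in both. -/
lemma isPreconnected_ball_diff_singleton (p : Plane) {ε : ℝ} (hε : 0 < ε) :
    IsPreconnected (ball p ε \ {p}) := by
  set v : Plane := EuclideanSpace.single 0 ε
  have hv : ‖v‖ = ε := by simp [v, abs_of_pos hε]
  have h1 : IsPreconnected (ball p ε \ segment ℝ (p + v) p) :=
    isPreconnected_ball_diff_segment hε (by simp [hv])
  have h2 : IsPreconnected (ball p ε \ segment ℝ (p - v) p) :=
    isPreconnected_ball_diff_segment hε (by simp [hv])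
  have c1 : ∀ {t : ℝ}, lineMap (p + v) p t 0 = p 0 + (1 - t) * ε := by
    intro t; rw [lineMap_coord]; simp [v]; ring
  have c2 : ∀ {t : ℝ}, lineMap (p - v) p t 0 = p 0 - (1 - t) * ε := by
    intro t; rw [lineMap_coord]; simp [v]; ring
  set w : Plane := EuclideanSpace.single 1 (ε / 2)
  have hw : w 1 = ε / 2 := by simp [w]
  have d1 : ∀ {t : ℝ}, lineMap (p + v) p t 1 = p 1 := by
    intro t; rw [lineMap_coord]; simp [v]
  have d2 : ∀ {t : ℝ}, lineMap (p - v) p t 1 = p 1 := by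
    intro t; rw [lineMap_coord]; simp [v]
  have hwb : p + w ∈ ball p ε := by
    simp [w, abs_of_pos hε]; linarith
  have hw1 : p + w ∉ segment ℝ (p + v) p := by
    rw [mem_segment_iff_lineMap]
    rintro ⟨t, -, h⟩
    have := congrArg (fun x : Plane => x 1) h
    simp only [d1, PiLp.add_apply, hw] at this
    linarith
  have hw2 : p + w ∉ segment ℝ (p - v) p := by
    rw [mem_segment_iff_lineMap]
    rintro ⟨t, -, h⟩
    have := congrArg (fun x : Plane => x 1) h
    simp only [d2, PiLp.add_apply, hw] at this
    linarith
  have e1 : p + w ∈ ball p ε \ segment ℝ (p + v) p := ⟨hwb, hw1⟩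
  have e2 : p + w ∈ ball p ε \ segment ℝ (p - v) p := ⟨hwb, hw2⟩
  have := IsPreconnected.union (p + w) e1 e2 h1 h2
  convert this using 1
  rw [← sdiff_inter]
  congr 1
  ext x
  constructor
  · rintro rfl
    exact ⟨right_mem_segment _ _ _, right_mem_segment _ _ _⟩
  · rintro ⟨hx1, hx2⟩
    obtain ⟨t, ht, h⟩ := mem_segment_iff_lineMap.1 hx1
    obtain ⟨s, hs, h'⟩ := mem_segment_iff_lineMap.1 hx2
    have := congrArg (fun x : Plane => x 0) (h.trans h'.symm)
    simp only [c1, c2] at this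
    have ht1 : t = 1 := by
      have : (1 - t) + (1 - s) = 0 := by
        have : ((1 - t) + (1 - s)) * ε = 0 := by linarith
        exact (mul_eq_zero.1 this).resolve_right hε.ne'
      linarith [ht.2, hs.2]
    rw [← h, ht1]
    simp

/-- A small punctured ball around `q` lies in one of the two parts. The other part does not
accumulate at `q`, so it is closed relative to `V` and must be empty. -/
lemma isPreconnected_diff_singleton {V : Set Plane} (hV : IsOpen V) (hVc : IsPreconnected V)
    (q : Plane) : IsPreconnected (V \ {q}) := by
  by_cases hq : q ∈ V
  swap
  · rwa [sdiff_singleton_eq_self hq]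
  refine isPreconnected_of_isOpen (hV.sdiff isClosed_singleton) fun X Y hX hY hXY hM => ?_
  obtain ⟨ε, hε, hball⟩ := Metric.isOpen_iff.1 hV q hq
  have hpre := isPreconnected_ball_diff_singleton q hε
  have main : ∀ X Y : Set Plane, IsOpen X → IsOpen Y → Disjoint X Y → X ∪ Y = V \ {q} →
      ball q ε \ {q} ⊆ X → Y = ∅ := by
    intro X Y hX hY hXY hM hb
    by_contra hne
    obtain ⟨y, hy⟩ := nonempty_iff_ne_empty.2 hne
    have hyV : Y ⊆ V \ {q} := hM ▸ subset_union_right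
    have : V ⊆ Y := by
      refine hVc.subset_of_closure_inter_subset hY ⟨y, (hyV hy).1, hy⟩ ?_
      rintro z ⟨hz, hzV⟩
      by_cases hzq : z = q
      · subst hzq
        obtain ⟨w, hw, hwd⟩ := Metric.mem_closure_iff.1 hz ε hε
        have hwX : w ∈ X := hb ⟨by rwa [mem_ball, dist_comm], (hyV hw).2⟩
        exact absurd hw (disjoint_left.1 hXY hwX)
      · have : z ∈ X ∪ Y := hM ▸ ⟨hzV, hzq⟩
        rcases this with h | h
        · exact absurd hz (disjoint_left.1 (hXY.closure_right hX) h)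
        · exact h
    exact (hyV (this hq)).2 rfl
  rcases hpre.subset_or_subset hX hY hXY
    (hM ▸ sdiff_subset_sdiff_left hball) with h | h
  · exact Or.inr (main X Y hX hY hXY hM h)
  · exact Or.inl (main Y X hY hX hXY.symm (by rwa [union_comm]) h)

/-- Removing a segment that enters an open connected set from outside keeps it connected. -/
lemma isPreconnected_diff_segment {V : Set Plane} (hV : IsOpen V) (hVc : IsPreconnected V)
    {p q : Plane} (hq : q ∉ V) (hpq : q ≠ p) (hseg : ∀ t ∈ Ioc (0 : ℝ) 1, lineMap q p t ∈ V) :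
    IsPreconnected (V \ segment ℝ q p) := by
  have hcl : IsClosed (segment ℝ q p) := isClosed_segment q p
  have hpV : p ∈ V := by simpa using hseg 1 (by simp)
  have hv : p - q ≠ 0 := sub_ne_zero.2 hpq.symm
  refine isPreconnected_of_isOpen (hV.sdiff hcl) fun X Y hX hY hXY hM => ?_
  obtain ⟨ε', hε', hball'⟩ := Metric.isOpen_iff.1 hV p hpV
  -- The second bound makes the segment cut the ball around its tip `p` along a full radius, so that
  -- the slit ball is connected.
  set ε := min ε' (dist p q)
  have hε : 0 < ε := lt_min hε' (dist_pos.2 hpq.symm)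
  have hball : ball p ε ⊆ V := (ball_subset_ball (min_le_left _ _)).trans hball'
  have main : ∀ X Y : Set Plane, IsOpen X → IsOpen Y → Disjoint X Y →
      X ∪ Y = V \ segment ℝ q p → ball p ε \ segment ℝ q p ⊆ X → Y = ∅ := by
    intro X Y hX hY hXY hM hb
    have hyV : Y ⊆ V \ segment ℝ q p := hM ▸ subset_union_right
    have hpY : p ∉ closure Y := by
      intro hp
      obtain ⟨w, hw, hwd⟩ := Metric.mem_closure_iff.1 hp ε hε
      have hwX : w ∈ X := hb ⟨by rwa [mem_ball, dist_comm], (hyV hw).2⟩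
      exact disjoint_left.1 hXY hwX hw
    -- `Y` does not reach the tip `p`; walking along one side of the segment, it touches the segment
    -- nowhere from that side. With both sides treated, `Y` is closed relative to `V`.
    have walk : ∀ S : Set Plane, Convex ℝ S → (∀ t : ℝ, lineMap q p t ∉ S) →
        (∀ t : ℝ, lineMap q p t ∈ closure S) →
        ∀ t ∈ Ioc (0 : ℝ) 1, lineMap q p t ∉ closure (Y ∩ S) := by
      intro S hS hS1 hS2
      have hwalk := closure_inter_all_or_none (I := Ioc (0 : ℝ) 1) isPreconnected_Ioc
        (γ := fun t => lineMap q p t) lineMap_continuous hX hY hXY hS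
        (fun t _ => hS2 t) (fun t ht => by
          obtain ⟨δ, hδ, hδb⟩ := Metric.isOpen_iff.1 hV _ (hseg t ht)
          refine ⟨δ, hδ, fun z hz => ?_⟩
          rw [hM]
          refine ⟨hδb hz.1, fun hzs => ?_⟩
          obtain ⟨r, -, rfl⟩ := mem_segment_iff_lineMap.1 hzs
          exact hS1 r hz.2)
      rcases hwalk with h | h
      · have := h 1 (by simp)
        simp only [lineMap_apply_one] at this
        exact absurd (closure_mono inter_subset_left this) hpY
      · exact h
    have hcz : ∀ t : ℝ, 0 ≤ cross (p - q) (lineMap q p t - q) := fun t => (cross_lineMap q p t).ge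
    have hcz' : ∀ t : ℝ, 0 ≤ cross (-(p - q)) (lineMap q p t - q) := fun t => by
      have := cross_lineMap q p t
      simp only [cross, PiLp.neg_apply] at *
      linarith
    have w1 := walk (leftOf q (p - q)) (convex_leftOf _ _) (lineMap_notMem_leftOf q p)
      (fun t => by simpa using mem_closure_leftOf hv (hcz t) isOpen_univ (mem_univ _))
    have w2 := walk (leftOf q (-(p - q))) (convex_leftOf _ _) (lineMap_notMem_leftOf_neg q p)
      (fun t => by
        simpa using mem_closure_leftOf (neg_ne_zero.2 hv) (hcz' t) isOpen_univ (mem_univ _))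
    by_contra hne
    obtain ⟨y, hy⟩ := nonempty_iff_ne_empty.2 hne
    have : V ⊆ Y := by
      refine hVc.subset_of_closure_inter_subset hY ⟨y, (hyV hy).1, hy⟩ ?_
      rintro z ⟨hz, hzV⟩
      by_cases hzq : z ∈ segment ℝ q p
      · obtain ⟨t, ht, rfl⟩ := mem_segment_iff_lineMap.1 hzq
        have ht0 : t ∈ Ioc (0 : ℝ) 1 := by
          refine ⟨ht.1.lt_of_ne' ?_, ht.2⟩
          rintro rfl
          rw [lineMap_apply_zero] at hzV
          exact hq hzV
        rcases closure_subset_closure_leftOf (a := q) hv hY hz with h | h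
        · exact absurd h (w1 t ht0)
        · exact absurd h (w2 t ht0)
      · have : z ∈ X ∪ Y := hM ▸ ⟨hzV, hzq⟩
        rcases this with h | h
        · exact absurd hz (disjoint_left.1 (hXY.closure_right hX) h)
        · exact h
    exact hpY (subset_closure (this hpV))
  rcases (isPreconnected_ball_diff_segment hε (min_le_right _ _)).subset_or_subset hX hY hXY
    (hM ▸ sdiff_subset_sdiff_left hball) with h | h
  · exact Or.inr (main X Y hX hY hXY hM h)
  · exact Or.inl (main Y X hY hX hXY.symm (by rwa [union_comm]) h)

end

section

/-! ### A simple polygon has a polygon interior on exactly one side of each edge -/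

/-- The plane as the complex numbers. -/
def toComplex (x : Plane) : ℂ := ⟨x 0, x 1⟩

lemma toComplex_injective : Function.Injective toComplex := fun _ _ h =>
  plane_ext (congrArg Complex.re h) (congrArg Complex.im h)

lemma continuous_toComplex : Continuous toComplex := by
  have : toComplex = fun x => Complex.equivRealProdCLM.symm (x 0, x 1) := by
    ext x
    apply Complex.ext <;> simp [toComplex]
  rw [this]
  exact Complex.equivRealProdCLM.symm.continuous.comp
    ((continuous_coord 0).prodMk (continuous_coord 1))

/-- The argument of this ratio is the angle under which the segment from `a` to `b` is seen
from `y`. -/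
def viewRatio (a b y : Plane) : ℂ := (toComplex b - toComplex y) / (toComplex a - toComplex y)

lemma toComplex_sub_ne_zero {a y : Plane} (h : y ≠ a) : toComplex a - toComplex y ≠ 0 :=
  sub_ne_zero.2 fun h' => h (toComplex_injective h').symm

/-- A nonpositive real ratio `r` would put `y` at the parameter `1 / (1 - r)` of the segment. Off
the segment the principal argument of the ratio is therefore continuous. -/
lemma viewRatio_mem_slitPlane {a b y : Plane} (h : y ∉ segment ℝ a b) :
    viewRatio a b y ∈ Complex.slitPlane := by
  by_contra hc
  have hya : y ≠ a := fun e => h (e ▸ left_mem_segment _ _ _)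
  have hne := toComplex_sub_ne_zero hya
  simp only [Complex.mem_slitPlane_iff, not_or, not_lt, not_not] at hc
  set r := (viewRatio a b y).re
  have hv : viewRatio a b y = (r : ℂ) := Complex.ext rfl (by simp [hc.2])
  have he : toComplex b - toComplex y = r * (toComplex a - toComplex y) := by
    rw [← hv, viewRatio, div_mul_cancel₀ _ hne]
  have h0 := congrArg Complex.re he
  have h1 := congrArg Complex.im he
  simp only [toComplex, Complex.sub_re, Complex.mul_re, Complex.ofReal_re, Complex.ofReal_im,
    zero_mul, sub_zero, Complex.sub_im, Complex.mul_im, add_zero] at h0 h1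
  have hr : 0 < 1 - r := by linarith [hc.1]
  refine h (mem_segment_iff_lineMap.2 ⟨1 / (1 - r), ⟨by positivity, ?_⟩, ?_⟩)
  · rw [div_le_one hr]; linarith [hc.1]
  · refine plane_ext ?_ ?_ <;> rw [lineMap_coord] <;> field_simp <;> linarith

lemma continuousAt_arg_viewRatio {a b y : Plane} (h : y ∉ segment ℝ a b) :
    ContinuousAt (fun z => (viewRatio a b z).arg) y := by
  have hya : y ≠ a := fun e => h (e ▸ left_mem_segment _ _ _)
  refine (Complex.continuousAt_arg (viewRatio_mem_slitPlane h)).comp (f := viewRatio a b) ?_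
  exact ((continuousAt_const.sub continuous_toComplex.continuousAt).div
    (continuousAt_const.sub continuous_toComplex.continuousAt) (toComplex_sub_ne_zero hya))

/-- The sign of the imaginary part tells the side of the line on which `y` lies. It decides whether
the argument tends to `π` or to `-π` at an interior point of the edge. -/
lemma im_viewRatio (a b y : Plane) :
    (viewRatio a b y).im = cross (b - a) (y - a) / Complex.normSq (toComplex a - toComplex y) := by
  rw [viewRatio, Complex.div_im]
  simp only [toComplex, cross, Complex.sub_re, Complex.sub_im, PiLp.sub_apply]
  ring

/-- The ratios multiply to 1 around the closed polygon, so the sum of their logarithms is a multiple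
of `2πi`. The integer `m` is the winding number around `y`. -/
lemma exists_sum_arg_eq {n : ℕ} {P : Polygon Plane n} {y : Plane} (hy : ∀ i, y ≠ P.vertices i) :
    ∃ m : ℤ, ∑ i, (viewRatio (P.vertices i) (P.vertices (finRotate n i)) y).arg =
      m * (2 * Real.pi) := by
  have hne : ∀ i, toComplex (P.vertices i) - toComplex y ≠ 0 := fun i =>
    toComplex_sub_ne_zero (hy i)
  have : Complex.exp (∑ i, Complex.log (viewRatio (P.vertices i)
      (P.vertices (finRotate n i)) y)) = 1 := by
    rw [Complex.exp_sum]
    have : ∀ i, Complex.exp (Complex.log (viewRatio (P.vertices i)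
        (P.vertices (finRotate n i)) y)) = (toComplex (P.vertices (finRotate n i)) - toComplex y)
          / (toComplex (P.vertices i) - toComplex y) := fun i =>
      Complex.exp_log (div_ne_zero (hne _) (hne _))
    rw [Finset.prod_congr rfl fun i _ => this i, Finset.prod_div_distrib,
      Equiv.prod_comp (finRotate n) (fun i => toComplex (P.vertices i) - toComplex y)]
    exact div_self (Finset.prod_ne_zero_iff.2 fun i _ => hne i)
  obtain ⟨m, hm⟩ := Complex.exp_eq_one_iff.1 this
  refine ⟨m, ?_⟩
  have := congrArg Complex.im hm
  rw [Complex.im_sum] at this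
  simp only [Complex.log_im] at this
  rw [this]
  simp

/-- Between two different values the intermediate value theorem would produce the value `(m + 1 / 2)
c`, which is not an integer multiple of `c`. -/
lemma constant_of_int_multiples {U : Set Plane} (hU : IsPreconnected U) {f : Plane → ℝ}
    (hf : ContinuousOn f U) {c : ℝ} (hc : 0 < c) (h : ∀ y ∈ U, ∃ m : ℤ, f y = m * c) {y z : Plane}
    (hy : y ∈ U) (hz : z ∈ U) : f y = f z := by
  have key : ∀ y ∈ U, ∀ z ∈ U, f y ≤ f z → f y = f z := by
    intro y hy z hz hle
    obtain ⟨m, hm⟩ := h y hy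
    obtain ⟨k, hk⟩ := h z hz
    by_contra hne
    have hlt : f y < f z := lt_of_le_of_ne hle hne
    have hmk : m < k := by
      rw [hm, hk] at hlt
      exact_mod_cast lt_of_mul_lt_mul_right hlt hc.le
    have hmk' : (m : ℝ) + 1 ≤ k := by exact_mod_cast hmk
    obtain ⟨x, hx, hfx⟩ := hU.intermediate_value hy hz hf
      (show (m + 1 / 2) * c ∈ Icc (f y) (f z) by
        rw [hm, hk]; constructor <;> nlinarith)
    obtain ⟨l, hl⟩ := h x hx
    rw [hfx] at hl
    have := mul_right_cancel₀ hc.ne' hl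
    have h2 : (2 * m + 1 : ℤ) = 2 * l := by
      have : (2 * m + 1 : ℝ) = 2 * l := by linarith
      exact_mod_cast this
    omega
  rcases le_total (f y) (f z) with h' | h'
  · exact key y hy z hz h'
  · exact (key z hz y hy h').symm

namespace IsSimplePolygon

variable {n : ℕ} {P : Polygon Plane n}

lemma edgeSet_eq (i : Fin n) :
    P.edgeSet ℝ i = segment ℝ (P.vertices i) (P.vertices (finRotate n i)) := by
  rw [Polygon.edgeSet, affineSegment_eq_segment]

lemma isClosed_edgeSet (i : Fin n) : IsClosed (P.edgeSet ℝ i) := by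
  rw [edgeSet_eq]; exact isClosed_segment _ _

lemma rotate_ne (hP : IsSimplePolygon P) (i : Fin n) : finRotate n i ≠ i := by
  have := hP.three_le
  obtain ⟨m, rfl⟩ : ∃ m, n = m + 1 := ⟨n - 1, by omega⟩
  intro h
  rcases lt_or_ge i.val m with hi | hi
  · have := finRotate_of_lt hi
    rw [show (⟨i.val, hi.trans_le m.le_succ⟩ : Fin (m + 1)) = i from rfl, h] at this
    have := congrArg Fin.val this
    simp at this
  · have hil : i = Fin.last m := Fin.ext (by have := i.2; simp; omega)
    rw [hil, finRotate_last] at h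
    have := congrArg Fin.val h
    simp at this
    omega

lemma vertex_ne (hP : IsSimplePolygon P) (i : Fin n) :
    P.vertices i ≠ P.vertices (finRotate n i) := fun h => hP.rotate_ne i (hP.injective h).symm

lemma lineMap_mem_edgeSet (i : Fin n) {t : ℝ} (ht : t ∈ Icc (0 : ℝ) 1) :
    lineMap (P.vertices i) (P.vertices (finRotate n i)) t ∈ P.edgeSet ℝ i := by
  rw [edgeSet_eq]
  exact mem_segment_iff_lineMap.2 ⟨t, ht, rfl⟩

lemma lineMap_notMem_edgeSet (hP : IsSimplePolygon P) {i j : Fin n} (hij : j ≠ i) {t : ℝ}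
    (ht : t ∈ Ioo (0 : ℝ) 1) :
    lineMap (P.vertices i) (P.vertices (finRotate n i)) t ∉ P.edgeSet ℝ j := by
  intro h
  have hi := lineMap_mem_edgeSet (P := P) i (Ioo_subset_Icc_self ht)
  have inj := lineMap_injective_of_ne (hP.vertex_ne i)
  rcases (hP.edge_inter i j hij.symm ⟨hi, h⟩).1 with h' | h'
  · exact ht.1.ne' (inj (h'.trans (lineMap_apply_zero _ _).symm))
  · exact ht.2.ne (inj ((mem_singleton_iff.1 h').trans (lineMap_apply_one _ _).symm))

lemma exists_ball_inter_boundary (hP : IsSimplePolygon P) (i : Fin n) {t : ℝ}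
    (ht : t ∈ Ioo (0 : ℝ) 1) : ∃ ε > 0,
      ball (lineMap (P.vertices i) (P.vertices (finRotate n i)) t) ε ∩ P.boundary ℝ ⊆
        P.edgeSet ℝ i := by
  set x := lineMap (P.vertices i) (P.vertices (finRotate n i)) t
  have hcl : IsClosed (⋃ j : {j : Fin n // j ≠ i}, P.edgeSet ℝ j.1) :=
    isClosed_iUnion_of_finite fun j => isClosed_edgeSet j.1
  have hx : x ∈ (⋃ j : {j : Fin n // j ≠ i}, P.edgeSet ℝ j.1)ᶜ := by
    simp only [mem_compl_iff, mem_iUnion, not_exists]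
    exact fun j => hP.lineMap_notMem_edgeSet j.2 ht
  obtain ⟨ε, hε, hb⟩ := Metric.isOpen_iff.1 hcl.isOpen_compl x hx
  refine ⟨ε, hε, fun y hy => ?_⟩
  obtain ⟨j, hj⟩ := mem_iUnion.1 hy.2
  by_contra hne
  have hji : j ≠ i := fun e => hne (e ▸ hj)
  exact hb hy.1 (mem_iUnion.2 ⟨⟨j, hji⟩, hj⟩)

/-- A connected open set bounded by a simple polygon does not lie on both sides of an edge. -/
lemma not_both_sides (hP : IsSimplePolygon P) {U : Set Plane} (hUc : IsPreconnected U)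
    (hUd : Disjoint U (P.boundary ℝ)) (i : Fin n) {t : ℝ} (ht : t ∈ Ioo (0 : ℝ) 1) {ε : ℝ}
    (hε : 0 < ε) {a b x : Plane} (ha : a = P.vertices i) (hb : b = P.vertices (finRotate n i))
    (hx : x = lineMap a b t)
    (h1 : ball x ε ∩ leftOf a (b - a) ⊆ U) (h2 : ball x ε ∩ leftOf a (-(b - a)) ⊆ U) : False := by
  set A : Fin n → Plane → ℝ := fun j y =>
    (viewRatio (P.vertices j) (P.vertices (finRotate n j)) y).arg with hA
  have hab : a ≠ b := ha ▸ hb ▸ hP.vertex_ne i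
  have hv : b - a ≠ 0 := sub_ne_zero.2 hab.symm
  have hUe : ∀ y ∈ U, ∀ j, y ∉ P.edgeSet ℝ j := fun y hy j hj =>
    disjoint_left.1 hUd hy (mem_iUnion.2 ⟨j, hj⟩)
  have hcont : ContinuousOn (fun y => ∑ j, A j y) U := by
    refine continuousOn_finsetSum _ fun j _ y hy => ?_
    refine (continuousAt_arg_viewRatio ?_).continuousWithinAt
    rw [← edgeSet_eq]
    exact hUe y hy j
  have hint : ∀ y ∈ U, ∃ m : ℤ, ∑ j, A j y = m * (2 * Real.pi) := fun y hy =>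
    exists_sum_arg_eq fun j e => hUe y hy j (by
      rw [edgeSet_eq, e]; exact left_mem_segment _ _ _)
  have hconst : ∀ y ∈ U, ∀ z ∈ U, ∑ j, A j y = ∑ j, A j z := fun y hy z hz =>
    constant_of_int_multiples hUc hcont Real.two_pi_pos hint hy hz
  -- The winding sum without the term of edge `i`. It is continuous at `x`, which lies on no other
  -- edge.
  set g : Plane → ℝ := fun y => ∑ j ∈ Finset.univ.erase i, A j y
  have hg : ContinuousAt g x := by
    refine tendsto_finsetSum _ fun j hj => ?_
    refine continuousAt_arg_viewRatio ?_
    rw [← edgeSet_eq, hx, ha, hb]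
    exact hP.lineMap_notMem_edgeSet (Finset.ne_of_mem_erase hj) ht
  have hsplit : ∀ y, ∑ j, A j y = A i y + g y := fun y =>
    (Finset.add_sum_erase _ _ (Finset.mem_univ i)).symm
  have hx0 : cross (b - a) (x - a) = 0 := hx ▸ cross_lineMap a b t
  have hx0' : 0 ≤ cross (-(b - a)) (x - a) := by
    simp only [cross, PiLp.neg_apply] at *
    linarith
  have hbx : x ∈ ball x ε := mem_ball_self hε
  have n1 : (𝓝[leftOf a (b - a)] x).NeBot := mem_closure_iff_nhdsWithin_neBot.1 (by
    simpa using mem_closure_leftOf hv hx0.ge isOpen_univ (mem_univ x))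
  have n2 : (𝓝[leftOf a (-(b - a))] x).NeBot := mem_closure_iff_nhdsWithin_neBot.1 (by
    simpa using mem_closure_leftOf (neg_ne_zero.2 hv) hx0' isOpen_univ (mem_univ x))
  obtain ⟨y0, hy0⟩ : (ball x ε ∩ leftOf a (b - a)).Nonempty := closure_nonempty_iff.1
    ⟨x, mem_closure_leftOf hv hx0.ge isOpen_ball hbx⟩
  set c := ∑ j, A j y0
  -- The full sum equals the constant `c` on `U`, so approaching `x` through `U` from either side
  -- gives the term of edge `i` the same limit `c - g x`. The actual limits, found in `l1` and `l2`,
  -- are `π` and `-π`.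
  have lim : ∀ S : Set Plane, ball x ε ∩ S ⊆ U →
      Tendsto (A i) (𝓝[S] x) (𝓝 (c - g x)) := by
    intro S hS
    have : Tendsto (fun y => c - g y) (𝓝[S] x) (𝓝 (c - g x)) :=
      (tendsto_const_nhds.sub hg).mono_left nhdsWithin_le_nhds
    refine this.congr' ?_
    filter_upwards [self_mem_nhdsWithin, mem_nhdsWithin_of_mem_nhds (isOpen_ball.mem_nhds hbx)]
      with y hy hyb
    have := hconst y (hS ⟨hyb, hy⟩) y0 (h1 hy0)
    rw [hsplit] at this
    linarith
  have hxa : x ≠ a := fun e => ht.1.ne' (lineMap_injective_of_ne hab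
    ((hx ▸ e).trans (lineMap_apply_zero a b).symm))
  have hrat : viewRatio a b x = ((-((1 - t) / t) : ℝ) : ℂ) := by
    rw [viewRatio, div_eq_iff (toComplex_sub_ne_zero hxa)]
    have ht0 := ht.1.ne'
    apply Complex.ext <;> simp only [toComplex, hx, lineMap_coord, Complex.sub_re, Complex.sub_im,
      Complex.mul_re, Complex.mul_im, Complex.ofReal_re, Complex.ofReal_im] <;> field_simp <;> ring
  have hre : (viewRatio a b x).re < 0 := by
    rw [hrat, Complex.ofReal_re]
    have := div_pos (sub_pos.2 ht.2) ht.1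
    linarith
  have him : (viewRatio a b x).im = 0 := by rw [hrat, Complex.ofReal_im]
  have hvc : ContinuousAt (viewRatio a b) x :=
    ((continuousAt_const.sub continuous_toComplex.continuousAt).div
      (continuousAt_const.sub continuous_toComplex.continuousAt) (toComplex_sub_ne_zero hxa))
  have nsq : ∀ y, 0 ≤ Complex.normSq (toComplex a - toComplex y) := fun y => Complex.normSq_nonneg _
  have l1 : Tendsto (A i) (𝓝[leftOf a (b - a)] x) (𝓝 Real.pi) := by
    simp only [hA, ← ha, ← hb]
    refine (Complex.tendsto_arg_nhdsWithin_im_nonneg_of_re_neg_of_im_zero hre him).comp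
      (tendsto_nhdsWithin_iff.2 ⟨hvc.mono_left nhdsWithin_le_nhds, ?_⟩)
    filter_upwards [self_mem_nhdsWithin] with y hy
    show 0 ≤ (viewRatio a b y).im
    rw [im_viewRatio]
    exact div_nonneg (le_of_lt hy) (nsq y)
  have l2 : Tendsto (A i) (𝓝[leftOf a (-(b - a))] x) (𝓝 (-Real.pi)) := by
    simp only [hA, ← ha, ← hb]
    refine (Complex.tendsto_arg_nhdsWithin_im_neg_of_re_neg_of_im_zero hre him).comp
      (tendsto_nhdsWithin_iff.2 ⟨hvc.mono_left nhdsWithin_le_nhds, ?_⟩)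
    filter_upwards [self_mem_nhdsWithin] with y hy
    show (viewRatio a b y).im < 0
    rw [im_viewRatio]
    have hy' : cross (b - a) (y - a) < 0 := by
      simp only [leftOf, mem_ofPred_eq, cross, PiLp.neg_apply] at *
      linarith
    refine div_neg_of_neg_of_pos hy' (Complex.normSq_pos.2 (toComplex_sub_ne_zero ?_))
    rintro rfl
    simp [cross] at hy'
  have e1 := tendsto_nhds_unique l1 (lim _ h1)
  have e2 := tendsto_nhds_unique l2 (lim _ h2)
  linarith [Real.pi_pos]

/-- A connected open set `U` with `∂U = P` lies locally on exactly one side of each edge. -/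
lemma one_side (hP : IsSimplePolygon P) {U : Set Plane} (hU : IsOpen U) (hUc : IsPreconnected U)
    (hUf : frontier U = P.boundary ℝ) (i : Fin n) {t : ℝ} (ht : t ∈ Ioo (0 : ℝ) 1)
    {a b x : Plane} (ha : a = P.vertices i) (hb : b = P.vertices (finRotate n i))
    (hx : x = lineMap a b t) : ∃ ε > 0,
      (ball x ε ∩ leftOf a (b - a) ⊆ U ∧ ball x ε ∩ leftOf a (-(b - a)) ⊆ (closure U)ᶜ) ∨
      (ball x ε ∩ leftOf a (-(b - a)) ⊆ U ∧ ball x ε ∩ leftOf a (b - a) ⊆ (closure U)ᶜ) := by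
  have hab : a ≠ b := ha ▸ hb ▸ hP.vertex_ne i
  have hv : b - a ≠ 0 := sub_ne_zero.2 hab.symm
  have hUd : Disjoint U (P.boundary ℝ) := by
    rw [← hUf, Set.disjoint_iff_inter_eq_empty]
    exact hU.inter_frontier_eq
  obtain ⟨ε, hε, hball⟩ := hP.exists_ball_inter_boundary i ht
  rw [← ha, ← hb, ← hx] at hball
  have hcov : (closure U) ⊆ U ∪ P.boundary ℝ := by
    rw [← hUf, closure_eq_self_union_frontier]
  -- A half ball at `x` misses the boundary of `U`; being connected, it lies in `U` or in the
  -- exterior.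
  have dich : ∀ S : Set Plane, Convex ℝ S → (∀ r : ℝ, lineMap a b r ∉ S) →
      ball x ε ∩ S ⊆ U ∨ ball x ε ∩ S ⊆ (closure U)ᶜ := by
    intro S hS hSl
    refine (((convex_ball x ε).inter hS).isPreconnected).subset_or_subset hU
      isClosed_closure.isOpen_compl
      (disjoint_compl_right.mono_left subset_closure) fun y hy => ?_
    by_contra hc
    simp only [mem_union, mem_compl_iff, not_or, not_not] at hc
    have hyb := (hcov hc.2).resolve_left hc.1
    have := hball ⟨hy.1, hyb⟩
    rw [edgeSet_eq, ← ha, ← hb] at this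
    obtain ⟨r, -, rfl⟩ := mem_segment_iff_lineMap.1 this
    exact hSl r hy.2
  have d1 := dich _ (convex_leftOf a (b - a)) (lineMap_notMem_leftOf a b)
  have d2 := dich _ (convex_leftOf a (-(b - a))) (lineMap_notMem_leftOf_neg a b)
  have hxU : x ∈ closure U := by
    refine frontier_subset_closure ?_
    rw [hUf]
    refine mem_iUnion.2 ⟨i, ?_⟩
    rw [hx, ha, hb]
    exact lineMap_mem_edgeSet i (Ioo_subset_Icc_self ht)
  refine ⟨ε, hε, ?_⟩
  rcases d1 with d1 | d1 <;> rcases d2 with d2 | d2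
  · exact (hP.not_both_sides hUc hUd i ht hε ha hb hx d1 d2).elim
  · exact Or.inl ⟨d1, d2⟩
  · exact Or.inr ⟨d2, d1⟩
  -- Both sides cannot be exterior, since `x` is in the closure of `U`.
  · exfalso
    have : ∀ S : Set Plane, ball x ε ∩ S ⊆ (closure U)ᶜ → x ∉ closure (U ∩ S) := by
      intro S hS hxS
      obtain ⟨y, hy, hyd⟩ := Metric.mem_closure_iff.1 hxS ε hε
      exact hS ⟨by rwa [mem_ball, dist_comm], hy.2⟩ (subset_closure hy.1)
    rcases closure_subset_closure_leftOf (a := a) hv hU hxU with h | h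
    · exact this _ d1 h
    · exact this _ d2 h

end IsSimplePolygon

end

/-! ### Polygons do not separate open connected sets -/

section

namespace IsSimplePolygon

variable {m : ℕ} {P : Polygon Plane (m + 1)}

/-- Removing all edges of a simple polygon but the last one keeps an open set connected. -/
lemma isPreconnected_diff_edges (hP : IsSimplePolygon P) {V : Set Plane} (hV : IsOpen V)
    (hVc : IsPreconnected V) (hPV : P.boundary ℝ ⊆ V) :
    IsPreconnected (V \ ⋃ l : {l : Fin (m + 1) // l.val < m}, P.edgeSet ℝ l.1) := by
  have hm : 2 ≤ m := by have := hP.three_le; omega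
  -- The edges are removed one after the other along the polygon. Vertex 0 is removed from the
  -- start, so that every edge emanates from a point already removed, as
  -- `isPreconnected_diff_segment` requires.
  set F : ℕ → Set Plane := fun k =>
    {P.vertices 0} ∪ ⋃ l : {l : Fin (m + 1) // l.val < k}, P.edgeSet ℝ l.1
  have hF : ∀ k, IsClosed (F k) := fun k =>
    isClosed_singleton.union (isClosed_iUnion_of_finite fun l => isClosed_edgeSet l.1)
  have hstep : ∀ k ≤ m, IsPreconnected (V \ F k) := by
    intro k
    induction k with
    | zero =>
      intro _
      have : IsEmpty {l : Fin (m + 1) // l.val < 0} := ⟨fun l => absurd l.2 (Nat.not_lt_zero _)⟩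
      have : F 0 = {P.vertices 0} := by simp [F]
      rw [this]
      exact isPreconnected_diff_singleton hV hVc _
    | succ k ih =>
      intro hk
      have hkm : k < m := hk
      set i : Fin (m + 1) := ⟨k, by omega⟩
      have hi1 : finRotate (m + 1) i = ⟨k + 1, by omega⟩ := finRotate_of_lt hkm
      have hFk : F (k + 1) = F k ∪ P.edgeSet ℝ i := by
        ext x
        simp only [F, mem_union, mem_iUnion, Subtype.exists, exists_prop]
        constructor
        · rintro (h | ⟨l, hl, hx⟩)
          · exact Or.inl (Or.inl h)
          · rcases Nat.lt_succ_iff_lt_or_eq.1 hl with h | h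
            · exact Or.inl (Or.inr ⟨l, h, hx⟩)
            · have : l = i := Fin.ext h
              exact Or.inr (this ▸ hx)
        · rintro ((h | ⟨l, hl, hx⟩) | h)
          · exact Or.inl h
          · exact Or.inr ⟨l, by omega, hx⟩
          · exact Or.inr ⟨i, by simp [i], h⟩
      -- Edge `k < m` meets the removed set only at its initial vertex: its final vertex `k + 1 ≤ m`
      -- is neither vertex 0 nor on an earlier edge. The last edge returns to vertex 0, and for it
      -- this would fail.
      have key : ∀ x ∈ P.edgeSet ℝ i, x ∈ F k → x = P.vertices i := by
        rintro x hx (h0 | h)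
        · rcases Nat.eq_zero_or_pos k with hk0 | hk0
          · have : i = 0 := Fin.ext hk0
            rw [this]
            exact h0
          · exfalso
            have hne : i ≠ 0 := fun h => by
              have := congrArg Fin.val h
              simp [i] at this
              omega
            have hx0 : x ∈ P.edgeSet ℝ 0 := by
              rw [mem_singleton_iff.1 h0, edgeSet_eq]
              exact left_mem_segment _ _ _
            rcases (hP.edge_inter i 0 hne ⟨hx, hx0⟩).1 with h' | h'
            · exact hne (hP.injective (h'.symm.trans h0))
            · have := hP.injective ((mem_singleton_iff.1 h').symm.trans h0)
              rw [hi1] at this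
              have := congrArg Fin.val this
              simp at this
        · simp only [mem_iUnion, Subtype.exists, exists_prop] at h
          obtain ⟨l, hl, hxl⟩ := h
          have hne : i ≠ l := fun h => by
            have := congrArg Fin.val h
            simp [i] at this
            omega
          obtain ⟨h1, h2⟩ := hP.edge_inter i l hne ⟨hx, hxl⟩
          rcases h1 with h1 | h1
          · exact h1
          · exfalso
            rw [mem_singleton_iff] at h1
            rcases h2 with h2 | h2
            · have := hP.injective (h1.symm.trans h2)
              rw [hi1] at this
              have := congrArg Fin.val this
              simp at this
              omega
            · have := (finRotate (m + 1)).injective (hP.injective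
                (h1.symm.trans (mem_singleton_iff.1 h2)))
              exact hne this
      have hPi : P.vertices i ∈ F k := by
        rcases Nat.eq_zero_or_pos k with hk0 | hk0
        · have : i = 0 := Fin.ext hk0
          rw [this]
          exact Or.inl rfl
        · refine Or.inr (mem_iUnion.2 ⟨⟨⟨k - 1, by omega⟩, by simp; omega⟩, ?_⟩)
          rw [edgeSet_eq, finRotate_of_lt (by omega : k - 1 < m)]
          have : (⟨k - 1 + 1, by omega⟩ : Fin (m + 1)) = i := Fin.ext (by simp [i]; omega)
          rw [this]
          exact right_mem_segment _ _ _
      rw [hFk, ← Set.sdiff_sdiff, edgeSet_eq]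
      refine isPreconnected_diff_segment (hV.sdiff (hF k)) (ih (by omega)) (fun h => h.2 hPi)
        (hP.vertex_ne i) fun t ht => ?_
      have hmem := lineMap_mem_edgeSet (P := P) i (Ioc_subset_Icc_self ht)
      refine ⟨hPV (mem_iUnion.2 ⟨i, hmem⟩), fun h => ht.1.ne' ?_⟩
      exact lineMap_injective_of_ne (hP.vertex_ne i)
        ((key _ hmem h).trans (lineMap_apply_zero _ _).symm)
  have := hstep m le_rfl
  convert this using 2
  symm
  refine union_eq_self_of_subset_left (singleton_subset_iff.2 (mem_iUnion.2
    ⟨⟨0, by simp; omega⟩, ?_⟩))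
  rw [edgeSet_eq]
  exact left_mem_segment _ _ _

end IsSimplePolygon

namespace IsPolygonInterior

variable {H : Set Plane}

lemma disjoint_frontier (hH : IsPolygonInterior H) : Disjoint H (frontier H) := by
  rw [Set.disjoint_iff_inter_eq_empty]
  exact hH.isOpen.inter_frontier_eq

/-- A closed polygon does not separate an open connected set that contains it. -/
lemma isPreconnected_diff_closure (hH : IsPolygonInterior H) {V : Set Plane} (hV : IsOpen V)
    (hVc : IsPreconnected V) (hHV : closure H ⊆ V) : IsPreconnected (V \ closure H) := by
  obtain ⟨n, P, hP, hf⟩ := hH.frontier_eq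
  have h3 := hP.three_le
  obtain ⟨m, rfl⟩ : ∃ m, n = m + 1 := ⟨n - 1, by omega⟩
  have hcl : closure H = H ∪ P.boundary ℝ := by rw [← hf, closure_eq_self_union_frontier]
  have hdisj : Disjoint H (P.boundary ℝ) := hf ▸ hH.disjoint_frontier
  have hPV : P.boundary ℝ ⊆ V := (hf ▸ frontier_subset_closure).trans hHV
  -- `M` contains `H`, all of `V \ closure H` and, of the boundary, only the open last edge. Through
  -- this edge the connected set `M` joins `H` to the outside.
  set M := V \ ⋃ l : {l : Fin (m + 1) // l.val < m}, P.edgeSet ℝ l.1 with hMdef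
  have hM : IsPreconnected M := hP.isPreconnected_diff_edges hV hVc hPV
  have hHM : H ⊆ M := fun x hx => ⟨hHV (subset_closure hx), fun h => by
    obtain ⟨l, hl⟩ := mem_iUnion.1 h
    exact disjoint_left.1 hdisj hx (mem_iUnion.2 ⟨l.1, hl⟩)⟩
  set i := Fin.last m
  set a := P.vertices i with ha
  set b := P.vertices (finRotate (m + 1) i) with hb
  have hab : a ≠ b := hP.vertex_ne i
  have hv : b - a ≠ 0 := sub_ne_zero.2 hab.symm
  have hMP : ∀ x ∈ M, x ∈ P.boundary ℝ → ∃ t ∈ Ioo (0 : ℝ) 1, x = lineMap a b t := by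
    intro x hx hxP
    obtain ⟨l, hl⟩ := mem_iUnion.1 hxP
    have hli : l = i := by
      by_contra hne
      refine hx.2 (mem_iUnion.2 ⟨⟨l, ?_⟩, hl⟩)
      have : l.val ≠ m := fun h => hne (Fin.ext (by simpa [i] using h))
      omega
    subst hli
    rw [IsSimplePolygon.edgeSet_eq] at hl
    obtain ⟨t, ht, rfl⟩ := mem_segment_iff_lineMap.1 hl
    refine ⟨t, ⟨ht.1.lt_of_ne' ?_, ht.2.lt_of_ne ?_⟩, rfl⟩
    · rintro rfl
      refine hx.2 (mem_iUnion.2 ⟨⟨⟨m - 1, by omega⟩, by simp; omega⟩, ?_⟩)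
      rw [IsSimplePolygon.edgeSet_eq, finRotate_of_lt (by omega : m - 1 < m), lineMap_apply_zero]
      have : (⟨m - 1 + 1, by omega⟩ : Fin (m + 1)) = Fin.last m := Fin.ext (by simp; omega)
      rw [this]
      exact right_mem_segment _ _ _
    · rintro rfl
      refine hx.2 (mem_iUnion.2 ⟨⟨0, by simp; omega⟩, ?_⟩)
      rw [IsSimplePolygon.edgeSet_eq, lineMap_apply_one, finRotate_last]
      exact left_mem_segment _ _ _
  have hedge : ∀ t ∈ Ioo (0 : ℝ) 1, lineMap a b t ∈ V := fun t ht => hPV (mem_iUnion.2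
    ⟨i, IsSimplePolygon.lineMap_mem_edgeSet i (Ioo_subset_Icc_self ht)⟩)
  refine isPreconnected_of_isOpen (hV.sdiff isClosed_closure) fun X Y hX hY hXY hXYV => ?_
  -- If `Y` stays away from the midpoint of the last edge on both sides, it stays away from the
  -- whole open edge and is closed relative to `M`. Were it nonempty, it would contain `M` and
  -- therefore `H`.
  have main : ∀ X Y : Set Plane, IsOpen X → IsOpen Y → Disjoint X Y → X ∪ Y = V \ closure H →
      (∀ S : Set Plane, S = leftOf a (b - a) ∨ S = leftOf a (-(b - a)) →
        lineMap a b (1 / 2 : ℝ) ∉ closure (Y ∩ S)) → Y = ∅ := by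
    intro X Y hX hY hXY hXYV hmid
    have hYV : Y ⊆ V \ closure H := hXYV ▸ subset_union_right
    have hHY : Disjoint H Y := disjoint_left.2 fun x hx hy => (hYV hy).2 (subset_closure hx)
    have walk : ∀ S : Set Plane, S = leftOf a (b - a) ∨ S = leftOf a (-(b - a)) → Convex ℝ S →
        (∀ t : ℝ, lineMap a b t ∉ S) → (∀ t : ℝ, lineMap a b t ∈ closure S) →
        ∀ t ∈ Ioo (0 : ℝ) 1, lineMap a b t ∉ closure (Y ∩ S) := by
      intro S hS hSc hS1 hS2
      -- `H` is joined to `X` here, since a half ball at the edge may lie in `H`.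
      have hwalk := closure_inter_all_or_none (I := Ioo (0 : ℝ) 1) isPreconnected_Ioo
        (γ := fun t => lineMap a b t) lineMap_continuous (hX.union hH.isOpen) hY
        (hXY.union_left hHY) hSc (fun t _ => hS2 t) (fun t ht => by
          obtain ⟨δ, hδ, hδb⟩ := Metric.isOpen_iff.1 hV _ (hedge t ht)
          obtain ⟨ε, hε, hεb⟩ := hP.exists_ball_inter_boundary i ht
          refine ⟨min δ ε, lt_min hδ hε, fun z hz => ?_⟩
          have hzV := hδb (ball_subset_ball (min_le_left _ _) hz.1)
          by_cases hzH : z ∈ closure H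
          · rw [hcl] at hzH
            rcases hzH with h | h
            · exact Or.inl (Or.inr h)
            · have := hεb ⟨ball_subset_ball (min_le_right _ _) hz.1, h⟩
              rw [IsSimplePolygon.edgeSet_eq] at this
              obtain ⟨r, -, rfl⟩ := mem_segment_iff_lineMap.1 this
              exact absurd hz.2 (hS1 r)
          · have : z ∈ X ∪ Y := hXYV ▸ ⟨hzV, hzH⟩
            rcases this with h | h
            · exact Or.inl (Or.inl h)
            · exact Or.inr h)
      rcases hwalk with h | h
      · exact absurd (h (1 / 2) (by norm_num)) (hmid S hS)
      · exact h
    have hcz : ∀ t : ℝ, 0 ≤ cross (b - a) (lineMap a b t - a) := fun t => (cross_lineMap a b t).ge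
    have hcz' : ∀ t : ℝ, 0 ≤ cross (-(b - a)) (lineMap a b t - a) := fun t => by
      have := cross_lineMap a b t
      simp only [cross, PiLp.neg_apply] at *
      linarith
    have w1 := walk _ (Or.inl rfl) (convex_leftOf _ _) (lineMap_notMem_leftOf a b)
      (fun t => by simpa using mem_closure_leftOf hv (hcz t) isOpen_univ (mem_univ _))
    have w2 := walk _ (Or.inr rfl) (convex_leftOf _ _) (lineMap_notMem_leftOf_neg a b)
      (fun t => by
        simpa using mem_closure_leftOf (neg_ne_zero.2 hv) (hcz' t) isOpen_univ (mem_univ _))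
    by_contra hne
    obtain ⟨y, hy⟩ := nonempty_iff_ne_empty.2 hne
    have hyM : y ∈ M := ⟨(hYV hy).1, fun h => by
      obtain ⟨l, hl⟩ := mem_iUnion.1 h
      exact (hYV hy).2 (hcl ▸ Or.inr (mem_iUnion.2 ⟨l.1, hl⟩))⟩
    have hMY : M ⊆ Y := by
      refine hM.subset_of_closure_inter_subset hY ⟨y, hyM, hy⟩ ?_
      rintro z ⟨hz, hzM⟩
      by_cases hzH : z ∈ closure H
      · rw [hcl] at hzH
        rcases hzH with h | h
        · exact absurd hz (disjoint_left.1 (hHY.closure_right hH.isOpen) h)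
        · obtain ⟨t, ht, rfl⟩ := hMP z hzM h
          rcases closure_subset_closure_leftOf (a := a) hv hY hz with h | h
          · exact absurd h (w1 t ht)
          · exact absurd h (w2 t ht)
      · have : z ∈ X ∪ Y := hXYV ▸ ⟨hzM.1, hzH⟩
        rcases this with h | h
        · exact absurd hz (disjoint_left.1 (hXY.closure_right hX) h)
        · exact h
    obtain ⟨x, hx⟩ := hH.isConnected.nonempty
    exact disjoint_left.1 hHY hx (hMY (hHM hx))
  have ht : (1 / 2 : ℝ) ∈ Ioo (0 : ℝ) 1 := by norm_num
  set x : Plane := lineMap a b (1 / 2 : ℝ)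
  obtain ⟨ε₁, hε₁, hside⟩ := hP.one_side hH.isOpen hH.isConnected.isPreconnected hf i ht ha hb rfl
  obtain ⟨ε₂, hε₂, hV₂⟩ := Metric.isOpen_iff.1 hV _ (hedge _ ht)
  set ε := min ε₁ ε₂
  have hε : 0 < ε := lt_min hε₁ hε₂
  have s1 : ball x ε ⊆ ball x ε₁ := ball_subset_ball (min_le_left _ _)
  have s2 : ball x ε ⊆ V := (ball_subset_ball (min_le_right _ _)).trans hV₂
  have notcl : ∀ Y S Z : Set Plane, ball x ε ∩ S ⊆ Z → Disjoint Z Y → x ∉ closure (Y ∩ S) := by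
    intro Y S Z hS hZ hx
    obtain ⟨y, hy, hyd⟩ := Metric.mem_closure_iff.1 hx ε hε
    exact disjoint_left.1 hZ (hS ⟨by rwa [mem_ball, dist_comm], hy.2⟩) hy.1
  -- On one side of the midpoint lies `H`; on the other lies a half ball of the exterior, which is
  -- connected and so contained in `X` or in `Y`. The remaining one of `X`, `Y` stays away from the
  -- midpoint.
  have pick : ∀ S S' : Set Plane, Convex ℝ S' → ball x ε₁ ∩ S ⊆ H →
      ball x ε₁ ∩ S' ⊆ (closure H)ᶜ →
      (x ∉ closure (Y ∩ S) ∧ x ∉ closure (Y ∩ S')) ∨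
        (x ∉ closure (X ∩ S) ∧ x ∉ closure (X ∩ S')) := by
    intro S S' hS' h1 h2
    have hsub : ball x ε ∩ S' ⊆ X ∪ Y := by
      rw [hXYV]
      exact fun z hz => ⟨s2 hz.1, h2 ⟨s1 hz.1, hz.2⟩⟩
    have h1' : ball x ε ∩ S ⊆ H := fun z hz => h1 ⟨s1 hz.1, hz.2⟩
    have hHXY : Disjoint H (X ∪ Y) := by
      rw [hXYV]
      exact disjoint_left.2 fun z hz h => h.2 (subset_closure hz)
    rcases (((convex_ball x ε).inter hS').isPreconnected).subset_or_subset hX hY hXY hsub with h | h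
    · exact Or.inl ⟨notcl _ _ _ h1' (hHXY.mono_right subset_union_right), notcl _ _ _ h hXY⟩
    · exact Or.inr ⟨notcl _ _ _ h1' (hHXY.mono_right subset_union_left), notcl _ _ _ h hXY.symm⟩
  have fin : ∀ S S' : Set Plane,
      (S = leftOf a (b - a) ∧ S' = leftOf a (-(b - a))) ∨
        (S' = leftOf a (b - a) ∧ S = leftOf a (-(b - a))) →
      Convex ℝ S' → ball x ε₁ ∩ S ⊆ H → ball x ε₁ ∩ S' ⊆ (closure H)ᶜ → X = ∅ ∨ Y = ∅ := by
    intro S S' hSS hS' h1 h2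
    rcases pick S S' hS' h1 h2 with ⟨p1, p2⟩ | ⟨p1, p2⟩
    · refine Or.inr (main X Y hX hY hXY hXYV ?_)
      rcases hSS with ⟨rfl, rfl⟩ | ⟨rfl, rfl⟩ <;> rintro T (rfl | rfl) <;> assumption
    · refine Or.inl (main Y X hY hX hXY.symm (by rwa [union_comm]) ?_)
      rcases hSS with ⟨rfl, rfl⟩ | ⟨rfl, rfl⟩ <;> rintro T (rfl | rfl) <;> assumption
  rcases hside with ⟨h1, h2⟩ | ⟨h1, h2⟩
  · exact fin _ _ (Or.inl ⟨rfl, rfl⟩) (convex_leftOf _ _) h1 h2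
  · exact fin _ _ (Or.inr ⟨rfl, rfl⟩) (convex_leftOf _ _) h1 h2

/-- The boundary of a polygon is also the boundary of its exterior. -/
lemma frontier_subset_closure_compl (hH : IsPolygonInterior H) :
    frontier H ⊆ closure (closure H)ᶜ := by
  obtain ⟨n, P, hP, hf⟩ := hH.frontier_eq
  rw [hf]
  refine iUnion_subset fun i => ?_
  set a := P.vertices i with ha
  set b := P.vertices (finRotate n i) with hb
  have hv : b - a ≠ 0 := sub_ne_zero.2 (hP.vertex_ne i).symm
  have hopen : ∀ t ∈ Ioo (0 : ℝ) 1, lineMap a b t ∈ closure (closure H)ᶜ := by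
    intro t ht
    obtain ⟨ε, hε, h⟩ := hP.one_side hH.isOpen hH.isConnected.isPreconnected hf i ht ha hb rfl
    have hx0' : 0 ≤ cross (-(b - a)) (lineMap a b t - a) := by
      have := cross_lineMap a b t
      simp only [cross, PiLp.neg_apply] at *
      linarith
    rcases h with ⟨-, h⟩ | ⟨-, h⟩
    · exact closure_mono h (mem_closure_leftOf (neg_ne_zero.2 hv) hx0' isOpen_ball
        (mem_ball_self hε))
    · exact closure_mono h (mem_closure_leftOf hv (cross_lineMap a b t).ge isOpen_ball
        (mem_ball_self hε))
  rw [IsSimplePolygon.edgeSet_eq]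
  intro x hx
  obtain ⟨t, ht, rfl⟩ := mem_segment_iff_lineMap.1 hx
  have hcl : IsClosed ((fun t : ℝ => lineMap a b t) ⁻¹' closure (closure H)ᶜ) :=
    isClosed_closure.preimage lineMap_continuous
  have : closure (Ioo (0 : ℝ) 1) ⊆ _ := hcl.closure_subset_iff.2 hopen
  rw [closure_Ioo zero_ne_one] at this
  exact this ht

/-- Every boundary point is a limit of exterior points, so a polygon interior is the interior of its
own closure. -/
lemma disjoint_frontier_interior_closure (hH : IsPolygonInterior H) :
    Disjoint (frontier H) (interior (closure H)) := by
  refine disjoint_left.2 fun x hx hxi => ?_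
  have := hH.frontier_subset_closure_compl hx
  rw [closure_compl] at this
  exact this hxi

/-- The case `V = ℝ²`. It forces a potential with zero gradient outside the outer polygon to be a
single constant there. -/
lemma isPreconnected_compl_closure (hH : IsPolygonInterior H) : IsPreconnected (closure H)ᶜ := by
  have := hH.isPreconnected_diff_closure isOpen_univ isPreconnected_univ (subset_univ _)
  rwa [← compl_eq_univ_sdiff] at this

/-- Finite length lets uniform convergence imply convergence in `L²` of the boundary curve. -/
lemma hausdorffMeasure_frontier_lt_top (hH : IsPolygonInterior H) :
    Measure.hausdorffMeasure 1 (frontier H) < ⊤ := by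
  obtain ⟨n, P, hP, hf⟩ := hH.frontier_eq
  rw [hf, Polygon.boundary]
  refine (measure_iUnion_fintype_le _ _).trans_lt (ENNReal.sum_lt_top.2 fun i _ => ?_)
  rw [IsSimplePolygon.edgeSet_eq, hausdorffMeasure_segment]
  exact edist_lt_top _ _

/-- Positive length is what prevents a nonzero constant from having trace zero. -/
lemma hausdorffMeasure_frontier_pos (hH : IsPolygonInterior H) :
    0 < Measure.hausdorffMeasure 1 (frontier H) := by
  obtain ⟨n, P, hP, hf⟩ := hH.frontier_eq
  have := hP.three_le
  set i : Fin n := ⟨0, by omega⟩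
  have hsub : P.edgeSet ℝ i ⊆ frontier H := hf ▸ subset_iUnion (fun i => P.edgeSet ℝ i) i
  refine lt_of_lt_of_le ?_ (measure_mono hsub)
  rw [IsSimplePolygon.edgeSet_eq, hausdorffMeasure_segment]
  exact edist_pos.2 (hP.vertex_ne i)

lemma volume_segment (a b : Plane) : volume (segment ℝ a b) = 0 := by
  refine measure_mono_null ?_ (Measure.addHaar_affineSubspace volume (line[ℝ, a, b]) ?_)
  · rw [← convexHull_pair]
    exact (convexHull_subset_affineSpan _)
  · intro h
    have h2 : Module.finrank ℝ (line[ℝ, a, b]).direction ≤ 1 := by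
      rw [direction_affineSpan]
      have := collinear_pair ℝ a b
      exact collinear_iff_finrank_le_one.1 this
    rw [h, AffineSubspace.direction_top, finrank_top, finrank_euclideanSpace_fin] at h2
    omega

lemma volume_frontier (hH : IsPolygonInterior H) : volume (frontier H) = 0 := by
  obtain ⟨n, P, hP, hf⟩ := hH.frontier_eq
  rw [hf, Polygon.boundary, measure_iUnion_null_iff]
  intro i
  rw [IsSimplePolygon.edgeSet_eq]
  exact volume_segment _ _

end IsPolygonInterior

/-! ### Topology of the multiply-connected domain -/

namespace MultiplyConnectedPolygon

variable {J : ℕ} (D : MultiplyConnectedPolygon J)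

lemma closure_hole_subset (j : Fin J) : closure (D.hole j) ⊆ D.outer := by
  intro x hx
  have h1 : x ∈ closure D.outer := closure_mono (D.hole_subset j) hx
  rw [closure_eq_self_union_frontier] at h1 hx
  rcases hx with hx | hx
  · exact D.hole_subset j hx
  · exact h1.resolve_right fun h => disjoint_left.1 (D.frontier_outer_disjoint j) h hx

lemma disjoint_closure_hole {i j : Fin J} (hij : i ≠ j) :
    Disjoint (closure (D.hole i)) (closure (D.hole j)) := by
  have h := D.hole_disjoint i j hij
  refine disjoint_left.2 fun x hi hj => ?_
  have h1 := h.closure_left (D.hole_polygon j).isOpen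
  have h2 := h.closure_right (D.hole_polygon i).isOpen
  have hi' := hi
  have hj' := hj
  rw [closure_eq_self_union_frontier] at hi' hj'
  rcases hi' with hi' | hi'
  · exact disjoint_left.1 h2 hi' hj
  · rcases hj' with hj' | hj'
    · exact disjoint_left.1 h1 hi hj'
    · exact disjoint_left.1 (D.frontier_hole_disjoint i j hij) hi' hj'

lemma isOpen_domain : IsOpen D.domain :=
  D.outer_polygon.isOpen.sdiff (isClosed_iUnion_of_finite fun _ => isClosed_closure)

lemma isBounded_domain : Bornology.IsBounded D.domain :=
  D.outer_polygon.isBounded.subset Set.sdiff_subset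

/-- The multiply-connected polygon is connected. -/
lemma isPreconnected_domain : IsPreconnected D.domain := by
  -- The holes are removed one by one. Each closed hole still lies in what remains, because the
  -- closed holes are pairwise disjoint.
  have key : ∀ s : Finset (Fin J), IsPreconnected (D.outer \ ⋃ j ∈ s, closure (D.hole j)) := by
    intro s
    induction s using Finset.induction_on with
    | empty => simpa using D.outer_polygon.isConnected.isPreconnected
    | insert j s hj ih =>
      have hcl : IsClosed (⋃ i ∈ s, closure (D.hole i)) :=
        s.finite_toSet.isClosed_biUnion fun _ _ => isClosed_closure
      rw [Finset.set_biUnion_insert, union_comm, ← Set.sdiff_sdiff]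
      refine (D.hole_polygon j).isPreconnected_diff_closure
        (D.outer_polygon.isOpen.sdiff hcl) ih fun x hx => ⟨D.closure_hole_subset j hx, fun h => ?_⟩
      simp only [mem_iUnion] at h
      obtain ⟨i, hi, hxi⟩ := h
      have hij : i ≠ j := fun e => hj (e ▸ hi)
      exact disjoint_left.1 (D.disjoint_closure_hole hij) hxi hx
  simpa [domain] using key Finset.univ

lemma disjoint_hole_domain (j : Fin J) : Disjoint (D.hole j) D.domain :=
  disjoint_left.2 fun _ hx h => h.2 (mem_iUnion.2 ⟨j, subset_closure hx⟩)

lemma frontier_domain_subset :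
    frontier D.domain ⊆ frontier D.outer ∪ ⋃ j, frontier (D.hole j) := by
  intro x hx
  rw [frontier, D.isOpen_domain.interior_eq] at hx
  have h1 : x ∈ closure D.outer := closure_mono sdiff_subset hx.1
  rw [closure_eq_self_union_frontier] at h1
  rcases h1 with h1 | h1
  · right
    have h2 : x ∈ ⋃ j, closure (D.hole j) := by
      by_contra h
      exact hx.2 ⟨h1, h⟩
    obtain ⟨j, hj⟩ := mem_iUnion.1 h2
    rw [closure_eq_self_union_frontier] at hj
    rcases hj with hj | hj
    · exact absurd hx.1 (disjoint_left.1
        ((D.disjoint_hole_domain j).closure_right (D.hole_polygon j).isOpen) hj)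
    · exact mem_iUnion.2 ⟨j, hj⟩
  · exact Or.inl h1

/-- A boundary point of the domain is on the outer curve or on the curve of a hole. The outer curve
misses the interior of the closed outer polygon, and the closed holes miss the interior of the
closed domain. This places the interiors of the cells inside the domain. -/
lemma interior_closure_domain_subset : interior (closure D.domain) ⊆ D.domain := by
  intro x hx
  have hxc : x ∈ closure D.domain := interior_subset hx
  by_contra hxd
  have hxf : x ∈ frontier D.domain := by
    rw [frontier, D.isOpen_domain.interior_eq]
    exact ⟨hxc, hxd⟩
  rcases D.frontier_domain_subset hxf with h | h
  · exact disjoint_left.1 D.outer_polygon.disjoint_frontier_interior_closure h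
      (interior_mono (closure_mono sdiff_subset) hx)
  · obtain ⟨j, hj⟩ := mem_iUnion.1 h
    have h1 := (D.disjoint_hole_domain j).closure_right (D.hole_polygon j).isOpen
    have h2 : Disjoint (closure (D.hole j)) (interior (closure D.domain)) :=
      (h1.mono_right interior_subset).closure_left isOpen_interior
    exact disjoint_left.1 h2 (frontier_subset_closure hj) hx

lemma volume_frontier_domain : volume (frontier D.domain) = 0 :=
  measure_mono_null D.frontier_domain_subset (measure_union_null D.outer_polygon.volume_frontier
    (measure_iUnion_null fun j => (D.hole_polygon j).volume_frontier))

/-- The closed holes lie inside the open set `outer`, so near the outer curve the domain agrees with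
`outer`. -/
lemma frontier_outer_subset_closure : frontier D.outer ⊆ closure D.domain := by
  intro x hx
  have hcl : IsClosed (⋃ j, closure (D.hole j)) :=
    isClosed_iUnion_of_finite fun _ => isClosed_closure
  have hxn : x ∈ (⋃ j, closure (D.hole j))ᶜ := by
    intro h
    obtain ⟨j, hj⟩ := mem_iUnion.1 h
    exact disjoint_left.1 D.outer_polygon.disjoint_frontier (D.closure_hole_subset j hj) hx
  have := hcl.isOpen_compl.inter_closure ⟨hxn, frontier_subset_closure hx⟩
  rwa [inter_comm, ← sdiff_eq] at this

lemma disjoint_domain_frontier_outer : Disjoint D.domain (frontier D.outer) :=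
  D.outer_polygon.disjoint_frontier.mono_left sdiff_subset

end MultiplyConnectedPolygon

end

section

/-! ### Green's formula on a triangle -/

/-- The standard simplex in `ℝ × ℝ`. -/
def stdTriangle : Set (ℝ × ℝ) := {z | 0 ≤ z.1 ∧ 0 ≤ z.2 ∧ z.1 + z.2 ≤ 1}

lemma isClosed_stdTriangle : IsClosed stdTriangle :=
  (isClosed_le continuous_const continuous_fst).inter
    ((isClosed_le continuous_const continuous_snd).inter
      (isClosed_le (continuous_fst.add continuous_snd) continuous_const))

lemma isCompact_stdTriangle : IsCompact stdTriangle := by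
  refine (isCompact_Icc (a := ((0 : ℝ), (0 : ℝ))) (b := (1, 1))).of_isClosed_subset
    isClosed_stdTriangle ?_
  rintro ⟨r, s⟩ ⟨h1, h2, h3⟩
  simp only at h1 h2 h3
  exact ⟨⟨h1, h2⟩, ⟨by simp only; linarith, by simp only; linarith⟩⟩

lemma setIntegral_stdTriangle {g : ℝ × ℝ → ℝ} (hg : Continuous g) :
    ∫ z in stdTriangle, g z = ∫ s in (0 : ℝ)..1, ∫ r in (0 : ℝ)..(1 - s), g (r, s) := by
  have hint : Integrable (stdTriangle.indicator g) :=
    (hg.continuousOn.integrableOn_compact isCompact_stdTriangle).integrable_indicator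
      isClosed_stdTriangle.measurableSet
  rw [← integral_indicator isClosed_stdTriangle.measurableSet, Measure.volume_eq_prod,
    integral_prod_symm _ (by rwa [← Measure.volume_eq_prod]),
    intervalIntegral.integral_of_le zero_le_one, ← integral_Icc_eq_integral_Ioc,
    ← integral_indicator measurableSet_Icc]
  congr 1
  ext s
  by_cases hs : s ∈ Icc (0 : ℝ) 1
  · rw [indicator_of_mem hs, intervalIntegral.integral_of_le (by linarith [hs.2]),
      ← integral_Icc_eq_integral_Ioc, ← integral_indicator measurableSet_Icc]
    congr 1
    ext r
    by_cases hr : r ∈ Icc 0 (1 - s)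
    · rw [indicator_of_mem hr, indicator_of_mem]
      exact ⟨hr.1, hs.1, by simp only; linarith [hr.2]⟩
    · rw [indicator_of_notMem hr, indicator_of_notMem]
      rintro ⟨h1, -, h3⟩
      simp only at h1 h3
      exact hr ⟨h1, by linarith⟩
  · rw [indicator_of_notMem hs]
    have : ∀ r, stdTriangle.indicator g (r, s) = 0 := fun r => by
      rw [indicator_of_notMem]
      rintro ⟨h1, h2, h3⟩
      simp only at h1 h2 h3
      exact hs ⟨h2, by linarith⟩
    simp [this]

lemma setIntegral_stdTriangle_swap {g : ℝ × ℝ → ℝ} (hg : Continuous g) :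
    ∫ z in stdTriangle, g z = ∫ r in (0 : ℝ)..1, ∫ s in (0 : ℝ)..(1 - r), g (r, s) := by
  have h := setIntegral_stdTriangle (hg.comp continuous_swap)
  have h2 := (Measure.measurePreserving_swap (μ := (volume : Measure ℝ))
    (ν := (volume : Measure ℝ))).setIntegral_preimage_emb
    MeasurableEquiv.prodComm.measurableEmbedding g stdTriangle
  have h3 : Prod.swap ⁻¹' stdTriangle = stdTriangle := by
    ext ⟨r, s⟩
    simp only [stdTriangle, mem_preimage, mem_ofPred_eq, Prod.swap, add_comm s r]
    tauto
  rw [h3] at h2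
  rw [Measure.volume_eq_prod, ← h2, ← Measure.volume_eq_prod]
  exact h

/-- The divergence theorem for a radial field on the standard triangle. -/
lemma setIntegral_stdTriangle_radial {f fr fs : ℝ × ℝ → ℝ} (hfr : Continuous fr)
    (hfs : Continuous fs) (hf : Continuous f)
    (h1 : ∀ r s, HasDerivAt (fun r => f (r, s)) (fr (r, s)) r)
    (h2 : ∀ r s, HasDerivAt (fun s => f (r, s)) (fs (r, s)) s) :
    ∫ z in stdTriangle, (z.1 * fr z + z.2 * fs z + 2 * f z) =
      ∫ s in (0 : ℝ)..1, f (1 - s, s) := by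
  -- The integrand is `∂_r (r f) + ∂_s (s f)`. Each summand is integrated first in its own variable;
  -- the results carry the weights `1 - s` and `s` on the hypotenuse, which add up to 1.
  have c1 : Continuous fun z : ℝ × ℝ => f z + z.1 * fr z := by fun_prop
  have c2 : Continuous fun z : ℝ × ℝ => f z + z.2 * fs z := by fun_prop
  have e1 : ∫ z in stdTriangle, (f z + z.1 * fr z) =
      ∫ s in (0 : ℝ)..1, (1 - s) * f (1 - s, s) := by
    rw [setIntegral_stdTriangle c1]
    refine intervalIntegral.integral_congr fun s _ => ?_
    simp only
    rw [intervalIntegral.integral_eq_sub_of_hasDerivAt (f := fun r => r * f (r, s))]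
    · simp
    · intro r _
      convert! (hasDerivAt_id r).mul (h1 r s) using 1
      simp
    · exact Continuous.intervalIntegrable (by fun_prop) _ _
  have e2 : ∫ z in stdTriangle, (f z + z.2 * fs z) =
      ∫ s in (0 : ℝ)..1, s * f (1 - s, s) := by
    rw [setIntegral_stdTriangle_swap c2]
    have : ∀ r, ∫ s in (0 : ℝ)..(1 - r), (f (r, s) + s * fs (r, s)) =
        (fun s => s * f (1 - s, s)) (1 - r) := by
      intro r
      rw [intervalIntegral.integral_eq_sub_of_hasDerivAt (f := fun s => s * f (r, s))]
      · simp
      · intro s _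
        convert! (hasDerivAt_id s).mul (h2 r s) using 1
        simp
      · exact Continuous.intervalIntegrable (by fun_prop) _ _
    simp only [this]
    rw [intervalIntegral.integral_comp_sub_left (fun s => s * f (1 - s, s))]
    simp
  have i1 : IntegrableOn (fun z : ℝ × ℝ => f z + z.1 * fr z) stdTriangle :=
    c1.continuousOn.integrableOn_compact isCompact_stdTriangle
  have i2 : IntegrableOn (fun z : ℝ × ℝ => f z + z.2 * fs z) stdTriangle :=
    c2.continuousOn.integrableOn_compact isCompact_stdTriangle
  have e3 : ∫ z in stdTriangle, (z.1 * fr z + z.2 * fs z + 2 * f z) =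
      ∫ z in stdTriangle, ((f z + z.1 * fr z) + (f z + z.2 * fs z)) :=
    integral_congr_ae (Eventually.of_forall fun z => by ring)
  rw [e3, integral_add i1 i2, e1, e2, ← intervalIntegral.integral_add
    (Continuous.intervalIntegrable (by fun_prop) _ _)
    (Continuous.intervalIntegrable (by fun_prop) _ _)]
  refine intervalIntegral.integral_congr fun s _ => ?_
  ring

/-- The linear map that sends the standard basis to `A`, `B`. -/
def columnMap (A B : Plane) : Plane →L[ℝ] Plane :=
  (EuclideanSpace.proj (𝕜 := ℝ) (0 : Fin 2)).smulRight A +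
    (EuclideanSpace.proj (𝕜 := ℝ) (1 : Fin 2)).smulRight B

lemma columnMap_apply (A B y : Plane) : columnMap A B y = y 0 • A + y 1 • B := by
  simp [columnMap]

lemma det_columnMap (A B : Plane) : (columnMap A B).det = cross A B := by
  rw [ContinuousLinearMap.det,
    ← LinearMap.det_toMatrix (EuclideanSpace.basisFun (Fin 2) ℝ).toBasis, Matrix.det_fin_two]
  simp only [LinearMap.toMatrix_apply, OrthonormalBasis.coe_toBasis,
    EuclideanSpace.basisFun_apply, ContinuousLinearMap.coe_coe, columnMap_apply,
    OrthonormalBasis.coe_toBasis_repr_apply, EuclideanSpace.basisFun_repr]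
  simp [cross]
  ring

/-- The affine map from the standard triangle to the triangle `p`, `a`, `b`. -/
def triangleMap (p a b : Plane) (y : Plane) : Plane := p + (y 0 • (a - p) + y 1 • (b - p))

/-- The standard triangle as a subset of the Euclidean plane. -/
def stdTriangle' : Set Plane := {y | 0 ≤ y 0 ∧ 0 ≤ y 1 ∧ y 0 + y 1 ≤ 1}

lemma triangleMap_injective {p a b : Plane} (h : cross (a - p) (b - p) ≠ 0) :
    Function.Injective (triangleMap p a b) := by
  intro y z hyz
  have h0 := congrArg (fun x : Plane => x 0) hyz
  have h1 := congrArg (fun x : Plane => x 1) hyz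
  simp only [triangleMap, cross, PiLp.add_apply, PiLp.smul_apply, PiLp.sub_apply,
    smul_eq_mul] at h0 h1 h
  refine plane_ext ?_ ?_
  · refine mul_right_cancel₀ h ?_
    linear_combination (b 1 - p 1) * h0 - (b 0 - p 0) * h1
  · refine mul_right_cancel₀ h ?_
    linear_combination (a 0 - p 0) * h1 - (a 1 - p 1) * h0

lemma convexHull_triangle (p a b : Plane) :
    convexHull ℝ {p, a, b} = triangleMap p a b '' stdTriangle' := by
  apply Subset.antisymm
  · refine convexHull_min ?_ ?_
    · rintro x (rfl | rfl | rfl)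
      · exact ⟨0, by simp [stdTriangle'], by simp [triangleMap]⟩
      · exact ⟨EuclideanSpace.single 0 1, by simp [stdTriangle'], by simp [triangleMap]⟩
      · exact ⟨EuclideanSpace.single 1 1, by simp [stdTriangle'], by simp [triangleMap]⟩
    · rintro _ ⟨y, ⟨hy0, hy1, hy2⟩, rfl⟩ _ ⟨z, ⟨hz0, hz1, hz2⟩, rfl⟩ s t hs ht hst
      refine ⟨s • y + t • z, ⟨?_, ?_, ?_⟩, ?_⟩
      · simp only [PiLp.add_apply, PiLp.smul_apply, smul_eq_mul]; positivity
      · simp only [PiLp.add_apply, PiLp.smul_apply, smul_eq_mul]; positivity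
      · simp only [PiLp.add_apply, PiLp.smul_apply, smul_eq_mul]
        nlinarith
      · refine plane_ext ?_ ?_ <;>
          simp only [triangleMap, PiLp.add_apply, PiLp.smul_apply, PiLp.sub_apply, smul_eq_mul]
        · linear_combination (-p 0) * hst
        · linear_combination (-p 1) * hst
  · rintro _ ⟨y, ⟨hy0, hy1, hy2⟩, rfl⟩
    have hc := convex_convexHull ℝ ({p, a, b} : Set Plane)
    have hp : p ∈ convexHull ℝ ({p, a, b} : Set Plane) := subset_convexHull ℝ _ (by simp)
    have ha : a ∈ convexHull ℝ ({p, a, b} : Set Plane) := subset_convexHull ℝ _ (by simp)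
    have hb : b ∈ convexHull ℝ ({p, a, b} : Set Plane) := subset_convexHull ℝ _ (by simp)
    have := hc.sum_mem (t := Finset.univ) (w := ![1 - y 0 - y 1, y 0, y 1]) (z := ![p, a, b])
      (fun i _ => by fin_cases i <;> simp <;> linarith)
      (by simp [Fin.sum_univ_three]; ring) (fun i _ => by fin_cases i <;> simp [hp, ha, hb])
    convert this using 1
    simp only [Fin.sum_univ_three, triangleMap]
    simp
    module

lemma hasFDerivAt_triangleMap (p a b y : Plane) :
    HasFDerivAt (triangleMap p a b) (columnMap (a - p) (b - p)) y := by
  have : triangleMap p a b = fun y => p + columnMap (a - p) (b - p) y := by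
    ext1 y; rw [columnMap_apply, triangleMap]
  rw [this]
  exact (columnMap (a - p) (b - p)).hasFDerivAt.const_add p

/-- The coordinates of the Euclidean plane. -/
def planeEquiv : Plane ≃ᵐ ℝ × ℝ :=
  (MeasurableEquiv.toLp 2 (Fin 2 → ℝ)).symm.trans MeasurableEquiv.finTwoArrow

lemma measurePreserving_planeEquiv : MeasurePreserving planeEquiv :=
  (volume_preserving_finTwoArrow ℝ).comp
    (EuclideanSpace.volume_preserving_symm_measurableEquiv_toLp (Fin 2))

lemma isClosed_stdTriangle' : IsClosed stdTriangle' :=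
  (isClosed_le continuous_const (continuous_coord 0)).inter
    ((isClosed_le continuous_const (continuous_coord 1)).inter
      (isClosed_le ((continuous_coord 0).add (continuous_coord 1)) continuous_const))

lemma setIntegral_triangle {p a b : Plane} (h : cross (a - p) (b - p) ≠ 0) (g : Plane → ℝ) :
    ∫ x in convexHull ℝ {p, a, b}, g x = |cross (a - p) (b - p)| *
      ∫ z in stdTriangle, g (p + (z.1 • (a - p) + z.2 • (b - p))) := by
  have h2 := measurePreserving_planeEquiv.setIntegral_preimage_emb
    planeEquiv.measurableEmbedding (fun z => g (p + (z.1 • (a - p) + z.2 • (b - p)))) stdTriangle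
  rw [convexHull_triangle, integral_image_eq_integral_abs_det_fderiv_smul volume
    isClosed_stdTriangle'.measurableSet
    (fun y _ => (hasFDerivAt_triangleMap p a b y).hasFDerivWithinAt)
    (triangleMap_injective h).injOn, det_columnMap]
  simp only [smul_eq_mul]
  rw [integral_const_mul, ← h2]
  rfl

/-- The mean value of a function on the segment from `a` to `b`. -/
def edgeMean (a b : Plane) (φ : Plane → ℝ) : ℝ := ∫ s in (0 : ℝ)..1, φ (lineMap a b s)

lemma edgeMean_comm (a b : Plane) (φ : Plane → ℝ) : edgeMean a b φ = edgeMean b a φ := by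
  unfold edgeMean
  have := intervalIntegral.integral_comp_sub_left (a := 0) (b := 1)
    (fun s => φ (lineMap a b s)) (1 : ℝ)
  simp only [sub_self, sub_zero] at this
  rw [← this]
  simp only [lineMap_apply_one_sub]

/-- The divergence theorem for a radial field on a triangle. -/
lemma setIntegral_triangle_radial {p a b : Plane} (h : cross (a - p) (b - p) ≠ 0) {φ : Plane → ℝ}
    (hφ : ContDiff ℝ 1 φ) :
    ∫ x in convexHull ℝ {p, a, b}, (fderiv ℝ φ x (x - p) + 2 * φ x) =
      |cross (a - p) (b - p)| * edgeMean a b φ := by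
  rw [setIntegral_triangle h]
  congr 1
  set Ψ : ℝ × ℝ → Plane := fun z => p + (z.1 • (a - p) + z.2 • (b - p)) with hΨ
  have hΨc : Continuous Ψ := by fun_prop
  have hd := hφ.differentiable (by norm_num)
  have hdc := hφ.continuous_fderiv (by norm_num)
  have key := setIntegral_stdTriangle_radial (f := fun z => φ (Ψ z))
    (fr := fun z => fderiv ℝ φ (Ψ z) (a - p)) (fs := fun z => fderiv ℝ φ (Ψ z) (b - p))
    (by fun_prop) (by fun_prop) (hφ.continuous.comp hΨc)
    (fun r s => by
      refine (hd (Ψ (r, s))).hasFDerivAt.comp_hasDerivAt (f := fun r => Ψ (r, s)) r ?_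
      have := (((hasDerivAt_id r).smul_const (a - p)).add_const (s • (b - p))).const_add p
      rw [one_smul] at this
      exact this)
    (fun r s => by
      refine (hd (Ψ (r, s))).hasFDerivAt.comp_hasDerivAt (f := fun s => Ψ (r, s)) s ?_
      have := (((hasDerivAt_id s).smul_const (b - p)).const_add (r • (a - p))).const_add p
      rw [one_smul] at this
      exact this)
  have e : ∀ z : ℝ × ℝ, fderiv ℝ φ (Ψ z) (Ψ z - p) =
      z.1 * fderiv ℝ φ (Ψ z) (a - p) + z.2 * fderiv ℝ φ (Ψ z) (b - p) := by
    intro z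
    rw [show Ψ z - p = z.1 • (a - p) + z.2 • (b - p) by simp [Ψ], map_add, map_smul, map_smul]
    rfl
  refine (integral_congr_ae (Eventually.of_forall fun z => ?_)).trans (key.trans ?_)
  · exact congrArg (· + 2 * φ (Ψ z)) (e z)
  rw [edgeMean]
  refine intervalIntegral.integral_congr fun s _ => ?_
  show φ (p + ((1 - s) • (a - p) + s • (b - p))) = φ (lineMap a b s)
  congr 1
  refine plane_ext ?_ ?_ <;>
    simp only [lineMap_coord, PiLp.add_apply, PiLp.smul_apply, PiLp.sub_apply, smul_eq_mul] <;> ring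

/-- The radial identity for the constant function 1. -/
lemma volume_triangle {p a b : Plane} (h : cross (a - p) (b - p) ≠ 0) :
    2 * (volume (convexHull ℝ {p, a, b})).toReal = |cross (a - p) (b - p)| := by
  have := setIntegral_triangle_radial h (φ := fun _ => 1) contDiff_const
  simp [edgeMean, Measure.real] at this
  linarith

lemma isOpenMap_triangleMap {p a b : Plane} (h : cross (a - p) (b - p) ≠ 0) :
    IsOpenMap (triangleMap p a b) := by
  have hinj : Function.Injective (columnMap (a - p) (b - p)) := by
    intro y z hyz
    apply triangleMap_injective h
    rw [columnMap_apply, columnMap_apply] at hyz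
    simp only [triangleMap, hyz]
  have hsurj : Function.Surjective (columnMap (a - p) (b - p)) :=
    LinearMap.injective_iff_surjective.1 hinj
  have ho := (columnMap (a - p) (b - p)).isOpenMap hsurj
  have : triangleMap p a b = (Homeomorph.addLeft p) ∘ columnMap (a - p) (b - p) := by
    ext1 y; rw [Function.comp_apply, columnMap_apply, triangleMap]; rfl
  rw [this]
  exact (Homeomorph.addLeft p).isOpenMap.comp ho

/-- A point of a triangle is in its interior or on one of its edges. -/
lemma mem_edge_of_notMem_interior {p a b x : Plane} (h : cross (a - p) (b - p) ≠ 0)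
    (hx : x ∈ convexHull ℝ {p, a, b}) (hxi : x ∉ interior (convexHull ℝ {p, a, b})) :
    x ∈ segment ℝ a b ∨ x ∈ segment ℝ b p ∨ x ∈ segment ℝ p a := by
  rw [convexHull_triangle] at hx hxi
  obtain ⟨y, ⟨hy0, hy1, hy2⟩, rfl⟩ := hx
  set O : Set Plane := {y | 0 < y 0 ∧ 0 < y 1 ∧ y 0 + y 1 < 1}
  have hO : IsOpen O := (isOpen_lt continuous_const (continuous_coord 0)).inter
    ((isOpen_lt continuous_const (continuous_coord 1)).inter
      (isOpen_lt ((continuous_coord 0).add (continuous_coord 1)) continuous_const))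
  have hOs : triangleMap p a b '' O ⊆ triangleMap p a b '' stdTriangle' :=
    image_mono fun z hz => ⟨hz.1.le, hz.2.1.le, hz.2.2.le⟩
  have hOi := interior_maximal hOs (isOpenMap_triangleMap h O hO)
  have hyO : y ∉ O := fun hy => hxi (hOi ⟨y, hy, rfl⟩)
  have : y 0 = 0 ∨ y 1 = 0 ∨ y 0 + y 1 = 1 := by
    by_contra hc
    push Not at hc
    exact hyO ⟨hy0.lt_of_ne hc.1.symm, hy1.lt_of_ne hc.2.1.symm, hy2.lt_of_ne hc.2.2⟩
  rcases this with h0 | h1 | h2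
  · refine Or.inr (Or.inl (mem_segment_iff_lineMap.2 ⟨1 - y 1, ⟨by linarith, by linarith⟩, ?_⟩))
    refine plane_ext ?_ ?_ <;> simp only [triangleMap, lineMap_coord, PiLp.add_apply,
      PiLp.smul_apply, PiLp.sub_apply, smul_eq_mul, h0] <;> ring
  · refine Or.inr (Or.inr (mem_segment_iff_lineMap.2 ⟨y 0, ⟨by linarith, by linarith⟩, ?_⟩))
    refine plane_ext ?_ ?_ <;> simp only [triangleMap, lineMap_coord, PiLp.add_apply,
      PiLp.smul_apply, PiLp.sub_apply, smul_eq_mul, h1] <;> ring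
  · refine Or.inl (mem_segment_iff_lineMap.2 ⟨y 1, ⟨by linarith, by linarith⟩, ?_⟩)
    have : y 0 = 1 - y 1 := by linarith
    refine plane_ext ?_ ?_ <;> simp only [triangleMap, lineMap_coord, PiLp.add_apply,
      PiLp.smul_apply, PiLp.sub_apply, smul_eq_mul, this] <;> ring

/-- If the determinant vanished, each coordinate would supply a linear relation between `a - p` and
`b - p` whose coefficients are coordinates of these vectors. Independence makes all of them zero, so
`p = a`. -/
lemma cross_ne_zero_of_affineIndependent {p a b : Plane} (hpa : p ≠ a) (hpb : p ≠ b) (hab : a ≠ b)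
    (h : AffineIndependent ℝ ((↑) : ({p, a, b} : Set Plane) → Plane)) :
    cross (a - p) (b - p) ≠ 0 := by
  have h' : AffineIndependent ℝ ![p, a, b] := by
    have := h.comp_embedding (⟨![⟨p, by simp⟩, ⟨a, by simp⟩, ⟨b, by simp⟩], by
      intro i j hij
      fin_cases i <;> fin_cases j <;> simp_all [Subtype.ext_iff]⟩ :
        Fin 3 ↪ ({p, a, b} : Set Plane))
    convert this using 1
    ext i : 1
    fin_cases i <;> rfl
  have hl := (affineIndependent_iff_linearIndependent_vsub ℝ _ (0 : Fin 3)).1 h'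
  intro hc
  have hcomb := hl.comp (![⟨1, by simp⟩, ⟨2, by simp⟩] : Fin 2 → {x : Fin 3 // x ≠ 0}) (by
    intro i j hij
    fin_cases i <;> fin_cases j <;> simp_all [Subtype.ext_iff])
  have hpair : LinearIndependent ℝ ![a - p, b - p] := by
    have e : ![a - p, b - p] = (fun i : {x : Fin 3 // x ≠ 0} => ![p, a, b] ↑i -ᵥ ![p, a, b] 0) ∘
        (![⟨1, by simp⟩, ⟨2, by simp⟩] : Fin 2 → {x : Fin 3 // x ≠ 0}) := by
      ext i : 1
      fin_cases i
      · exact rfl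
      · exact rfl
    rw [e]
    exact hcomb
  rw [LinearIndependent.pair_iff] at hpair
  simp only [cross, PiLp.sub_apply] at hc
  have e0 := hpair (b 0 - p 0) (-(a 0 - p 0)) (by
    refine plane_ext ?_ ?_ <;> simp only [PiLp.add_apply, PiLp.smul_apply, PiLp.sub_apply,
      smul_eq_mul, PiLp.zero_apply] <;> linarith)
  have e1 := hpair (b 1 - p 1) (-(a 1 - p 1)) (by
    refine plane_ext ?_ ?_ <;> simp only [PiLp.add_apply, PiLp.smul_apply, PiLp.sub_apply,
      smul_eq_mul, PiLp.zero_apply] <;> linarith)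
  exact hpa (plane_ext (by linarith [e0.2]) (by linarith [e1.2]))

end

section

/-! ### Mollification -/

/-- The bump function of radius `1 / (k + 1)`. -/
def kernelBump (k : ℕ) : ContDiffBump (0 : Plane) where
  rIn := 1 / (2 * (k + 1))
  rOut := 1 / (k + 1)
  rIn_pos := by positivity
  rIn_lt_rOut := by
    have : (0 : ℝ) < k + 1 := by positivity
    exact one_div_lt_one_div_of_lt this (by linarith)

/-- A smooth mollifier supported in the ball of radius `1 / (k + 1)`. -/
def kernel (k : ℕ) : Plane → ℝ := (kernelBump k).normed volume

lemma contDiff_kernel (k : ℕ) : ContDiff ℝ ∞ (kernel k) := (kernelBump k).contDiff_normed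

lemma kernel_nonneg (k : ℕ) (x : Plane) : 0 ≤ kernel k x := (kernelBump k).nonneg_normed x

lemma integral_kernel (k : ℕ) : ∫ x, kernel k x = 1 := (kernelBump k).integral_normed

lemma integrable_kernel (k : ℕ) : Integrable (kernel k) := (kernelBump k).integrable_normed

lemma hasCompactSupport_kernel (k : ℕ) : HasCompactSupport (kernel k) :=
  (kernelBump k).hasCompactSupport_normed

lemma kernel_eq_zero {k : ℕ} {x : Plane} (h : 1 / ((k : ℝ) + 1) ≤ ‖x‖) : kernel k x = 0 := by
  have : x ∉ Function.support (kernel k) := by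
    have e : Function.support (kernel k) = ball 0 (1 / (k + 1)) :=
      (kernelBump k).support_normed_eq
    rw [e, mem_ball_zero_iff]
    linarith
  simpa using this

lemma isTest_kernel_sub (k : ℕ) (x : Plane) {U : Set Plane}
    (hU : closedBall x (1 / (k + 1)) ⊆ U) : IsTest U fun t => kernel k (x - t) where
  contDiff := (contDiff_kernel k).comp (contDiff_const.sub contDiff_id)
  compact := (hasCompactSupport_kernel k).comp_homeomorph (Homeomorph.subLeft x)
  subset := by
    have : tsupport (fun t => kernel k (x - t)) ⊆ closedBall x (1 / (k + 1)) := by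
      refine closure_minimal (fun t ht => ?_) isClosed_closedBall
      by_contra hc
      rw [mem_closedBall, not_le, dist_comm, dist_eq_norm] at hc
      exact ht (kernel_eq_zero hc.le)
    exact this.trans hU

lemma partialD_kernel_sub (k : ℕ) (x : Plane) (i : Fin 2) (t : Plane) :
    partialD i (fun t => kernel k (x - t)) t =
      -fderiv ℝ (kernel k) (x - t) (EuclideanSpace.single i 1) := by
  have h : HasFDerivAt (fun t => kernel k (x - t))
      ((fderiv ℝ (kernel k) (x - t)).comp (-ContinuousLinearMap.id ℝ Plane)) t :=
    (((contDiff_kernel k).differentiable (by simp)) (x - t)).hasFDerivAt.comp t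
      ((hasFDerivAt_id t).const_sub x)
  rw [partialD, h.fderiv]
  simp

/-- The mollification of a function. -/
def mollify (k : ℕ) (f : Plane → ℝ) (x : Plane) : ℝ := ∫ t, f t * kernel k (x - t)

lemma mollify_eq_convolution (k : ℕ) (f : Plane → ℝ) :
    mollify k f = convolution f (kernel k) (ContinuousLinearMap.mul ℝ ℝ) volume := by
  ext x
  simp [mollify, convolution_def]

lemma mollify_eq (k : ℕ) (f : Plane → ℝ) (x : Plane) :
    mollify k f x = ∫ t, f (x - t) * kernel k t := by
  rw [mollify, ← integral_sub_left_eq_self _ volume x]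
  simp

lemma hasFDerivAt_mollify (k : ℕ) {f : Plane → ℝ} (hf : LocallyIntegrable f) (x : Plane) :
    ∃ D : Plane →L[ℝ] ℝ, HasFDerivAt (mollify k f) D x ∧
      ∀ v, D v = ∫ t, f t * fderiv ℝ (kernel k) (x - t) v := by
  have h := (hasCompactSupport_kernel k).hasFDerivAt_convolution_right
    (ContinuousLinearMap.mul ℝ ℝ) hf ((contDiff_kernel k).of_le (by exact_mod_cast le_top)) x
  rw [← mollify_eq_convolution] at h
  refine ⟨_, h, ?_⟩
  · intro v
    rw [convolution_precompR_apply _ hf ((hasCompactSupport_kernel k).fderiv ℝ)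
      ((contDiff_kernel k).continuous_fderiv (by simp))]
    simp [convolution_def]

lemma contDiff_mollify (k : ℕ) {f : Plane → ℝ} (hf : LocallyIntegrable f) :
    ContDiff ℝ ∞ (mollify k f) := by
  rw [mollify_eq_convolution]
  exact (hasCompactSupport_kernel k).contDiff_convolution_right _ hf (contDiff_kernel k)

lemma fderiv_mollify_single (k : ℕ) {f : Plane → ℝ} (hf : LocallyIntegrable f) (x : Plane)
    (i : Fin 2) : fderiv ℝ (mollify k f) x (EuclideanSpace.single i 1) =
      -∫ t, f t * partialD i (fun t => kernel k (x - t)) t := by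
  obtain ⟨D, hD, hDv⟩ := hasFDerivAt_mollify k hf x
  rw [hD.fderiv, hDv, ← integral_neg]
  simp only [partialD_kernel_sub, mul_neg, neg_neg]

lemma mollify_eq_const {k : ℕ} {f : Plane → ℝ} {x : Plane} {r c : ℝ} (hr : 1 / ((k : ℝ) + 1) ≤ r)
    (h : ∀ᵐ t, t ∈ ball x r → f t = c) : mollify k f x = c := by
  have : mollify k f x = ∫ t, c * kernel k (x - t) := by
    refine integral_congr_ae ?_
    filter_upwards [h] with t ht
    by_cases htb : t ∈ ball x r
    · simp only [ht htb]
    · rw [mem_ball, not_lt, dist_comm, dist_eq_norm] at htb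
      simp only [kernel_eq_zero (hr.trans htb), mul_zero]
  rw [this, integral_const_mul, integral_sub_left_eq_self (kernel k) volume x, integral_kernel,
    mul_one]

lemma abs_mollify_le (k : ℕ) {f : Plane → ℝ} {M : ℝ} (h : ∀ᵐ t, |f t| ≤ M) (x : Plane) :
    |mollify k f x| ≤ M := by
  have hi : Integrable fun t => M * kernel k (x - t) :=
    ((integrable_kernel k).comp_sub_left x).const_mul M
  have := norm_integral_le_of_norm_le (f := fun t => f t * kernel k (x - t)) hi (by
    filter_upwards [h] with t ht
    rw [Real.norm_eq_abs, abs_mul, abs_of_nonneg (kernel_nonneg k _)]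
    exact mul_le_mul_of_nonneg_right ht (kernel_nonneg k _))
  rw [integral_const_mul, integral_sub_left_eq_self (kernel k) volume x, integral_kernel,
    mul_one] at this
  exact this

/-! ### Mollification of Lipschitz functions -/

section Lipschitz

variable {W : Plane → ℝ} {C : NNReal}

lemma integrable_mul_kernel (hW : Continuous W) (k : ℕ) (x : Plane) :
    Integrable fun t => W (x - t) * kernel k t :=
  ((hW.comp (continuous_const.sub continuous_id)).mul
    (contDiff_kernel k).continuous).integrable_of_hasCompactSupport
      (hasCompactSupport_kernel k).mul_left

lemma mollify_sub_mollify (hW : Continuous W) (k : ℕ) (x y : Plane) :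
    mollify k W x - mollify k W y = ∫ t, (W (x - t) - W (y - t)) * kernel k t := by
  rw [mollify_eq, mollify_eq, ← integral_sub (integrable_mul_kernel hW k x)
    (integrable_mul_kernel hW k y)]
  simp only [sub_mul]

lemma lipschitzWith_mollify (hW : LipschitzWith C W) (k : ℕ) : LipschitzWith C (mollify k W) := by
  refine LipschitzWith.of_dist_le_mul fun x y => ?_
  rw [Real.dist_eq, mollify_sub_mollify hW.continuous]
  have := norm_integral_le_of_norm_le (f := fun t => (W (x - t) - W (y - t)) * kernel k t)
    ((integrable_kernel k).const_mul (C * dist x y)) (Eventually.of_forall fun t => by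
      rw [Real.norm_eq_abs, abs_mul, abs_of_nonneg (kernel_nonneg k _)]
      refine mul_le_mul_of_nonneg_right ?_ (kernel_nonneg k _)
      have := hW.dist_le_mul (x - t) (y - t)
      rwa [Real.dist_eq, dist_sub_right] at this)
  rw [integral_const_mul, integral_kernel, mul_one] at this
  exact this

lemma abs_mollify_sub_le (hW : LipschitzWith C W) (k : ℕ) (x : Plane) :
    |mollify k W x - W x| ≤ C * (1 / (k + 1)) := by
  have e : mollify k W x - W x = ∫ t, (W (x - t) - W x) * kernel k t := by
    simp only [sub_mul]
    rw [integral_sub (integrable_mul_kernel hW.continuous k x)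
      ((integrable_kernel k).const_mul _), integral_const_mul, integral_kernel, mollify_eq, mul_one]
  rw [e]
  have := norm_integral_le_of_norm_le (f := fun t => (W (x - t) - W x) * kernel k t)
    ((integrable_kernel k).const_mul (C * (1 / (k + 1)))) (Eventually.of_forall fun t => by
      rw [Real.norm_eq_abs, abs_mul, abs_of_nonneg (kernel_nonneg k _)]
      rcases le_total (1 / ((k : ℝ) + 1)) ‖t‖ with h | h
      · simp [kernel_eq_zero h]
      · refine mul_le_mul_of_nonneg_right ?_ (kernel_nonneg k _)
        have := hW.dist_le_mul (x - t) x
        rw [Real.dist_eq, dist_self_sub_left] at this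
        exact this.trans (mul_le_mul_of_nonneg_left h C.2))
  rw [integral_const_mul, integral_kernel, mul_one] at this
  exact this

/-- Within radius `δ` of `x`, an average at scale at most `δ` only sees the affine part of `W`.
Differences of the averages are integrals of a constant against the kernel, so only its mass matters
and not its symmetry. -/
lemma hasGradientAt_mollify (hW : Continuous W) {u x : Plane} {δ : ℝ} (hδ : 0 < δ)
    (h : ∀ y ∈ ball x (2 * δ), W y = W x + (u 0 * (y 0 - x 0) + u 1 * (y 1 - x 1))) {k : ℕ}
    (hk : 1 / ((k : ℝ) + 1) ≤ δ) : HasGradientAt (mollify k W) u x := by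
  have e : ∀ y ∈ ball x δ, mollify k W y = mollify k W x + inner ℝ u (y - x) := by
    intro y hy
    have : mollify k W y - mollify k W x = ∫ t, inner ℝ u (y - x) * kernel k t := by
      rw [mollify_sub_mollify hW]
      refine integral_congr_ae (Eventually.of_forall fun t => ?_)
      rcases le_total (1 / ((k : ℝ) + 1)) ‖t‖ with ht | ht
      · simp [kernel_eq_zero ht]
      · have hty : y - t ∈ ball x (2 * δ) := by
          rw [mem_ball, dist_eq_norm] at *
          have := norm_sub_le (y - x) t
          rw [show y - t - x = y - x - t by abel]
          linarith
        have htx : x - t ∈ ball x (2 * δ) := by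
          rw [mem_ball, dist_self_sub_left]
          linarith
        simp only [h _ hty, h _ htx, PiLp.sub_apply, PiLp.inner_apply, Fin.sum_univ_two,
          RCLike.inner_apply, conj_trivial]
        ring
    rw [integral_const_mul, integral_kernel, mul_one] at this
    linarith
  rw [hasGradientAt_iff_hasFDerivAt]
  have hd : HasFDerivAt (fun y => mollify k W x + inner ℝ u (y - x))
      (InnerProductSpace.toDual ℝ Plane u) x := by
    have := ((InnerProductSpace.toDual ℝ Plane u).hasFDerivAt (x := x)).sub_const
      (inner ℝ u x)
    simp only [InnerProductSpace.toDual_apply_apply, ← inner_sub_right] at this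
    exact this.const_add (mollify k W x)
  exact hd.congr_of_eventuallyEq (by
    filter_upwards [ball_mem_nhds x hδ] with y hy using e y hy)

end Lipschitz

/-! ### Potentials of irrotational fields -/

lemma tendsto_one_div_nat_succ : Tendsto (fun k : ℕ => 1 / ((k : ℝ) + 1)) atTop (𝓝 0) :=
  tendsto_one_div_add_atTop_nhds_zero_nat

/-- The one-form of a vector field. -/
def oneForm (f₀ f₁ : ℝ) : Plane →L[ℝ] ℝ :=
  f₀ • EuclideanSpace.proj (0 : Fin 2) + f₁ • EuclideanSpace.proj (1 : Fin 2)

lemma oneForm_apply (f₀ f₁ : ℝ) (v : Plane) : oneForm f₀ f₁ v = f₀ * v 0 + f₁ * v 1 := by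
  simp [oneForm]

lemma abs_coord_le (x : Plane) (i : Fin 2) : |x i| ≤ ‖x‖ := PiLp.norm_apply_le x i

lemma norm_oneForm_le {f₀ f₁ M : ℝ} (h₀ : |f₀| ≤ M) (h₁ : |f₁| ≤ M) : ‖oneForm f₀ f₁‖ ≤ 2 * M := by
  have hM : 0 ≤ M := (abs_nonneg _).trans h₀
  refine ContinuousLinearMap.opNorm_le_bound _ (by positivity) fun v => ?_
  rw [oneForm_apply, Real.norm_eq_abs]
  refine (abs_add_le _ _).trans ?_
  rw [abs_mul, abs_mul]
  have := mul_le_mul h₀ (abs_coord_le v 0) (abs_nonneg _) hM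
  have := mul_le_mul h₁ (abs_coord_le v 1) (abs_nonneg _) hM
  linarith

lemma linear_plane (L : Plane →L[ℝ] ℝ) (v : Plane) :
    L v = v 0 * L (EuclideanSpace.single 0 1) + v 1 * L (EuclideanSpace.single 1 1) := by
  have : v = v 0 • (EuclideanSpace.single 0 1 : Plane) + v 1 • EuclideanSpace.single 1 1 := by
    refine plane_ext ?_ ?_ <;> simp
  conv_lhs => rw [this]
  simp

lemma exists_const_of_hasFDerivAt {O : Set Plane} (hO : IsOpen O) (hOc : IsPreconnected O)
    {W : Plane → ℝ} {u₀ u₁ : ℝ} (h : ∀ z ∈ O, HasFDerivAt W (oneForm u₀ u₁) z) :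
    ∃ c, ∀ y ∈ O, W y = c + (u₀ * y 0 + u₁ * y 1) := by
  have hd : ∀ z ∈ O, HasFDerivAt (fun y => W y - oneForm u₀ u₁ y) (0 : Plane →L[ℝ] ℝ) z := by
    intro z hz
    have := (h z hz).sub (oneForm u₀ u₁).hasFDerivAt
    rwa [sub_self] at this
  obtain ⟨c, hc⟩ := hO.exists_is_const_of_fderiv_eq_zero hOc
    (fun z hz => (hd z hz).differentiableAt.differentiableWithinAt)
    (fun z hz => (hd z hz).fderiv)
  refine ⟨c, fun y hy => ?_⟩
  have := hc y hy
  rw [oneForm_apply] at this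
  linarith

/-- The mollified fields are smooth and irrotational, hence gradients by the Poincaré lemma on the
plane. Their potentials, normalized at the origin, are uniformly Lipschitz, and a pointwise limit is
`W`. Where `T` is locally a constant `u`, the potentials are eventually affine with gradient `u`,
and so is the limit. Nothing is needed about `W` where `T` varies. -/
lemma exists_lipschitz_potential {T : Plane → Plane} (hT : AEStronglyMeasurable T) {M : ℝ}
    (hM : ∀ᵐ x, ‖T x‖ ≤ M)
    (hrot : ∀ φ, IsTest univ φ → ∫ x, (T x 0 * partialD 1 φ x - T x 1 * partialD 0 φ x) = 0) :
    ∃ (W : Plane → ℝ) (C : NNReal), LipschitzWith C W ∧ ∀ (O : Set Plane) (u : Plane), IsOpen O →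
      IsPreconnected O → (∀ᵐ x, x ∈ O → T x = u) →
        ∃ c, ∀ y ∈ O, W y = c + (u 0 * y 0 + u 1 * y 1) := by
  have hTm : ∀ i, AEStronglyMeasurable fun x => T x i := fun i =>
    (EuclideanSpace.proj (𝕜 := ℝ) i).continuous.comp_aestronglyMeasurable hT
  have hTb : ∀ i, ∀ᵐ x, |T x i| ≤ M := fun i => by
    filter_upwards [hM] with x hx using (abs_coord_le _ i).trans hx
  have hTl : ∀ i, LocallyIntegrable fun x => T x i := fun i => by
    refine (locallyIntegrable_const M).mono (hTm i) ?_
    filter_upwards [hTb i] with x hx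
    exact hx.trans (le_abs_self M)
  -- The factor 2 is the one in `norm_oneForm_le`: each of the two components is bounded by `M`.
  set C : NNReal := 2 * M.toNNReal
  have hM0 : 0 ≤ M := by
    obtain ⟨x, hx⟩ := hM.exists
    exact (norm_nonneg _).trans hx
  set S : ℕ → Fin 2 → Plane → ℝ := fun k i => mollify k fun x => T x i
  have hS : ∀ k i, ContDiff ℝ ∞ (S k i) := fun k i => contDiff_mollify k (hTl i)
  have hSd : ∀ k i, Differentiable ℝ (S k i) := fun k i => (hS k i).differentiable (by simp)
  -- Testing with `kernel k (x - ·)` turns the weak irrotationality of `T` into the classical one of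
  -- its mollification at `x`.
  have hcross : ∀ k x, fderiv ℝ (S k 0) x (EuclideanSpace.single 1 1) =
      fderiv ℝ (S k 1) x (EuclideanSpace.single 0 1) := by
    intro k x
    have ht := isTest_kernel_sub k x (subset_univ _)
    have key := hrot _ ht
    have hi : ∀ i j, Integrable fun t => T t i * partialD j (fun t => kernel k (x - t)) t := by
      intro i j
      have := (hTl i).integrable_smul_left_of_hasCompactSupport
        (partialD_eq j ht.contDiff) (ht.compact.fderiv_apply (𝕜 := ℝ) _)
      simpa only [smul_eq_mul, mul_comm] using this
    rw [integral_sub (hi 0 1) (hi 1 0), sub_eq_zero] at key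
    rw [fderiv_mollify_single k (hTl 0), fderiv_mollify_single k (hTl 1), key]
  have hprim : ∀ k, ∃ f : Plane → ℝ, ∀ x, HasFDerivAt f (oneForm (S k 0 x) (S k 1 x)) x := by
    intro k
    have hform : ∀ x, HasFDerivAt (fun x => oneForm (S k 0 x) (S k 1 x))
        ((fderiv ℝ (S k 0) x).smulRight (EuclideanSpace.proj (0 : Fin 2) : Plane →L[ℝ] ℝ) +
          (fderiv ℝ (S k 1) x).smulRight (EuclideanSpace.proj (1 : Fin 2) : Plane →L[ℝ] ℝ)) x :=
      fun x => HasFDerivAt.add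
        ((hSd k 0 x).hasFDerivAt.smul_const (EuclideanSpace.proj (0 : Fin 2) : Plane →L[ℝ] ℝ))
        ((hSd k 1 x).hasFDerivAt.smul_const (EuclideanSpace.proj (1 : Fin 2) : Plane →L[ℝ] ℝ))
    have hdiff : DifferentiableOn ℝ (fun x => oneForm (S k 0 x) (S k 1 x)) univ :=
      fun x _ => (hform x).differentiableAt.differentiableWithinAt
    obtain ⟨f, hf⟩ := convex_univ.exists_forall_hasFDerivAt_of_fderiv_symmetric isOpen_univ
      hdiff (by
        intro x _ v w
        rw [(hform x).fderiv]
        simp only [add_apply, ContinuousLinearMap.smulRight_apply, smul_apply, smul_eq_mul,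
          PiLp.proj_apply]
        rw [linear_plane (fderiv ℝ (S k 0) x) v, linear_plane (fderiv ℝ (S k 1) x) v,
          linear_plane (fderiv ℝ (S k 0) x) w, linear_plane (fderiv ℝ (S k 1) x) w, hcross k x]
        ring)
    exact ⟨f, fun x => hf x (mem_univ x)⟩
  choose F₀ hF₀ using hprim
  set F : ℕ → Plane → ℝ := fun k x => F₀ k x - F₀ k 0
  have hF : ∀ k x, HasFDerivAt (F k) (oneForm (S k 0 x) (S k 1 x)) x := fun k x =>
    (hF₀ k x).sub_const _
  have hlip : ∀ k, LipschitzWith C (F k) := fun k => by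
    refine lipschitzWith_of_nnnorm_fderiv_le (fun x => (hF k x).differentiableAt) fun x => ?_
    rw [(hF k x).fderiv, ← NNReal.coe_le_coe, coe_nnnorm]
    have := norm_oneForm_le (abs_mollify_le k (hTb 0) x) (abs_mollify_le k (hTb 1) x)
    simpa [C, hM0] using this
  -- For fixed `x` the values stay in a compact interval. One nonprincipal ultrafilter gives a limit
  -- at all points at once, with no choice of subsequences.
  have hlim : ∀ x, ∃ l, Tendsto (fun k => F k x) (hyperfilter ℕ) (𝓝 l) := by
    intro x
    have hmem : ∀ k, F k x ∈ closedBall (0 : ℝ) (C * ‖x‖) := by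
      intro k
      have := (hlip k).dist_le_mul x 0
      simpa [F] using this
    obtain ⟨l, -, hl⟩ := (isCompact_closedBall (0 : ℝ) (C * ‖x‖)).ultrafilter_le_nhds
      ((hyperfilter ℕ).map fun k => F k x)
      (le_principal_iff.2 (Filter.mem_map.2 (Eventually.of_forall hmem)))
    exact ⟨l, hl⟩
  choose W hW using hlim
  refine ⟨W, C, LipschitzWith.of_dist_le_mul fun x y => ?_, fun O u hO hOc hu => ?_⟩
  · exact le_of_tendsto ((hW x).dist (hW y)) (Eventually.of_forall fun k => (hlip k).dist_le_mul x y)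
  · refine exists_const_of_hasFDerivAt hO hOc fun z hz => ?_
    obtain ⟨ε, hε, hεO⟩ := Metric.isOpen_iff.1 hO z hz
    -- For large `k` the mollified field equals `u` on this ball, so the increments of `F k` are
    -- eventually constant in `k`.
    have hloc : ∀ y ∈ ball z (ε / 2), W y = W z + (oneForm (u 0) (u 1) y - oneForm (u 0) (u 1) z) := by
      intro y hy
      have hev : ∀ᶠ k in (hyperfilter ℕ : Filter ℕ), F k y - F k z =
          oneForm (u 0) (u 1) y - oneForm (u 0) (u 1) z := by
        refine Nat.hyperfilter_le_atTop ?_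
        filter_upwards [tendsto_one_div_nat_succ.eventually (gt_mem_nhds (half_pos hε))] with k hk
        have hSk : ∀ i, ∀ x ∈ ball z (ε / 2), S k i x = u i := by
          intro i x hx
          refine mollify_eq_const hk.le ?_
          filter_upwards [hu] with t ht htb
          rw [ht (hεO _)]
          rw [mem_ball] at *
          have := dist_triangle t x z
          linarith
        obtain ⟨c, hc⟩ := exists_const_of_hasFDerivAt isOpen_ball
          (convex_ball z (ε / 2)).isPreconnected (W := F k) (u₀ := u 0) (u₁ := u 1)
          (fun x hx => by
            have := hF k x
            rwa [hSk 0 x hx, hSk 1 x hx] at this)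
        rw [hc y hy, hc z (mem_ball_self (half_pos hε)), oneForm_apply, oneForm_apply]
        ring
      have := tendsto_nhds_unique (((hW y).sub (hW z)).congr' hev) tendsto_const_nhds
      linarith
    have hd : HasFDerivAt (fun y => W z + (oneForm (u 0) (u 1) y - oneForm (u 0) (u 1) z))
        (oneForm (u 0) (u 1)) z :=
      ((oneForm (u 0) (u 1)).hasFDerivAt.sub_const _).const_add _
    exact hd.congr_of_eventuallyEq (by
      filter_upwards [ball_mem_nhds z (half_pos hε)] with y hy using hloc y hy)

end

section

/-! ### Convergence in `L²` -/

lemma tendsto_eLpNorm_of_bound {E : Type*} [NormedAddCommGroup E] {μ : Measure Plane}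
    [IsFiniteMeasure μ] {f : ℕ → Plane → E} {c : ℕ → ℝ} (hc : Tendsto c atTop (𝓝 0))
    (h : ∀ n, ∀ᵐ x ∂μ, ‖f n x‖ ≤ c n) : Tendsto (fun n => eLpNorm (f n) 2 μ) atTop (𝓝 0) := by
  have h1 : Tendsto (fun n => μ univ ^ (2 : ℝ≥0∞).toReal⁻¹ * ENNReal.ofReal (c n)) atTop
      (𝓝 0) := by
    have := ENNReal.Tendsto.const_mul (a := μ univ ^ (2 : ℝ≥0∞).toReal⁻¹)
      (ENNReal.tendsto_ofReal hc) (Or.inr (ENNReal.rpow_ne_top_of_nonneg (by simp)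
        (measure_ne_top μ univ)))
    simpa using this
  exact tendsto_of_tendsto_of_tendsto_of_le_of_le tendsto_const_nhds h1 (fun _ => zero_le)
    fun n => eLpNorm_le_of_ae_bound (h n)

lemma tendsto_eLpNorm_of_dominated {E : Type*} [NormedAddCommGroup E] {μ : Measure Plane}
    [IsFiniteMeasure μ] {f : ℕ → Plane → E} (hf : ∀ n, AEStronglyMeasurable (f n) μ) {M : ℝ}
    (hM : ∀ n, ∀ᵐ x ∂μ, ‖f n x‖ ≤ M) (h : ∀ᵐ x ∂μ, Tendsto (fun n => f n x) atTop (𝓝 0)) :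
    Tendsto (fun n => eLpNorm (f n) 2 μ) atTop (𝓝 0) := by
  have h2 : ∀ n, eLpNorm (f n) 2 μ = (∫⁻ x, ‖f n x‖ₑ ^ (2 : ℝ) ∂μ) ^ (1 / 2 : ℝ) := fun n => by
    rw [eLpNorm_eq_lintegral_rpow_enorm_toReal (by norm_num) (by norm_num)]
    simp
  have key : Tendsto (fun n => ∫⁻ x, ‖f n x‖ₑ ^ (2 : ℝ) ∂μ) atTop (𝓝 (∫⁻ _, 0 ∂μ)) := by
    refine tendsto_lintegral_of_dominated_convergence' (fun _ => ENNReal.ofReal M ^ (2 : ℝ))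
      (fun n => (hf n).enorm.pow_const _) (fun n => ?_) ?_ ?_
    · filter_upwards [hM n] with x hx
      refine ENNReal.rpow_le_rpow ?_ (by norm_num)
      rw [← ofReal_norm]
      exact ENNReal.ofReal_le_ofReal hx
    · rw [lintegral_const]
      exact ENNReal.mul_ne_top (by simp) (measure_ne_top μ univ)
    · filter_upwards [h] with x hx
      have := (ENNReal.continuous_rpow_const (y := 2)).tendsto _ |>.comp hx.enorm
      simpa [Function.comp_def] using this
  rw [lintegral_zero] at key
  have := (ENNReal.continuous_rpow_const (y := 1 / 2)).tendsto _ |>.comp key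
  simp only [h2]
  simpa [Function.comp_def] using this

/-! ### Lipschitz functions as elements of `H¹` -/

section Lipschitz

variable {Ω : Set Plane} {W : Plane → ℝ} {C : NNReal} {w : L2 Ω} {g : L2Vec Ω}

/-- Near almost every point of `Ω` the function `W` is affine with gradient `g`. -/
def LocallyAffineWith (Ω : Set Plane) (W : Plane → ℝ) (g : Plane → Plane) : Prop :=
  ∀ᵐ x ∂(volume.restrict Ω), ∃ δ > 0, ∀ y ∈ ball x (2 * δ),
    W y = W x + (g x 0 * (y 0 - x 0) + g x 1 * (y 1 - x 1))

lemma hasFDerivAt_of_locally_affine {u x : Plane} {δ : ℝ} (hδ : 0 < δ)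
    (h : ∀ y ∈ ball x δ, W y = W x + (u 0 * (y 0 - x 0) + u 1 * (y 1 - x 1))) :
    HasFDerivAt W (oneForm (u 0) (u 1)) x := by
  have hd : HasFDerivAt (fun y => W x + (oneForm (u 0) (u 1) y - oneForm (u 0) (u 1) x))
      (oneForm (u 0) (u 1)) x :=
    ((oneForm (u 0) (u 1)).hasFDerivAt.sub_const _).const_add _
  refine hd.congr_of_eventuallyEq ?_
  filter_upwards [ball_mem_nhds x hδ] with y hy
  rw [h y hy, oneForm_apply, oneForm_apply]
  ring

lemma IsTest.eq_zero_of_notMem {U : Set Plane} {φ : Plane → ℝ} (hφ : IsTest U φ) {x : Plane}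
    (hx : x ∉ U) : φ x = 0 :=
  image_eq_zero_of_notMem_tsupport fun h => hx (hφ.subset h)

lemma IsTest.partialD_eq_zero_of_notMem {U : Set Plane} {φ : Plane → ℝ} (hφ : IsTest U φ)
    {x : Plane} (hx : x ∉ U) (i : Fin 2) : partialD i φ x = 0 := by
  have : fderiv ℝ φ x = 0 := by
    have h : x ∉ tsupport (fderiv ℝ φ) := fun h => hx (hφ.subset (tsupport_fderiv_subset ℝ h))
    exact image_eq_zero_of_notMem_tsupport h
  rw [partialD, this]
  simp

lemma IsTest.mono {U V : Set Plane} {φ : Plane → ℝ} (hφ : IsTest U φ) (h : U ⊆ V) :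
    IsTest V φ := ⟨hφ.contDiff, hφ.compact, hφ.subset.trans h⟩

lemma hasWeakGrad_of_lipschitz (hW : LipschitzWith C W)
    (hg : LocallyAffineWith Ω W g)
    (hw : w =ᵐ[volume.restrict Ω] W) : HasWeakGrad Ω w g := by
  intro φ hφ i
  obtain ⟨D, hD⟩ := ContDiff.lipschitzWith_of_hasCompactSupport hφ.compact hφ.contDiff (by simp)
  have key := hW.integral_lineDeriv_mul_eq (μ := volume) hD hφ.compact (EuclideanSpace.single i 1)
  have hφd : ∀ x, lineDeriv ℝ φ x (-EuclideanSpace.single i 1) = -partialD i φ x := fun x => by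
    rw [((hφ.contDiff.differentiable (by simp)) x).lineDeriv_eq_fderiv, map_neg]
    rfl
  have h1 : ∫ x in Ω, lineDeriv ℝ W x (EuclideanSpace.single i 1) * φ x =
      ∫ x, lineDeriv ℝ W x (EuclideanSpace.single i 1) * φ x :=
    setIntegral_eq_integral_of_forall_compl_eq_zero fun x hx => by
      rw [hφ.eq_zero_of_notMem hx, mul_zero]
  have h2 : ∫ x in Ω, lineDeriv ℝ φ x (-EuclideanSpace.single i 1) * W x =
      ∫ x, lineDeriv ℝ φ x (-EuclideanSpace.single i 1) * W x :=
    setIntegral_eq_integral_of_forall_compl_eq_zero fun x hx => by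
      rw [hφd, hφ.partialD_eq_zero_of_notMem hx, neg_zero, zero_mul]
  rw [← h1, ← h2] at key
  have e1 : ∫ x in Ω, w x * partialD i φ x =
      -∫ x in Ω, lineDeriv ℝ φ x (-EuclideanSpace.single i 1) * W x := by
    rw [← integral_neg]
    refine integral_congr_ae ?_
    filter_upwards [hw] with x hx
    rw [hφd, hx]
    ring
  have e2 : ∫ x in Ω, g x i * φ x =
      ∫ x in Ω, lineDeriv ℝ W x (EuclideanSpace.single i 1) * φ x := by
    refine integral_congr_ae ?_
    filter_upwards [hg] with x hx
    obtain ⟨δ, hδ, h⟩ := hx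
    have := hasFDerivAt_of_locally_affine (show 0 < 2 * δ by positivity) h
    rw [this.hasLineDerivAt _ |>.lineDeriv, oneForm_apply]
    fin_cases i <;> simp
  rw [e1, e2, key]

/-- Mollifications at scale `1 / (k + 1)` approach `W` uniformly in the plane, with error at most `C
/ (k + 1)`. One sequence thus serves for `L²(Ω)` and for `L²(S)`. The gradients are bounded by `C`
and at almost every point eventually equal to `g`, so dominated convergence applies. -/
lemma hasTrace_of_lipschitz [IsFiniteMeasure (volume.restrict Ω)]
    (hW : LipschitzWith C W) (hg : LocallyAffineWith Ω W g) (hw : w =ᵐ[volume.restrict Ω] W)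
    {S : Set Plane} (hS : MeasurableSet S) (hSf : Measure.hausdorffMeasure 1 S < ⊤) {c : ℝ}
    (hc : ∀ x ∈ S, W x = c) : HasTrace Ω w S fun _ => c := by
  have hfin : IsFiniteMeasure ((Measure.hausdorffMeasure 1).restrict S : Measure Plane) :=
    ⟨by simpa using hSf⟩
  have hlim : Tendsto (fun k : ℕ => C * (1 / ((k : ℝ) + 1))) atTop (𝓝 0) := by
    simpa using tendsto_one_div_nat_succ.const_mul (C : ℝ)
  have hsm : ∀ k, ContDiff ℝ ∞ (mollify k W) := fun k =>
    contDiff_mollify k hW.continuous.locallyIntegrable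
  refine ⟨g, hasWeakGrad_of_lipschitz hW hg hw, fun k => mollify k W, hsm, ?_, ?_, ?_⟩
  · refine tendsto_eLpNorm_of_bound hlim fun k => ?_
    filter_upwards [hw] with x hx
    rw [hx]
    exact abs_mollify_sub_le hW k x
  · refine tendsto_eLpNorm_of_dominated (M := C + C)
      (fun k => (gradient_continuous (hsm k)).aestronglyMeasurable.sub
        (Lp.aestronglyMeasurable g)) (fun k => ?_) ?_
    · filter_upwards [hg] with x hx
      obtain ⟨δ, hδ, h⟩ := hx
      have h1 : ∀ k, ‖gradient (mollify k W) x‖ ≤ C := fun k => by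
        rw [gradient, LinearIsometryEquiv.norm_map]
        exact norm_fderiv_le_of_lipschitz ℝ (lipschitzWith_mollify hW k)
      -- The value `g x` is itself the gradient of a sufficiently fine mollification, so it inherits
      -- the bound.
      have h2 : ‖g x‖ ≤ C := by
        obtain ⟨k, hk⟩ := (tendsto_one_div_nat_succ.eventually (gt_mem_nhds hδ)).exists
        rw [← (hasGradientAt_mollify hW.continuous hδ h hk.le).gradient]
        exact h1 k
      exact (norm_sub_le _ _).trans (add_le_add (h1 k) h2)
    · filter_upwards [hg] with x hx
      obtain ⟨δ, hδ, h⟩ := hx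
      refine tendsto_const_nhds.congr' ?_
      filter_upwards [tendsto_one_div_nat_succ.eventually (gt_mem_nhds hδ)] with k hk
      rw [(hasGradientAt_mollify hW.continuous hδ h hk.le).gradient, sub_self]
  · refine tendsto_eLpNorm_of_bound hlim fun k => ?_
    filter_upwards [ae_restrict_mem hS] with x hx
    rw [← hc x hx]
    exact abs_mollify_sub_le hW k x

end Lipschitz

/-! ### Uniqueness of weak derivatives -/

section Weak

variable {Ω : Set Plane}

lemma setIntegral_mul_isTest {O : Set Plane} (hOΩ : O ⊆ Ω) {φ : Plane → ℝ} (hφ : IsTest O φ)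
    (f : Plane → ℝ) : ∫ x in Ω, f x * φ x = ∫ x, f x * φ x :=
  setIntegral_eq_integral_of_forall_compl_eq_zero fun x hx => by
    rw [hφ.eq_zero_of_notMem fun h => hx (hOΩ h), mul_zero]

lemma setIntegral_mul_partialD_isTest {O : Set Plane} (hOΩ : O ⊆ Ω) {φ : Plane → ℝ}
    (hφ : IsTest O φ) (f : Plane → ℝ) (i : Fin 2) :
    ∫ x in Ω, f x * partialD i φ x = ∫ x, f x * partialD i φ x :=
  setIntegral_eq_integral_of_forall_compl_eq_zero fun x hx => by
    rw [hφ.partialD_eq_zero_of_notMem fun h => hx (hOΩ h), mul_zero]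

/-- A weak gradient is irrotational. -/
lemma HasWeakGrad.hasWeakRot {w : L2 Ω} {g : L2Vec Ω} (h : HasWeakGrad Ω w g) :
    HasWeakRot Ω g 0 := by
  intro φ hφ
  have hsm : ∀ i, ContDiff ℝ ∞ (partialD i φ) := fun i =>
    (hφ.contDiff.fderiv_right (m := ∞) (by simp)).clm_apply contDiff_const
  have ht : ∀ i, IsTest Ω (partialD i φ) := fun i =>
    ⟨hsm i, hφ.compact.fderiv_apply (𝕜 := ℝ) _, (closure_minimal (fun x hx => by
      by_contra hc
      exact hx (by
        have h1 : x ∉ tsupport (fderiv ℝ φ) := fun h1 => hc (tsupport_fderiv_subset ℝ h1)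
        have h2 : fderiv ℝ φ x = 0 := image_eq_zero_of_notMem_tsupport h1
        rw [partialD, h2]
        simp)) isClosed_closure).trans hφ.subset⟩
  have hcomm : ∀ x, partialD 0 (partialD 1 φ) x = partialD 1 (partialD 0 φ) x := by
    intro x
    have hd : DifferentiableAt ℝ (fderiv ℝ φ) x :=
      ((hφ.contDiff.fderiv_right (m := ∞) (by simp)).differentiable (by simp)) x
    have hsymm : IsSymmSndFDerivAt ℝ φ x := hφ.contDiff.contDiffAt.isSymmSndFDerivAt (by
      rw [minSmoothness_of_isRCLikeNormedField]
      exact WithTop.coe_le_coe.2 (le_top (a := (2 : ℕ∞))))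
    have e : ∀ i j, partialD i (partialD j φ) x =
        fderiv ℝ (fderiv ℝ φ) x (EuclideanSpace.single i 1) (EuclideanSpace.single j 1) := by
      intro i j
      have := (hd.hasFDerivAt.clm_apply
        (hasFDerivAt_const (EuclideanSpace.single j 1 : Plane) x)).fderiv
      rw [partialD]
      unfold partialD
      rw [this]
      simp
    rw [e, e]
    exact hsymm _ _
  -- The weak gradient is tested with `∂₁φ` and `∂₀φ`; the two contributions agree by the symmetry
  -- of second derivatives.
  have h0 := h _ (ht 1) 0
  have h1 := h _ (ht 0) 1
  have hz : ∫ x in Ω, (0 : L2 Ω) x * φ x = 0 := by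
    refine integral_eq_zero_of_ae ?_
    filter_upwards [Lp.coeFn_zero ℝ 2 (volume.restrict Ω)] with x hx
    rw [hx]
    simp
  rw [hz, integral_sub (integrable_mul_of_memLp (memLp_coord g 0) (hφ.memLp_partialD 1))
    (integrable_mul_of_memLp (memLp_coord g 1) (hφ.memLp_partialD 0))]
  simp only [hcomm] at h0
  linarith

variable [IsFiniteMeasure (volume.restrict Ω)]

lemma ae_eq_zero_of_forall_isTest {O : Set Plane} (hO : IsOpen O) {f : Plane → ℝ}
    (hf : MemLp f 2 (volume.restrict Ω)) (h : ∀ φ, IsTest O φ → ∫ x in Ω, f x * φ x = 0) :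
    ∀ᵐ x ∂(volume.restrict Ω), x ∈ O → f x = 0 := by
  refine hO.ae_eq_zero_of_integral_contDiff_smul_eq_zero
    ((hf.integrable (by norm_num)).locallyIntegrable.locallyIntegrableOn _) fun φ h1 h2 h3 => ?_
  rw [← h φ ⟨h1, h2, h3⟩]
  simp only [smul_eq_mul, mul_comm]

lemma integral_mul_partialD {f φ : Plane → ℝ} (hf : ContDiff ℝ ∞ f) {U : Set Plane}
    (hφ : IsTest U φ) (i : Fin 2) :
    ∫ x, f x * partialD i φ x = -∫ x, partialD i f x * φ x := by
  have hfc := hf.continuous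
  have hφc := hφ.contDiff.continuous
  have hfd := partialD_eq i hf
  have hφd := partialD_eq i hφ.contDiff
  have hcd : HasCompactSupport (partialD i φ) := hφ.compact.fderiv_apply (𝕜 := ℝ) _
  exact integral_mul_fderiv_eq_neg_fderiv_mul_of_integrable
    ((hfd.mul hφc).integrable_of_hasCompactSupport hφ.compact.mul_left)
    ((hfc.mul hφd).integrable_of_hasCompactSupport hcd.mul_left)
    ((hfc.mul hφc).integrable_of_hasCompactSupport hφ.compact.mul_left)
    (fun x _ => hf.differentiable (by simp) x)
    (fun x _ => hφ.contDiff.differentiable (by simp) x)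

lemma partialD_affine (a b₀ b₁ : ℝ) (i : Fin 2) (x : Plane) :
    partialD i (fun x => a + (b₀ * x 0 + b₁ * x 1)) x = if i = 0 then b₀ else b₁ := by
  have : (fun x : Plane => a + (b₀ * x 0 + b₁ * x 1)) = fun x => a + oneForm b₀ b₁ x := by
    ext x; rw [oneForm_apply]
  rw [partialD, this, ((oneForm b₀ b₁).hasFDerivAt.const_add a).fderiv, oneForm_apply]
  fin_cases i <;> simp

lemma contDiff_affine (a b₀ b₁ : ℝ) :
    ContDiff ℝ ∞ fun x : Plane => a + (b₀ * x 0 + b₁ * x 1) := by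
  have : (fun x : Plane => a + (b₀ * x 0 + b₁ * x 1)) = fun x => a + oneForm b₀ b₁ x := by
    ext x; rw [oneForm_apply]
  rw [this]
  exact contDiff_const.add (oneForm b₀ b₁).contDiff

lemma integral_affine_mul_partialD (a b₀ b₁ : ℝ) {φ : Plane → ℝ} {U : Set Plane}
    (hφ : IsTest U φ) (i : Fin 2) :
    ∫ x, (a + (b₀ * x 0 + b₁ * x 1)) * partialD i φ x =
      -((if i = 0 then b₀ else b₁) * ∫ x, φ x) := by
  rw [integral_mul_partialD (contDiff_affine a b₀ b₁) hφ]
  simp only [partialD_affine]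
  rw [integral_const_mul]

/-- Weak derivatives are local: a test function supported in `O` sees only the affine expression,
and integration by parts leaves `b`. -/
lemma HasWeakGrad.ae_eq_of_affine {O : Set Plane} (hO : IsOpen O) (hOΩ : O ⊆ Ω) {w : L2 Ω}
    {g : L2Vec Ω} (h : HasWeakGrad Ω w g) {a : ℝ} {b : Plane}
    (hw : ∀ᵐ x ∂(volume.restrict Ω), x ∈ O → w x = a + (b 0 * x 0 + b 1 * x 1)) :
    ∀ᵐ x ∂(volume.restrict Ω), x ∈ O → g x = b := by
  have key : ∀ i, ∀ᵐ x ∂(volume.restrict Ω), x ∈ O → g x i - b i = 0 := by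
    intro i
    refine ae_eq_zero_of_forall_isTest hO ((memLp_coord g i).sub (memLp_const _)) fun φ hφ => ?_
    have h1 := h φ (hφ.mono hOΩ) i
    have h2 : ∫ x in Ω, w x * partialD i φ x =
        ∫ x in Ω, (a + (b 0 * x 0 + b 1 * x 1)) * partialD i φ x := by
      refine integral_congr_ae ?_
      filter_upwards [hw] with x hx
      by_cases hxO : x ∈ O
      · rw [hx hxO]
      · rw [hφ.partialD_eq_zero_of_notMem hxO, mul_zero, mul_zero]
    rw [h2, setIntegral_mul_partialD_isTest hOΩ hφ, integral_affine_mul_partialD _ _ _ hφ] at h1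
    have h3 : (if i = 0 then b 0 else b 1) = b i := by fin_cases i <;> simp
    rw [h3] at h1
    simp only [sub_mul]
    rw [integral_sub (integrable_mul_of_memLp (memLp_coord g i) hφ.memLp)
      (integrable_mul_of_memLp (memLp_const _) hφ.memLp), integral_const_mul]
    have h4 := setIntegral_mul_isTest hOΩ hφ (fun _ => 1)
    simp only [one_mul] at h4
    rw [h4]
    linarith
  filter_upwards [key 0, key 1] with x h0 h1 hx
  exact plane_ext (by linarith [h0 hx]) (by linarith [h1 hx])

lemma HasWeakGrad.unique (hΩ : IsOpen Ω) {w : L2 Ω} {g g' : L2Vec Ω} (h : HasWeakGrad Ω w g)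
    (h' : HasWeakGrad Ω w g') : g = g' := by
  have key : ∀ i, ∀ᵐ x ∂(volume.restrict Ω), x ∈ Ω → g x i - g' x i = 0 := by
    intro i
    refine ae_eq_zero_of_forall_isTest hΩ ((memLp_coord g i).sub (memLp_coord g' i)) fun φ hφ => ?_
    have h1 := h φ hφ i
    rw [h' φ hφ i] at h1
    simp only [sub_mul]
    rw [integral_sub (integrable_mul_of_memLp (memLp_coord g i) hφ.memLp)
      (integrable_mul_of_memLp (memLp_coord g' i) hφ.memLp)]
    linarith
  refine Lp.ext ?_
  filter_upwards [key 0, key 1, ae_restrict_mem hΩ.measurableSet] with x h0 h1 hx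
  exact plane_ext (by linarith [h0 hx]) (by linarith [h1 hx])

lemma HasWeakRot.unique (hΩ : IsOpen Ω) {τ : L2Vec Ω} {r r' : L2 Ω} (h : HasWeakRot Ω τ r)
    (h' : HasWeakRot Ω τ r') : r = r' := by
  have key : ∀ᵐ x ∂(volume.restrict Ω), x ∈ Ω → r x - r' x = 0 := by
    refine ae_eq_zero_of_forall_isTest hΩ ((Lp.memLp r).sub (Lp.memLp r')) fun φ hφ => ?_
    have h1 := h φ hφ
    rw [h' φ hφ] at h1
    simp only [sub_mul]
    rw [integral_sub (integrable_mul_of_memLp (Lp.memLp r) hφ.memLp)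
      (integrable_mul_of_memLp (Lp.memLp r') hφ.memLp)]
    linarith
  refine Lp.ext ?_
  filter_upwards [key, ae_restrict_mem hΩ.measurableSet] with x h0 hx
  linarith [h0 hx]

/-- The classical rotation of `u + v x^⊥` is `2 v`, and test functions supported in `O` transfer it
to the weak rotation. -/
lemma HasWeakRot.ae_eq_of_affine {O : Set Plane} (hO : IsOpen O) (hOΩ : O ⊆ Ω) {τ : L2Vec Ω}
    {r : L2 Ω} (h : HasWeakRot Ω τ r) {u : Plane} {v : ℝ}
    (hτ : ∀ᵐ x ∂(volume.restrict Ω), x ∈ O → τ x = u + v • (!₂[-x 1, x 0] : Plane)) :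
    ∀ᵐ x ∂(volume.restrict Ω), x ∈ O → r x = 2 * v := by
  have key : ∀ᵐ x ∂(volume.restrict Ω), x ∈ O → r x - 2 * v = 0 := by
    refine ae_eq_zero_of_forall_isTest hO ((Lp.memLp r).sub (memLp_const _)) fun φ hφ => ?_
    have h1 := h φ (hφ.mono hOΩ)
    rw [integral_sub (integrable_mul_of_memLp (memLp_coord τ 0) (hφ.memLp_partialD 1))
      (integrable_mul_of_memLp (memLp_coord τ 1) (hφ.memLp_partialD 0))] at h1
    have h2 : ∫ x in Ω, τ x 0 * partialD 1 φ x =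
        ∫ x in Ω, (u 0 + (0 * x 0 + (-v) * x 1)) * partialD 1 φ x := by
      refine integral_congr_ae ?_
      filter_upwards [hτ] with x hx
      by_cases hxO : x ∈ O
      · rw [hx hxO]
        simp
      · rw [hφ.partialD_eq_zero_of_notMem hxO, mul_zero, mul_zero]
    have h3 : ∫ x in Ω, τ x 1 * partialD 0 φ x =
        ∫ x in Ω, (u 1 + (v * x 0 + 0 * x 1)) * partialD 0 φ x := by
      refine integral_congr_ae ?_
      filter_upwards [hτ] with x hx
      by_cases hxO : x ∈ O
      · rw [hx hxO]
        simp
      · rw [hφ.partialD_eq_zero_of_notMem hxO, mul_zero, mul_zero]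
    rw [h2, h3, setIntegral_mul_partialD_isTest hOΩ hφ, setIntegral_mul_partialD_isTest hOΩ hφ,
      integral_affine_mul_partialD _ _ _ hφ, integral_affine_mul_partialD _ _ _ hφ] at h1
    simp only [one_ne_zero, if_false, if_true] at h1
    simp only [sub_mul]
    rw [integral_sub (integrable_mul_of_memLp (Lp.memLp r) hφ.memLp)
      (integrable_mul_of_memLp (memLp_const _) hφ.memLp), integral_const_mul]
    have h4 := setIntegral_mul_isTest hOΩ hφ (fun _ => 1)
    simp only [one_mul] at h4
    rw [h4]
    linarith
  filter_upwards [key] with x h0 hx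
  linarith [h0 hx]

/-- The mollification of a function with vanishing weak gradient is locally constant. -/
lemma HasWeakGrad.mollify_eq (hΩ : MeasurableSet Ω) {w : L2 Ω} (h : HasWeakGrad Ω w 0)
    {x : Plane} {δ : ℝ} (hx : ball x (2 * δ) ⊆ Ω) {k : ℕ} (hk : 1 / ((k : ℝ) + 1) < δ)
    {y z : Plane} (hy : y ∈ ball x δ) (hz : z ∈ ball x δ) :
    mollify k (Ω.indicator w) y = mollify k (Ω.indicator w) z := by
  have hint : Integrable (Ω.indicator w) :=
    (integrable_indicator_iff hΩ).2 ((Lp.memLp w).integrable (by norm_num))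
  have hd : ∀ y ∈ ball x δ, fderiv ℝ (mollify k (Ω.indicator w)) y = 0 := by
    intro y hy
    have hb : closedBall y (1 / ((k : ℝ) + 1)) ⊆ Ω := by
      refine Subset.trans (fun t ht => ?_) hx
      rw [mem_ball] at *
      rw [mem_closedBall] at ht
      have := dist_triangle t y x
      linarith
    have hi : ∀ i, fderiv ℝ (mollify k (Ω.indicator w)) y (EuclideanSpace.single i 1) = 0 := by
      intro i
      have ht := isTest_kernel_sub k y hb
      have h1 := h _ ht i
      have h2 : ∫ t in Ω, (0 : L2Vec Ω) t i * kernel k (y - t) = 0 := by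
        refine integral_eq_zero_of_ae ?_
        filter_upwards [Lp.coeFn_zero Plane 2 (volume.restrict Ω)] with x hx
        rw [hx]
        simp
      rw [h2, neg_zero, ← integral_indicator hΩ] at h1
      rw [fderiv_mollify_single k hint.locallyIntegrable, neg_eq_zero, ← h1]
      congr 1
      ext t
      by_cases htΩ : t ∈ Ω
      · rw [indicator_of_mem htΩ, indicator_of_mem htΩ]
      · rw [indicator_of_notMem htΩ, indicator_of_notMem htΩ, zero_mul]
    ext v
    rw [linear_plane, hi 0, hi 1]
    simp
  exact isOpen_ball.is_const_of_fderiv_eq_zero (convex_ball x δ).isPreconnected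
    (contDiff_mollify k hint.locallyIntegrable |>.differentiable (by simp)).differentiableOn
    (fun t ht => hd t ht) hy hz

end Weak

end

section

/-! ### Geometry of triangulations -/

namespace Triangulation

section general

variable {Ω : Set Plane} (T : Triangulation Ω) {K L : Finset Plane}

lemma exists_third_vertex (hK : K ∈ T.cells) {a b : Plane} (ha : a ∈ K) (hb : b ∈ K) (hab : a ≠ b) :
    ∃ p, p ≠ a ∧ p ≠ b ∧ K = {p, a, b} ∧ cross (a - p) (b - p) ≠ 0 := by
  obtain ⟨p, hp, hpa, hpb⟩ : ∃ p ∈ K, p ≠ a ∧ p ≠ b := by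
    by_contra! h
    have : K ⊆ {a, b} := fun p hp => by
      by_cases hpa : p = a
      · simp [hpa]
      · simp [h p hp hpa]
    have h2 := Finset.card_le_card this
    rw [T.card_eq K hK, Finset.card_pair hab] at h2
    omega
  have e : ({p, a, b} : Finset Plane) = K := by
    refine Finset.eq_of_subset_of_card_le ?_ ?_
    · intro x hx
      simp only [Finset.mem_insert, Finset.mem_singleton] at hx
      rcases hx with rfl | rfl | rfl <;> assumption
    · rw [T.card_eq K hK, Finset.card_eq_three.2 ⟨p, a, b, hpa, hpb, hab, rfl⟩]
  refine ⟨p, hpa, hpb, e.symm, cross_ne_zero_of_affineIndependent hpa hpb hab ?_⟩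
  have := T.affineIndependent K hK
  rw [← e] at this
  have h2 : (({p, a, b} : Finset Plane) : Set Plane) = {p, a, b} := by simp
  rw [← h2]
  exact this

lemma exists_vertices (hK : K ∈ T.cells) :
    ∃ p a b, p ≠ a ∧ p ≠ b ∧ a ≠ b ∧ K = {p, a, b} ∧ cross (a - p) (b - p) ≠ 0 := by
  obtain ⟨p, a, b, hpa, hpb, hab, rfl⟩ := Finset.card_eq_three.1 (T.card_eq K hK)
  obtain ⟨q, hqa, hqb, e, h⟩ := T.exists_third_vertex hK (a := a) (b := b) (by simp) (by simp) hab
  exact ⟨q, a, b, hqa, hqb, hab, e, h⟩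

lemma isClosed_cell (K : Finset Plane) : IsClosed (convexHull ℝ (K : Set Plane)) :=
  K.finite_toSet.isClosed_convexHull ℝ

lemma isCompact_cell (K : Finset Plane) : IsCompact (convexHull ℝ (K : Set Plane)) :=
  K.finite_toSet.isCompact_convexHull ℝ

lemma coe_triangle (p a b : Plane) : (({p, a, b} : Finset Plane) : Set Plane) = {p, a, b} := by
  simp

lemma volume_cell_pos (hK : K ∈ T.cells) : 0 < (volume (convexHull ℝ (K : Set Plane))).toReal := by
  obtain ⟨p, a, b, -, -, -, rfl, h⟩ := T.exists_vertices hK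
  have := volume_triangle h
  rw [coe_triangle]
  have := abs_pos.2 h
  linarith

lemma volume_frontier_cell (K : Finset Plane) :
    volume (frontier (convexHull ℝ (K : Set Plane))) = 0 :=
  (convex_convexHull ℝ _).addHaar_frontier volume

lemma interior_cell_nonempty (hK : K ∈ T.cells) :
    (interior (convexHull ℝ (K : Set Plane))).Nonempty := by
  by_contra h
  rw [not_nonempty_iff_eq_empty] at h
  have h1 := volume_frontier_cell K
  rw [frontier, h, sdiff_empty, (isClosed_cell K).closure_eq] at h1
  have := T.volume_cell_pos hK
  simp [h1] at this

lemma closure_interior_cell (hK : K ∈ T.cells) :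
    closure (interior (convexHull ℝ (K : Set Plane))) = convexHull ℝ (K : Set Plane) := by
  rw [(convex_convexHull ℝ _).closure_interior_eq_closure_of_nonempty_interior
    (T.interior_cell_nonempty hK), (isClosed_cell K).closure_eq]

lemma cell_subset_closure (hK : K ∈ T.cells) : convexHull ℝ (K : Set Plane) ⊆ closure Ω := by
  rw [T.cover]
  exact subset_biUnion_of_mem (u := fun K : Finset Plane => convexHull ℝ (K : Set Plane)) hK

lemma ae_mem_interior_of_mem_cell (K : Finset Plane) :
    ∀ᵐ x, x ∈ convexHull ℝ (K : Set Plane) → x ∈ interior (convexHull ℝ (K : Set Plane)) := by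
  filter_upwards [measure_eq_zero_iff_ae_notMem.1 (volume_frontier_cell K)] with x hx h
  by_contra hi
  exact hx ⟨subset_closure h, hi⟩

lemma card_inter_le (hK : K ∈ T.cells) (hL : L ∈ T.cells) (hKL : K ≠ L) : (K ∩ L).card ≤ 2 := by
  by_contra! h
  have h1 : K ∩ L = K := Finset.eq_of_subset_of_card_le Finset.inter_subset_left (by
    rw [T.card_eq K hK]; omega)
  have h2 : K ∩ L = L := Finset.eq_of_subset_of_card_le Finset.inter_subset_right (by
    rw [T.card_eq L hL]; omega)
  exact hKL (h1.symm.trans h2)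

lemma cell_inter (hK : K ∈ T.cells) (hL : L ∈ T.cells) :
    convexHull ℝ (K : Set Plane) ∩ convexHull ℝ (L : Set Plane) =
      convexHull ℝ ((K ∩ L : Finset Plane) : Set Plane) := by
  rw [T.conforming K hK L hL, Finset.coe_inter]

lemma volume_convexHull_of_card_le_two {s : Finset Plane} (hs : s.card ≤ 2) :
    volume (convexHull ℝ (s : Set Plane)) = 0 := by
  obtain ⟨a, b, h⟩ : ∃ a b : Plane, s ⊆ {a, b} := by
    rcases (by omega : s.card = 0 ∨ s.card = 1 ∨ s.card = 2) with h | h | h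
    · exact ⟨0, 0, by simp [Finset.card_eq_zero.1 h]⟩
    · obtain ⟨a, rfl⟩ := Finset.card_eq_one.1 h
      exact ⟨a, a, by simp⟩
    · obtain ⟨a, b, -, rfl⟩ := Finset.card_eq_two.1 h
      exact ⟨a, b, subset_rfl⟩
  refine measure_mono_null (convexHull_mono (Finset.coe_subset.2 h)) ?_
  rw [Finset.coe_pair, convexHull_pair]
  exact IsPolygonInterior.volume_segment a b

/-- By conformity the intersection is the convex hull of at most two points. -/
lemma volume_cell_inter (hK : K ∈ T.cells) (hL : L ∈ T.cells) (hKL : K ≠ L) :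
    volume (convexHull ℝ (K : Set Plane) ∩ convexHull ℝ (L : Set Plane)) = 0 := by
  rw [T.cell_inter hK hL]
  exact volume_convexHull_of_card_le_two (T.card_inter_le hK hL hKL)

/-- A connected set covered by the cells that meets all of them connects them. -/
lemma exists_adjacent_of_isPreconnected {O : Set Plane} (hO : IsPreconnected O)
    (hOΩ : O ⊆ closure Ω)
    (hmeet : ∀ K ∈ T.cells, (convexHull ℝ (K : Set Plane) ∩ O).Nonempty) {p : Finset Plane → Prop}
    (hK : K ∈ T.cells) (hpK : p K) (hL : L ∈ T.cells) (hpL : ¬p L) :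
    ∃ K ∈ T.cells, ∃ L ∈ T.cells, p K ∧ ¬p L ∧
      (convexHull ℝ (K : Set Plane) ∩ convexHull ℝ (L : Set Plane) ∩ O).Nonempty := by
  classical
  -- The cells with the property and those without it form two closed sets that cover the connected
  -- set `O` and both meet it, so they have a common point in `O`.
  set A : Set Plane := ⋃ K ∈ T.cells.filter p, convexHull ℝ (K : Set Plane)
  set B : Set Plane := ⋃ K ∈ T.cells.filter fun K => ¬p K, convexHull ℝ (K : Set Plane)
  have hA : IsClosed A := isClosed_biUnion_finset fun K _ => isClosed_cell K
  have hB : IsClosed B := isClosed_biUnion_finset fun K _ => isClosed_cell K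
  have hAB : O ⊆ A ∪ B := by
    intro x hx
    have := hOΩ hx
    rw [T.cover] at this
    simp only [mem_iUnion] at this
    obtain ⟨M, hM, hxM⟩ := this
    by_cases h : p M
    · exact Or.inl (mem_biUnion (Finset.mem_filter.2 ⟨hM, h⟩) hxM)
    · exact Or.inr (mem_biUnion (Finset.mem_filter.2 ⟨hM, h⟩) hxM)
  obtain ⟨x, hx, hxK⟩ := hmeet K hK
  obtain ⟨y, hy, hyL⟩ := hmeet L hL
  obtain ⟨z, hzO, hzA, hzB⟩ := isPreconnected_closed_iff.1 hO A B hA hB hAB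
    ⟨x, hxK, mem_biUnion (Finset.mem_filter.2 ⟨hK, hpK⟩) hx⟩
    ⟨y, hyL, mem_biUnion (Finset.mem_filter.2 ⟨hL, hpL⟩) hy⟩
  simp only [A, B, mem_iUnion, Finset.mem_filter] at hzA hzB
  obtain ⟨M, ⟨hM, hpM⟩, hzM⟩ := hzA
  obtain ⟨N, ⟨hN, hpN⟩, hzN⟩ := hzB
  exact ⟨M, hM, N, hN, hpM, hpN, z, ⟨hzM, hzN⟩, hzO⟩

/-- Edges with a common relatively interior point coincide. -/
lemma pair_eq_of_mem_openSegment (hK : K ∈ T.cells) (hL : L ∈ T.cells) {a b a' b' z : Plane}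
    (ha : a ∈ K) (hb : b ∈ K) (hab : a ≠ b) (ha' : a' ∈ L) (hb' : b' ∈ L)
    (hz : z ∈ openSegment ℝ a b) (hz' : z ∈ segment ℝ a' b') :
    a ∈ ({a', b'} : Set Plane) ∧ b ∈ ({a', b'} : Set Plane) := by
  -- Inside one triangle, affine independence makes convex hulls of vertex sets intersect like the
  -- vertex sets. A relatively interior point of `a b` is thus in the hull of `s` only if `s`
  -- contains both ends. This is applied in `K` to the common vertices `K ∩ L`, then in `L` to the
  -- pair `a'`, `b'`.
  have sub : ∀ M ∈ T.cells, a ∈ M → b ∈ M → ∀ s : Finset Plane, s ⊆ M →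
      z ∈ convexHull ℝ (s : Set Plane) → a ∈ s ∧ b ∈ s := by
    intro M hM haM hbM s hs hzs
    have hzab : z ∈ convexHull ℝ (({a, b} : Finset Plane) : Set Plane) := by
      rw [Finset.coe_pair, convexHull_pair]
      exact openSegment_subset_segment ℝ a b hz
    have h1 : z ∈ convexHull ℝ (({a, b} ∩ s : Finset Plane) : Set Plane) := by
      have hu : AffineIndependent ℝ ((↑) : (({a, b} ∪ s : Finset Plane) : Finset Plane) → Plane) :=
        (T.affineIndependent M hM).mono (by
          refine Finset.coe_subset.2 (Finset.union_subset (fun x hx => ?_) hs)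
          simp only [Finset.mem_insert, Finset.mem_singleton] at hx
          rcases hx with rfl | rfl <;> assumption)
      rw [Finset.coe_inter, hu.convexHull_inter']
      exact ⟨hzab, hzs⟩
    have hne : ∀ c d : Plane, c ≠ d → z ∈ openSegment ℝ c d → z ≠ c := by
      rintro c d hcd ⟨s, t, hs, ht, hst, rfl⟩ e
      have h2 : t • (d - c) = 0 := by
        have : s = 1 - t := by linarith
        subst this
        rw [← sub_eq_zero] at e
        rw [← e]
        module
      rcases smul_eq_zero.1 h2 with h | h
      · exact ht.ne' h
      · exact hcd (sub_eq_zero.1 h).symm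
    have hza := hne a b hab hz
    have hzb := hne b a hab.symm (by rwa [openSegment_symm])
    constructor
    · by_contra h
      have : z ∈ convexHull ℝ ({b} : Set Plane) := convexHull_mono (by
        intro x hx
        simp only [Finset.coe_inter, Finset.coe_pair, mem_inter_iff, mem_insert_iff,
          mem_singleton_iff, Finset.mem_coe] at hx
        rcases hx with ⟨rfl | rfl, h2⟩
        · exact absurd h2 h
        · rfl) h1
      rw [convexHull_singleton] at this
      exact hzb this
    · by_contra h
      have : z ∈ convexHull ℝ ({a} : Set Plane) := convexHull_mono (by
        intro x hx
        simp only [Finset.coe_inter, Finset.coe_pair, mem_inter_iff, mem_insert_iff,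
          mem_singleton_iff, Finset.mem_coe] at hx
        rcases hx with ⟨rfl | rfl, h2⟩
        · rfl
        · exact absurd h2 h) h1
      rw [convexHull_singleton] at this
      exact hza this
  have hzK : z ∈ convexHull ℝ (K : Set Plane) := by
    refine convexHull_mono (s := {a, b}) ?_ ?_
    · rintro x (rfl | rfl) <;> assumption
    · rw [convexHull_pair]
      exact openSegment_subset_segment ℝ a b hz
  have hzL : z ∈ convexHull ℝ (({a', b'} : Finset Plane) : Set Plane) := by
    rwa [Finset.coe_pair, convexHull_pair]
  have hsubL : ({a', b'} : Finset Plane) ⊆ L := by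
    intro x hx
    simp only [Finset.mem_insert, Finset.mem_singleton] at hx
    rcases hx with rfl | rfl <;> assumption
  have h1 := sub K hK ha hb (K ∩ L) Finset.inter_subset_left (by
    rw [← T.cell_inter hK hL]
    exact ⟨hzK, convexHull_mono (Finset.coe_subset.2 hsubL) hzL⟩)
  have h2 := sub L hL (Finset.mem_inter.1 h1.1).2 (Finset.mem_inter.1 h1.2).2 _ hsubL hzL
  simpa using h2

end general

/-! ### Cells of a triangulated domain, null sets and adjacency -/

section domain

variable {J : ℕ} {D : MultiplyConnectedPolygon J} (T : Triangulation D.domain) {K L : Finset Plane}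

lemma interior_cell_subset (hK : K ∈ T.cells) :
    interior (convexHull ℝ (K : Set Plane)) ⊆ D.domain :=
  (interior_mono (T.cell_subset_closure hK)).trans D.interior_closure_domain_subset

/-- A cell is contained in the domain up to its boundary, a null set. Almost everywhere statements
and `L²` bounds on the domain therefore restrict to cells. -/
lemma restrict_cell_le (hK : K ∈ T.cells) :
    volume.restrict (convexHull ℝ (K : Set Plane)) ≤ volume.restrict D.domain := by
  refine Measure.restrict_mono' ?_ le_rfl
  filter_upwards [ae_mem_interior_of_mem_cell K] with x hx h
  exact T.interior_cell_subset hK (hx h)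

lemma domain_ae_eq : D.domain =ᵐ[volume] ⋃ K ∈ T.cells, convexHull ℝ (K : Set Plane) := by
  rw [← T.cover]
  filter_upwards [measure_eq_zero_iff_ae_notMem.1 D.volume_frontier_domain] with x hx
  refine propext ⟨fun h => subset_closure h, fun h => ?_⟩
  by_contra h2
  exact hx ⟨h, fun h3 => h2 (interior_subset h3)⟩

lemma setIntegral_domain {f : Plane → ℝ} (hf : IntegrableOn f D.domain) :
    ∫ x in D.domain, f x = ∑ K ∈ T.cells, ∫ x in convexHull ℝ (K : Set Plane), f x := by
  rw [setIntegral_congr_set T.domain_ae_eq]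
  have e : (⋃ K ∈ T.cells, convexHull ℝ (K : Set Plane)) =
      ⋃ K : T.cells, convexHull ℝ ((K : Finset Plane) : Set Plane) :=
    biUnion_eq_iUnion (T.cells : Set (Finset Plane)) (fun K _ => convexHull ℝ (K : Set Plane))
  have hf' : IntegrableOn f (⋃ K : T.cells, convexHull ℝ ((K : Finset Plane) : Set Plane)) := by
    rw [← e]
    exact hf.congr_set_ae T.domain_ae_eq.symm
  rw [e, integral_iUnion_ae (fun K => (isClosed_cell _).measurableSet.nullMeasurableSet)
    (fun K L h => T.volume_cell_inter K.2 L.2 (fun e => h (Subtype.ext e))) hf', tsum_fintype,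
    Finset.sum_coe_sort T.cells fun K => ∫ x in convexHull ℝ (K : Set Plane), f x]

lemma ae_restrict_cell {p : Plane → Prop} (hK : K ∈ T.cells)
    (h : ∀ᵐ x ∂(volume.restrict D.domain), x ∈ convexHull ℝ (K : Set Plane) → p x) :
    ∀ᵐ x ∂(volume.restrict (convexHull ℝ (K : Set Plane))), p x := by
  filter_upwards [(ae_mono (T.restrict_cell_le hK)) h,
    ae_restrict_mem (isClosed_cell K).measurableSet] with x h1 h2 using h1 h2

lemma ae_domain_of_interior {p : Plane → Prop} (K : Finset Plane)
    (h : ∀ᵐ x ∂(volume.restrict D.domain),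
      x ∈ interior (convexHull ℝ (K : Set Plane)) → p x) :
    ∀ᵐ x ∂(volume.restrict D.domain), x ∈ convexHull ℝ (K : Set Plane) → p x := by
  filter_upwards [h, ae_restrict_of_ae (ae_mem_interior_of_mem_cell K)] with x h1 h2 h3
    using h1 (h2 h3)

lemma ae_exists_mem_interior_cell : ∀ᵐ x ∂(volume.restrict D.domain),
    ∃ K ∈ T.cells, x ∈ interior (convexHull ℝ (K : Set Plane)) := by
  have h : ∀ᵐ x, ∀ K ∈ T.cells, x ∈ convexHull ℝ (K : Set Plane) →
      x ∈ interior (convexHull ℝ (K : Set Plane)) :=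
    (ae_ball_iff T.cells.countable_toSet).2 fun K _ => ae_mem_interior_of_mem_cell K
  filter_upwards [ae_restrict_of_ae h, ae_restrict_mem D.isOpen_domain.measurableSet] with x hx hxd
  have := subset_closure hxd
  rw [T.cover] at this
  simp only [mem_iUnion] at this
  obtain ⟨K, hK, hxK⟩ := this
  exact ⟨K, hK, hx K hK hxK⟩

/-- The closure of the domain contains the outer curve, a set of positive length. -/
lemma cells_nonempty : T.cells.Nonempty := by
  by_contra h
  rw [Finset.not_nonempty_iff_eq_empty] at h
  have hc := T.cover
  simp only [h, Finset.notMem_empty, iUnion_of_empty, iUnion_empty] at hc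
  have h2 := D.frontier_outer_subset_closure
  have h3 := D.outer_polygon.hausdorffMeasure_frontier_pos
  rw [hc, subset_empty_iff] at h2
  simp [h2] at h3

/-- A property of some but not all cells distinguishes two cells that meet in the domain. -/
lemma exists_adjacent {p : Finset Plane → Prop}
    (hK : K ∈ T.cells) (hpK : p K) (hL : L ∈ T.cells) (hpL : ¬p L) :
    ∃ K ∈ T.cells, ∃ L ∈ T.cells, p K ∧ ¬p L ∧
      (convexHull ℝ (K : Set Plane) ∩ convexHull ℝ (L : Set Plane) ∩ D.domain).Nonempty := by
  refine T.exists_adjacent_of_isPreconnected D.isPreconnected_domain subset_closure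
    (fun K hK => ?_) hK hpK hL hpL
  obtain ⟨x, hx⟩ := T.interior_cell_nonempty hK
  exact ⟨x, interior_subset hx, T.interior_cell_subset hK hx⟩

/-- A property of some but not all cells distinguishes two cells with a common edge. -/
lemma exists_edge_adjacent {p : Finset Plane → Prop}
    (hK : K ∈ T.cells) (hpK : p K) (hL : L ∈ T.cells) (hpL : ¬p L) :
    ∃ K ∈ T.cells, ∃ L ∈ T.cells, p K ∧ ¬p L ∧ (K ∩ L).card = 2 := by
  classical
  set V : Finset Plane := T.cells.biUnion id
  -- Finitely many points do not disconnect the domain. Removing all vertices excludes adjacency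
  -- through a vertex alone.
  have hV : ∀ s : Finset Plane, IsPreconnected (D.domain \ s) := by
    intro s
    induction s using Finset.induction_on with
    | empty => simpa using D.isPreconnected_domain
    | insert q s _ ih =>
      have : D.domain \ (insert q s : Finset Plane) = (D.domain \ s) \ {q} := by
        ext x
        simp only [Finset.coe_insert, Set.mem_sdiff, mem_insert_iff, mem_singleton_iff]
        tauto
      rw [this]
      exact isPreconnected_diff_singleton (D.isOpen_domain.sdiff s.finite_toSet.isClosed) ih q
  obtain ⟨M, hM, N, hN, hpM, hpN, z, ⟨hzM, hzN⟩, hzD, hzV⟩ :=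
    T.exists_adjacent_of_isPreconnected (hV V) (sdiff_subset.trans subset_closure)
    (fun K hK => by
      obtain ⟨x, hx, hxV⟩ := (V.finite_toSet.countable.dense_compl ℝ).inter_open_nonempty _
        isOpen_interior (T.interior_cell_nonempty hK)
      exact ⟨x, interior_subset hx, T.interior_cell_subset hK hx, hxV⟩) hK hpK hL hpL
  refine ⟨M, hM, N, hN, hpM, hpN, ?_⟩
  -- The common point `z` lies in the hull of the common vertices but is no vertex, so there are at
  -- least two of them.
  have h2 := T.card_inter_le hM hN (fun e => hpN (e ▸ hpM))
  have hz : z ∈ convexHull ℝ ((M ∩ N : Finset Plane) : Set Plane) := by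
    rw [← T.cell_inter hM hN]; exact ⟨hzM, hzN⟩
  rcases (by omega : (M ∩ N).card = 0 ∨ (M ∩ N).card = 1 ∨ (M ∩ N).card = 2) with h | h | h
  · simp [Finset.card_eq_zero.1 h] at hz
  · obtain ⟨q, hq⟩ := Finset.card_eq_one.1 h
    rw [hq, Finset.coe_singleton, convexHull_singleton, mem_singleton_iff] at hz
    refine absurd ?_ hzV
    rw [hz]
    refine Finset.mem_coe.2 (Finset.mem_biUnion.2 ⟨M, hM, ?_⟩)
    have : q ∈ M ∩ N := by simp [hq]
    exact (Finset.mem_inter.1 this).1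
  · exact h

end domain

end Triangulation

end

section

/-! ### Surjectivity of the rotation -/

lemma fderiv_eq_partialD (φ : Plane → ℝ) (x v : Plane) :
    fderiv ℝ φ x v = partialD 0 φ x * v 0 + partialD 1 φ x * v 1 := by
  rw [linear_plane, partialD, partialD]
  ring

/-- Two fields whose rotations have the same boundary contributions. -/
lemma greenRot_sub {Ω U : Set Plane} {τ τ' : L2Vec Ω} {r r' : L2 Ω} {ℓ : (Plane → ℝ) → ℝ}
    (h : ∀ φ, IsTest U φ → ∫ x in Ω, (τ x 0 * partialD 1 φ x - τ x 1 * partialD 0 φ x) =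
      (∫ x in Ω, r x * φ x) - ℓ φ)
    (h' : ∀ φ, IsTest U φ → ∫ x in Ω, (τ' x 0 * partialD 1 φ x - τ' x 1 * partialD 0 φ x) =
      (∫ x in Ω, r' x * φ x) - ℓ φ) : GreenRot Ω U (τ - τ') (r - r') := by
  intro φ hφ
  have e1 : ∫ x in Ω, ((τ - τ' : L2Vec Ω) x 0 * partialD 1 φ x
        - (τ - τ' : L2Vec Ω) x 1 * partialD 0 φ x) =
      ∫ x in Ω, ((τ x 0 * partialD 1 φ x - τ x 1 * partialD 0 φ x)
        - (τ' x 0 * partialD 1 φ x - τ' x 1 * partialD 0 φ x)) := by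
    refine integral_congr_ae ?_
    filter_upwards [Lp.coeFn_sub τ τ'] with x hx
    rw [hx, Pi.sub_apply, PiLp.sub_apply, PiLp.sub_apply]
    ring
  have e2 : ∫ x in Ω, (r - r' : L2 Ω) x * φ x = ∫ x in Ω, (r x * φ x - r' x * φ x) := by
    refine integral_congr_ae ?_
    filter_upwards [Lp.coeFn_sub r r'] with x hx
    rw [hx, Pi.sub_apply, sub_mul]
  rw [e1, e2, integral_sub (GreenRot.integrable hφ τ) (GreenRot.integrable hφ τ'), h φ hφ,
    h' φ hφ, integral_sub (integrable_mul_of_memLp (Lp.memLp r) hφ.memLp)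
      (integrable_mul_of_memLp (Lp.memLp r') hφ.memLp)]
  ring

/-- The Whitney field `(x - p)^⊥ / d`. -/
def whitney (p : Plane) (d : ℝ) (x : Plane) : Plane :=
  d⁻¹ • (!₂[p 1, -p 0] : Plane) + d⁻¹ • (!₂[-x 1, x 0] : Plane)

lemma continuous_whitney (p : Plane) (d : ℝ) : Continuous (whitney p d) := by
  have h0 := continuous_coord 0
  have h1 := continuous_coord 1
  unfold whitney
  fun_prop

/-- The field is orthogonal to the edges issuing from `p`, so only the opposite edge contributes. As
the determinant is twice the area, the rotation is the inverse of the area, and the boundary term is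
the mean over the edge `a b` with a coefficient that does not depend on `p`. -/
lemma setIntegral_whitney {p a b : Plane} (h : cross (a - p) (b - p) ≠ 0) {φ : Plane → ℝ}
    (hφ : IsTest univ φ) :
    ∫ x in convexHull ℝ {p, a, b}, (whitney p |cross (a - p) (b - p)| x 0 * partialD 1 φ x -
        whitney p |cross (a - p) (b - p)| x 1 * partialD 0 φ x) =
      2 * |cross (a - p) (b - p)|⁻¹ * (∫ x in convexHull ℝ {p, a, b}, φ x) - edgeMean a b φ := by
  set d := |cross (a - p) (b - p)|
  have hd : d ≠ 0 := abs_ne_zero.2 h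
  have key := setIntegral_triangle_radial h (φ := φ) (hφ.contDiff.of_le (by simp))
  have hc : IsCompact (convexHull ℝ ({p, a, b} : Set Plane)) :=
    (Set.toFinite _).isCompact_convexHull ℝ
  have hφc := hφ.contDiff.continuous
  have e : ∀ x, whitney p d x 0 * partialD 1 φ x - whitney p d x 1 * partialD 0 φ x =
      d⁻¹ * (2 * φ x) - d⁻¹ * (fderiv ℝ φ x (x - p) + 2 * φ x) := by
    intro x
    rw [fderiv_eq_partialD]
    simp [whitney]
    ring
  have hcont : Continuous fun x => fderiv ℝ φ x (x - p) :=
    (hφ.contDiff.continuous_fderiv (by simp)).clm_apply (by fun_prop)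
  simp only [e]
  rw [integral_sub, integral_const_mul, integral_const_mul, integral_const_mul, key]
  · field_simp
    rfl
  · exact (by fun_prop : Continuous fun x => d⁻¹ * (2 * φ x)).continuousOn.integrableOn_compact hc
  · exact (by fun_prop : Continuous fun x =>
      d⁻¹ * (fderiv ℝ φ x (x - p) + 2 * φ x)).continuousOn.integrableOn_compact hc

namespace Triangulation

variable {J : ℕ} {D : MultiplyConnectedPolygon J} (T : Triangulation D.domain) {K L : Finset Plane}

lemma memLp_of_continuous (D : MultiplyConnectedPolygon J) {E : Type*} [NormedAddCommGroup E]
    [SecondCountableTopologyEither Plane E] {f : Plane → E} (hf : Continuous f) :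
    MemLp f 2 (volume.restrict D.domain) := by
  obtain ⟨C, hC⟩ := D.isBounded_domain.isCompact_closure.exists_bound_of_continuousOn hf.continuousOn
  refine MemLp.of_bound hf.aestronglyMeasurable C ?_
  filter_upwards [ae_restrict_mem D.isOpen_domain.measurableSet] with x hx
    using hC x (subset_closure hx)

lemma setIntegral_indicator_cell (hK : K ∈ T.cells) (f : Plane → ℝ) :
    ∫ x in D.domain, (convexHull ℝ (K : Set Plane)).indicator f x =
      ∫ x in convexHull ℝ (K : Set Plane), f x := by
  rw [setIntegral_indicator (isClosed_cell K).measurableSet]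
  refine setIntegral_congr_set ?_
  filter_upwards [ae_mem_interior_of_mem_cell K] with x hx
  exact propext ⟨fun h => h.2, fun h => ⟨T.interior_cell_subset hK (hx h), h⟩⟩

/-- Extension by zero of a continuous function on a cell, as an element of `L²`. -/
def cellLp (D : MultiplyConnectedPolygon J) (K : Finset Plane) {E : Type*} [NormedAddCommGroup E]
    [SecondCountableTopologyEither Plane E] (f : Plane → E) (hf : Continuous f) :
    Lp E 2 (volume.restrict D.domain) :=
  ((memLp_of_continuous D hf).indicator (s := convexHull ℝ (K : Set Plane))
    (isClosed_cell K).measurableSet).toLp _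

lemma coeFn_cellLp (D : MultiplyConnectedPolygon J) (K : Finset Plane) {E : Type*}
    [NormedAddCommGroup E] [SecondCountableTopologyEither Plane E] (f : Plane → E)
    (hf : Continuous f) :
    cellLp D K f hf =ᵐ[volume.restrict D.domain] (convexHull ℝ (K : Set Plane)).indicator f :=
  MemLp.coeFn_toLp _

lemma cellLp_ae_self (D : MultiplyConnectedPolygon J) (K : Finset Plane) {E : Type*}
    [NormedAddCommGroup E] [SecondCountableTopologyEither Plane E] (f : Plane → E)
    (hf : Continuous f) : ∀ᵐ x ∂(volume.restrict D.domain), x ∈ convexHull ℝ (K : Set Plane) →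
      cellLp D K f hf x = f x := by
  filter_upwards [coeFn_cellLp D K f hf] with x hx h
  rw [hx, indicator_of_mem h]

lemma cellLp_ae_other (hK : K ∈ T.cells) (hL : L ∈ T.cells) (hKL : K ≠ L) {E : Type*}
    [NormedAddCommGroup E] [SecondCountableTopologyEither Plane E] (f : Plane → E)
    (hf : Continuous f) : ∀ᵐ x ∂(volume.restrict D.domain), x ∈ convexHull ℝ (L : Set Plane) →
      cellLp D K f hf x = 0 := by
  filter_upwards [coeFn_cellLp D K f hf,
    ae_restrict_of_ae (measure_eq_zero_iff_ae_notMem.1 (T.volume_cell_inter hK hL hKL))] with x hx h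
    hxL
  rw [hx, indicator_of_notMem fun hxK => h ⟨hxK, hxL⟩]

lemma cellLp_whitney_mem (hK : K ∈ T.cells) (p : Plane) (d : ℝ) :
    cellLp D K (whitney p d) (continuous_whitney p d) ∈ T.piecewiseE := by
  intro L hL
  by_cases h : K = L
  · subst h
    exact ⟨_, _, cellLp_ae_self D K _ _⟩
  · refine ⟨0, 0, ?_⟩
    filter_upwards [T.cellLp_ae_other hK hL h (whitney p d) (continuous_whitney p d)] with x hx hxL
    rw [hx hxL]
    simp

/-- The normalized characteristic function of a cell. -/
def cellUnit (D : MultiplyConnectedPolygon J) (K : Finset Plane) : L2 D.domain :=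
  cellLp D K (fun _ => (volume (convexHull ℝ (K : Set Plane))).toReal⁻¹) continuous_const

lemma green_cellLp_whitney {p a b : Plane} (hK : ({p, a, b} : Finset Plane) ∈ T.cells)
    (h : cross (a - p) (b - p) ≠ 0) {φ : Plane → ℝ} (hφ : IsTest univ φ) :
    ∫ x in D.domain, (cellLp D {p, a, b} _ (continuous_whitney p |cross (a - p) (b - p)|) x 0 *
        partialD 1 φ x - cellLp D {p, a, b} _ (continuous_whitney p |cross (a - p) (b - p)|) x 1 *
          partialD 0 φ x) =
      (∫ x in D.domain, cellUnit D {p, a, b} x * φ x) - edgeMean a b φ := by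
  have hvol := volume_triangle h
  rw [← coe_triangle] at hvol
  have key := setIntegral_whitney h hφ
  rw [← coe_triangle] at key
  set d := |cross (a - p) (b - p)|
  have e1 : ∫ x in D.domain, (cellLp D {p, a, b} _ (continuous_whitney p d) x 0 *
        partialD 1 φ x - cellLp D {p, a, b} _ (continuous_whitney p d) x 1 *
          partialD 0 φ x) = ∫ x in D.domain,
          (convexHull ℝ (({p, a, b} : Finset Plane) : Set Plane)).indicator (fun x =>
            whitney p d x 0 * partialD 1 φ x - whitney p d x 1 * partialD 0 φ x) x := by
    refine integral_congr_ae ?_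
    filter_upwards [coeFn_cellLp D {p, a, b} _ (continuous_whitney p d)] with x hx
    rw [hx]
    by_cases hxK : x ∈ convexHull ℝ (({p, a, b} : Finset Plane) : Set Plane)
    · rw [indicator_of_mem hxK, indicator_of_mem hxK]
    · rw [indicator_of_notMem hxK, indicator_of_notMem hxK]
      simp
  have e2 : ∫ x in D.domain, cellUnit D {p, a, b} x * φ x = ∫ x in D.domain,
          (convexHull ℝ (({p, a, b} : Finset Plane) : Set Plane)).indicator (fun x =>
            2 * d⁻¹ * φ x) x := by
    refine integral_congr_ae ?_
    filter_upwards [coeFn_cellLp D {p, a, b} (fun _ => (volume (convexHull ℝ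
      (({p, a, b} : Finset Plane) : Set Plane))).toReal⁻¹) continuous_const] with x hx
    rw [cellUnit, hx]
    by_cases hxK : x ∈ convexHull ℝ (({p, a, b} : Finset Plane) : Set Plane)
    · rw [indicator_of_mem hxK, indicator_of_mem hxK, ← hvol]
      congr 1
      rw [mul_inv]
      ring
    · rw [indicator_of_notMem hxK, indicator_of_notMem hxK]
      simp
  rw [e1, e2, T.setIntegral_indicator_cell hK, T.setIntegral_indicator_cell hK, key,
    integral_const_mul]

/-- The rotations of the fields in `R_{h0}`. -/
def rotRange : Submodule ℝ (L2 D.domain) where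
  carrier := {r | ∃ τ ∈ T.Rh0, HasWeakRot D.domain τ r}
  add_mem' := fun ⟨τ, hτ, h⟩ ⟨τ', hτ', h'⟩ => ⟨τ + τ', T.Rh0.add_mem hτ hτ', GreenRot.add h h'⟩
  zero_mem' := ⟨0, T.Rh0.zero_mem, GreenRot.zero⟩
  smul_mem' := fun c _ ⟨τ, hτ, h⟩ => ⟨c • τ, T.Rh0.smul_mem c hτ, GreenRot.smul c h⟩

/-- The Whitney fields of the two cells with respect to the common edge have identical boundary
terms `edgeMean a b φ`, which cancel in the difference whatever the orientation of the edge. -/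
lemma cellUnit_sub_mem (hK : K ∈ T.cells) (hL : L ∈ T.cells) (hKL : (K ∩ L).card = 2) :
    cellUnit D K - cellUnit D L ∈ T.rotRange := by
  obtain ⟨a, b, hab, e⟩ := Finset.card_eq_two.1 hKL
  have ha : a ∈ K ∩ L := by simp [e]
  have hb : b ∈ K ∩ L := by simp [e]
  rw [Finset.mem_inter] at ha hb
  obtain ⟨p, -, -, rfl, hp⟩ := T.exists_third_vertex hK ha.1 hb.1 hab
  obtain ⟨q, -, -, rfl, hq⟩ := T.exists_third_vertex hL ha.2 hb.2 hab
  have h : GreenRot D.domain univ (cellLp D {p, a, b} _ (continuous_whitney p _) -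
      cellLp D {q, a, b} _ (continuous_whitney q _)) (cellUnit D {p, a, b} - cellUnit D {q, a, b}) :=
    greenRot_sub (ℓ := edgeMean a b) (fun φ hφ => T.green_cellLp_whitney hK hp hφ)
    (fun φ hφ => T.green_cellLp_whitney hL hq hφ)
  have h' : HasWeakRot D.domain _ _ := fun φ hφ => h φ (hφ.mono (subset_univ _))
  exact ⟨_, ⟨⟨⟨_, h'⟩, T.piecewiseE.sub_mem (T.cellLp_whitney_mem hK _ _)
    (T.cellLp_whitney_mem hL _ _)⟩, _, h', h⟩, h'⟩

/-- By telescoping, the property of having an attained difference with `L` passes across every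
common edge. A cell without it would contradict `exists_edge_adjacent`. -/
lemma cellUnit_sub_mem' (hK : K ∈ T.cells) (hL : L ∈ T.cells) :
    cellUnit D K - cellUnit D L ∈ T.rotRange := by
  by_contra h
  obtain ⟨M, hM, N, hN, hpM, hpN, hMN⟩ := T.exists_edge_adjacent
    (p := fun M => cellUnit D M - cellUnit D L ∈ T.rotRange) hL (by simp) hK h
  have h1 := T.cellUnit_sub_mem hN hM (by rwa [Finset.inter_comm])
  refine hpN ?_
  have := T.rotRange.add_mem h1 hpM
  rwa [sub_add_sub_cancel] at this

/-- The coefficients of `q` with respect to the `cellUnit` functions are its integrals over the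
cells. They add up to zero, so the unit of one reference cell may be subtracted from every term. -/
lemma mem_rotRange {q : L2 D.domain} (hq : q ∈ L0h0 D T) : q ∈ T.rotRange := by
  obtain ⟨hq0, hqm⟩ := hq
  choose! c hc using hq0
  set m : Finset Plane → ℝ := fun K => (volume (convexHull ℝ (K : Set Plane))).toReal
  have hsum : ∑ K ∈ T.cells, c K * m K = 0 := by
    have h1 : ∫ x in D.domain, q x = 0 := hqm
    rw [T.setIntegral_domain ((Lp.memLp q).integrable (by norm_num))] at h1
    rw [← h1]
    refine Finset.sum_congr rfl fun K hK => ?_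
    rw [integral_congr_ae (T.ae_restrict_cell hK (hc K hK))]
    simp [m, Measure.real, mul_comm]
  obtain ⟨K₀, hK₀⟩ := T.cells_nonempty
  have e : q = ∑ K ∈ T.cells, (c K * m K) • cellUnit D K := by
    refine Lp.ext ?_
    have h1 : ∀ᵐ x ∂(volume.restrict D.domain), ∀ K ∈ T.cells, x ∈ convexHull ℝ (K : Set Plane) →
        q x = c K := (ae_ball_iff T.cells.countable_toSet).2 hc
    have h2 : ∀ᵐ x ∂(volume.restrict D.domain), ∀ K ∈ T.cells, x ∈ convexHull ℝ (K : Set Plane) →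
        cellUnit D K x = (m K)⁻¹ := (ae_ball_iff T.cells.countable_toSet).2 fun K _ =>
          cellLp_ae_self D K _ _
    have h3 : ∀ᵐ x ∂(volume.restrict D.domain), ∀ K ∈ T.cells, ∀ L ∈ T.cells, K ≠ L →
        x ∈ convexHull ℝ (L : Set Plane) → cellUnit D K x = 0 :=
      (ae_ball_iff T.cells.countable_toSet).2 fun K hK =>
        (ae_ball_iff T.cells.countable_toSet).2 fun L hL => ae_all_iff.2 fun hKL =>
          T.cellLp_ae_other hK hL hKL _ _
    have h4 : ∀ᵐ x ∂(volume.restrict D.domain), ∀ K ∈ T.cells,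
        ((c K * m K) • cellUnit D K : L2 D.domain) x = (c K * m K) * cellUnit D K x :=
      (ae_ball_iff T.cells.countable_toSet).2 fun K hK => Lp.coeFn_smul _ _
    have h5 := Lp.coeFn_finsetSum T.cells fun K => (c K * m K) • cellUnit D K
    filter_upwards [h1, h2, h3, h4, h5, T.ae_exists_mem_interior_cell] with x h1 h2 h3 h4 h5 h6
    obtain ⟨K, hK, hxK⟩ := h6
    have hxK := interior_subset hxK
    rw [h5, Finset.sum_apply, Finset.sum_eq_single K, h4 K hK, h2 K hK hxK, h1 K hK hxK, mul_assoc,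
      mul_inv_cancel₀ (T.volume_cell_pos hK).ne', mul_one]
    · intro L hL hLK
      rw [h4 L hL, h3 L hL K hK hLK hxK, mul_zero]
    · exact fun h => absurd hK h
  have e2 : q = ∑ K ∈ T.cells, (c K * m K) • (cellUnit D K - cellUnit D K₀) := by
    simp only [smul_sub, Finset.sum_sub_distrib]
    rw [← Finset.sum_smul, hsum, zero_smul, sub_zero]
    exact e
  rw [e2]
  exact T.rotRange.sum_mem fun K hK => T.rotRange.smul_mem _ (T.cellUnit_sub_mem' hK hK₀)

/-! ### The rotation maps into the piecewise constants of mean value zero -/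

/-- Green's formula is tested with a cutoff that equals 1 on a ball containing the domain, so its
gradient vanishes there. -/
lemma integral_eq_zero_of_greenRot {τ : L2Vec D.domain} {r : L2 D.domain}
    (h : GreenRot D.domain univ τ r) : ∫ x in D.domain, r x = 0 := by
  obtain ⟨R, hR⟩ := D.isBounded_domain.subset_ball (0 : Plane)
  set B : ContDiffBump (0 : Plane) := ⟨max R 1, max R 1 + 1, by positivity, by linarith⟩
  have hφ : IsTest univ B := ⟨B.contDiff, B.hasCompactSupport, subset_univ _⟩
  have hone : ∀ x ∈ D.domain, B =ᶠ[𝓝 x] fun _ => 1 := by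
    intro x hx
    filter_upwards [isOpen_ball.mem_nhds (hR hx)] with y hy
    refine B.one_of_mem_closedBall (ball_subset_closedBall (ball_subset_ball (le_max_left _ _) hy))
  have h1 := h B hφ
  have e1 : ∫ x in D.domain, (τ x 0 * partialD 1 B x - τ x 1 * partialD 0 B x) = 0 := by
    refine setIntegral_eq_zero_of_forall_eq_zero fun x hx => ?_
    have : fderiv ℝ B x = 0 := by rw [(hone x hx).fderiv_eq]; simp
    simp [partialD, this]
  rw [e1] at h1
  rw [h1]
  refine setIntegral_congr_fun D.isOpen_domain.measurableSet fun x hx => ?_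
  simp only [(hone x hx).eq_of_nhds, mul_one]

/-- Membership in `H₀(rot)` supplies Green's formula for some weak rotation, which is the given one
by uniqueness. -/
lemma greenRot_univ {τ : L2Vec D.domain} {r : L2 D.domain} (hτ : τ ∈ T.Rh0)
    (h : HasWeakRot D.domain τ r) : GreenRot D.domain univ τ r := by
  obtain ⟨-, r', h', hg⟩ := hτ
  rwa [h.unique D.isOpen_domain h']

lemma rot_mem {τ : L2Vec D.domain} {r : L2 D.domain} (hτ : τ ∈ T.Rh0)
    (h : HasWeakRot D.domain τ r) : r ∈ L0h0 D T := by
  refine ⟨fun K hK => ?_, integral_eq_zero_of_greenRot (T.greenRot_univ hτ h)⟩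
  obtain ⟨u, v, huv⟩ := hτ.1.2 K hK
  refine ⟨2 * v, ae_domain_of_interior K (HasWeakRot.ae_eq_of_affine isOpen_interior
    (T.interior_cell_subset hK) h (u := u) (v := v) ?_)⟩
  filter_upwards [huv] with x hx hxK using hx (interior_subset hxK)

end Triangulation

end

section

/-! ### Rotation free fields are gradients -/

namespace Triangulation

variable {J : ℕ} {D : MultiplyConnectedPolygon J} (T : Triangulation D.domain) {K L : Finset Plane}

lemma eq_of_ae_interior_cell (hK : K ∈ T.cells) {p : Prop}
    (h : ∀ᵐ x ∂(volume.restrict D.domain), x ∈ interior (convexHull ℝ (K : Set Plane)) → p) :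
    p := by
  by_contra hp
  have h1 : ∀ᵐ x, x ∉ interior (convexHull ℝ (K : Set Plane)) := by
    rw [ae_restrict_iff' D.isOpen_domain.measurableSet] at h
    filter_upwards [h] with x hx hxK using hp (hx (T.interior_cell_subset hK hxK) hxK)
  have h2 := isOpen_interior.eq_empty_of_measure_zero (measure_eq_zero_iff_ae_notMem.2 h1)
  exact (T.interior_cell_nonempty hK).ne_empty h2

/-- The rotation on `K` is `2 v`, and the interior of `K` is not a null set, so `v = 0`. -/
lemma exists_const_of_rot_eq_zero {τ : L2Vec D.domain} (hτ : τ ∈ T.piecewiseE)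
    (h : HasWeakRot D.domain τ 0) (hK : K ∈ T.cells) : ∃ u : Plane,
      ∀ᵐ x ∂(volume.restrict D.domain), x ∈ convexHull ℝ (K : Set Plane) → τ x = u := by
  obtain ⟨u, v, huv⟩ := hτ K hK
  have h1 := HasWeakRot.ae_eq_of_affine isOpen_interior (T.interior_cell_subset hK) h (u := u)
    (v := v) (by filter_upwards [huv] with x hx hxK using hx (interior_subset hxK))
  have hv : 2 * v = 0 := by
    refine (T.eq_of_ae_interior_cell hK ?_)
    filter_upwards [h1, Lp.coeFn_zero ℝ 2 (volume.restrict D.domain)] with x h2 h3 hx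
    rw [← h2 hx, h3]
    rfl
  have hv' : v = 0 := by linarith
  refine ⟨u, ?_⟩
  filter_upwards [huv] with x hx hxK
  rw [hx hxK, hv', zero_smul, add_zero]

/-- The extension of `τ` by zero is bounded, irrotational in the plane and constant on each cell.
Its Lipschitz potential is affine on each cell, and constant on each hole and on the exterior, which
gives the required boundary values by continuity. -/
lemma exists_grad_eq {τ : L2Vec D.domain} (hτ : τ ∈ T.Rh0) (h : HasWeakRot D.domain τ 0) :
    ∃ w ∈ LhC D T, HasWeakGrad D.domain w τ := by
  have hΩ := D.isOpen_domain.measurableSet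
  choose! u hu using fun K (hK : K ∈ T.cells) => T.exists_const_of_rot_eq_zero hτ.1.2 h hK
  have hu' : ∀ᵐ x ∂(volume.restrict D.domain), ∀ K ∈ T.cells, x ∈ convexHull ℝ (K : Set Plane) →
      τ x = u K := (ae_ball_iff T.cells.countable_toSet).2 hu
  have hbound : ∀ᵐ x, ‖D.domain.indicator τ x‖ ≤ ∑ K ∈ T.cells, ‖u K‖ := by
    have : ∀ᵐ x ∂(volume.restrict D.domain), ‖τ x‖ ≤ ∑ K ∈ T.cells, ‖u K‖ := by
      filter_upwards [hu', T.ae_exists_mem_interior_cell] with x h1 ⟨K, hK, hxK⟩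
      rw [h1 K hK (interior_subset hxK)]
      exact Finset.single_le_sum (f := fun K => ‖u K‖) (fun _ _ => norm_nonneg _) hK
    rw [ae_restrict_iff' hΩ] at this
    filter_upwards [this] with x hx
    by_cases hxΩ : x ∈ D.domain
    · rw [indicator_of_mem hxΩ]
      exact hx hxΩ
    · rw [indicator_of_notMem hxΩ, norm_zero]
      exact Finset.sum_nonneg fun _ _ => norm_nonneg _
  -- The zero tangential trace is Green's formula for all test functions of the plane, and this is
  -- the irrotationality of the extension by zero.
  have hrot : ∀ φ, IsTest univ φ → ∫ x, (D.domain.indicator τ x 0 * partialD 1 φ x -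
      D.domain.indicator τ x 1 * partialD 0 φ x) = 0 := by
    intro φ hφ
    have h1 := T.greenRot_univ hτ h φ hφ
    have h2 : ∫ x in D.domain, (0 : L2 D.domain) x * φ x = 0 := by
      refine integral_eq_zero_of_ae ?_
      filter_upwards [Lp.coeFn_zero ℝ 2 (volume.restrict D.domain)] with x hx
      rw [hx]
      simp
    rw [h2, ← integral_indicator hΩ] at h1
    rw [← h1]
    congr 1
    ext x
    by_cases hxΩ : x ∈ D.domain
    · simp only [indicator_of_mem hxΩ]
    · simp only [indicator_of_notMem hxΩ]
      simp
  obtain ⟨W₀, C, hW₀, haff₀⟩ := exists_lipschitz_potential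
    ((aestronglyMeasurable_indicator_iff hΩ).2 (Lp.aestronglyMeasurable τ)) hbound hrot
  -- Off the domain the extended field is zero, so on open connected sets there the potential is
  -- affine with zero gradient.
  have hout : ∀ O : Set Plane, IsOpen O → IsPreconnected O → Disjoint O D.domain →
      ∃ c, ∀ y ∈ O, W₀ y = c := by
    intro O hO hOc hd
    obtain ⟨c, hc⟩ := haff₀ O 0 hO hOc (Eventually.of_forall fun x hx =>
      indicator_of_notMem (disjoint_left.1 hd hx) _)
    exact ⟨c, fun y hy => by simp [hc y hy]⟩
  obtain ⟨c₀, hc₀⟩ := hout (closure D.outer)ᶜ isClosed_closure.isOpen_compl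
    D.outer_polygon.isPreconnected_compl_closure
    (disjoint_left.2 fun x hx hxΩ => hx (subset_closure hxΩ.1))
  -- Subtracting the constant of the exterior yields the value 0 on the outer curve; on the holes
  -- other constants may remain.
  set W : Plane → ℝ := fun x => W₀ x - c₀ with hWdef
  have hW : LipschitzWith C W := by
    refine LipschitzWith.of_dist_le_mul fun x y => ?_
    have := hW₀.dist_le_mul x y
    simpa [hWdef, Real.dist_eq] using this
  have haff : ∀ K ∈ T.cells, ∃ c, ∀ y ∈ convexHull ℝ (K : Set Plane),
      W y = c + (u K 0 * y 0 + u K 1 * y 1) := by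
    intro K hK
    obtain ⟨c, hc⟩ := haff₀ (interior (convexHull ℝ (K : Set Plane))) (u K) isOpen_interior
      (convex_convexHull ℝ _).interior.isPreconnected (by
        have := hu K hK
        rw [ae_restrict_iff' hΩ] at this
        filter_upwards [this] with x hx hxK
        rw [indicator_of_mem (T.interior_cell_subset hK hxK)]
        exact hx (T.interior_cell_subset hK hxK) (interior_subset hxK))
    refine ⟨c - c₀, fun y hy => ?_⟩
    have h0 := continuous_coord 0
    have h1 := continuous_coord 1
    rw [← T.closure_interior_cell hK] at hy
    refine (isClosed_eq hW.continuous (by fun_prop : Continuous fun y : Plane =>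
      c - c₀ + (u K 0 * y 0 + u K 1 * y 1))).closure_subset_iff.2 (fun z hz => ?_) hy
    change W₀ z - c₀ = _
    rw [hc z hz]
    ring
  have hclosure : ∀ (O : Set Plane) (c : ℝ), (∀ y ∈ O, W y = c) → ∀ y ∈ closure O, W y = c :=
    fun O c hO y hy => (isClosed_eq hW.continuous continuous_const).closure_subset_iff.2 hO hy
  set w : L2 D.domain := (memLp_of_continuous D hW.continuous).toLp W
  have hw : w =ᵐ[volume.restrict D.domain] W := MemLp.coeFn_toLp _
  have hloc : LocallyAffineWith D.domain W τ := by
    filter_upwards [hu', T.ae_exists_mem_interior_cell] with x h1 ⟨K, hK, hxK⟩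
    obtain ⟨ε, hε, hb⟩ := isOpen_iff.1 isOpen_interior x hxK
    obtain ⟨c, hc⟩ := haff K hK
    refine ⟨ε / 2, by positivity, fun y hy => ?_⟩
    rw [mul_div_cancel₀ ε two_ne_zero] at hy
    rw [hc y (interior_subset (hb hy)), hc x (interior_subset hxK), h1 K hK (interior_subset hxK)]
    ring
  have hgrad : HasWeakGrad D.domain w τ := hasWeakGrad_of_lipschitz hW hloc hw
  refine ⟨w, ⟨⟨⟨τ, hgrad⟩, fun K hK => ?_⟩, ⟨τ, hgrad⟩, ?_, fun j => ?_⟩, hgrad⟩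
  · obtain ⟨c, hc⟩ := haff K hK
    refine ⟨c, u K, ?_⟩
    filter_upwards [hw] with x hx hxK
    rw [hx, hc x hxK]
  · refine hasTrace_of_lipschitz hW hloc hw isClosed_frontier.measurableSet
      D.outer_polygon.hausdorffMeasure_frontier_lt_top fun x hx => ?_
    refine hclosure (closure D.outer)ᶜ 0 (fun y hy => ?_) x
      (D.outer_polygon.frontier_subset_closure_compl hx)
    simp [hWdef, hc₀ y hy]
  · obtain ⟨c, hc⟩ := hout (D.hole j) (D.hole_polygon j).isOpen
      (D.hole_polygon j).isConnected.isPreconnected (D.disjoint_hole_domain j)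
    refine ⟨c - c₀, hasTrace_of_lipschitz hW hloc hw isClosed_frontier.measurableSet
      (D.hole_polygon j).hausdorffMeasure_frontier_lt_top fun x hx => ?_⟩
    exact hclosure (D.hole j) (c - c₀) (fun y hy => by simp [hWdef, hc y hy]) x
      (frontier_subset_closure hx)

end Triangulation

end

section

/-! ### Traces on edges -/

/-- The parametrization multiplies length by `dist a b`. Convergence in `L²` of the curve `S`
thereby passes to the parameters whose points lie in `S`, even if only part of the edge does. -/
lemma map_lineMap_restrict_le {a b : Plane} (hab : a ≠ b) (S : Set Plane) :
    Measure.map (lineMap a b : ℝ → Plane) (volume.restrict ((lineMap a b : ℝ → Plane) ⁻¹' S)) ≤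
      (nndist a b : ℝ≥0∞)⁻¹ • (Measure.hausdorffMeasure 1).restrict S := by
  have hγ : Continuous (lineMap a b : ℝ → Plane) := lineMap_continuous
  refine Measure.le_iff.2 fun A hA => ?_
  have hd : (nndist a b : ℝ≥0∞) ≠ 0 := by simpa using hab
  rw [Measure.map_apply hγ.measurable hA, Measure.restrict_apply (hγ.measurable hA),
    Measure.smul_apply, Measure.restrict_apply hA, smul_eq_mul]
  set t : Set ℝ := (lineMap a b : ℝ → Plane) ⁻¹' A ∩ (lineMap a b : ℝ → Plane) ⁻¹' S
  have h1 := hausdorffMeasure_lineMap_image a b t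
  rw [hausdorffMeasure_real] at h1
  have h2 : volume t = (nndist a b : ℝ≥0∞)⁻¹ *
      Measure.hausdorffMeasure 1 ((lineMap a b : ℝ → Plane) '' t) := by
    rw [h1, ENNReal.smul_def, smul_eq_mul, ← mul_assoc, ENNReal.inv_mul_cancel hd (by simp),
      one_mul]
  rw [h2]
  gcongr
  rintro _ ⟨s, ⟨hs1, hs2⟩, rfl⟩
  exact ⟨hs1, hs2⟩

lemma tendsto_integral_sq_of_tendsto_eLpNorm {X E : Type*} [MeasurableSpace X] {μ : Measure X}
    [NormedAddCommGroup E] {f : ℕ → X → E} (hf : ∀ n, MemLp (f n) 2 μ)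
    (h : Tendsto (fun n => eLpNorm (f n) 2 μ) atTop (𝓝 0)) :
    Tendsto (fun n => ∫ x, ‖f n x‖ ^ 2 ∂μ) atTop (𝓝 0) := by
  have e : ∀ n, ∫ x, ‖f n x‖ ^ 2 ∂μ = (eLpNorm (f n) 2 μ).toReal ^ 2 := by
    intro n
    have h0 : 0 ≤ ∫ x, ‖f n x‖ ^ 2 ∂μ := integral_nonneg fun x => by positivity
    rw [(hf n).eLpNorm_eq_integral_rpow_norm (by norm_num) (by norm_num),
      ENNReal.toReal_ofReal (by positivity), ← Real.rpow_natCast _ 2, ← Real.rpow_mul (by positivity)]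
    simp
  simp only [e]
  have := (ENNReal.tendsto_toReal ENNReal.zero_ne_top).comp h
  simpa using this.pow 2

lemma tendsto_eLpNorm_of_tendsto_integral_sq {X : Type*} [MeasurableSpace X] {μ : Measure X}
    {f : ℕ → X → ℝ} (hf : ∀ n, MemLp (f n) 2 μ)
    (h : Tendsto (fun n => ∫ x, f n x ^ 2 ∂μ) atTop (𝓝 0)) :
    Tendsto (fun n => eLpNorm (f n) 2 μ) atTop (𝓝 0) := by
  have e : ∀ n, eLpNorm (f n) 2 μ = ENNReal.ofReal (√(∫ x, f n x ^ 2 ∂μ)) := by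
    intro n
    rw [(hf n).eLpNorm_eq_integral_rpow_norm (by norm_num) (by norm_num), Real.sqrt_eq_rpow]
    simp
  simp only [e]
  have := ENNReal.tendsto_ofReal ((Real.continuous_sqrt.tendsto 0).comp h)
  simpa using this

/-- The trace inequality on a triangle. -/
lemma edgeMean_sq_le {p a b : Plane} (h : cross (a - p) (b - p) ≠ 0) {ψ : Plane → ℝ}
    (hψ : ContDiff ℝ ∞ ψ) {M : ℝ} (hM : ∀ x ∈ convexHull ℝ {p, a, b}, ‖x - p‖ ≤ M) :
    |cross (a - p) (b - p)| * edgeMean a b (fun x => ψ x ^ 2) ≤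
      (M + 2) * (∫ x in convexHull ℝ {p, a, b}, ‖ψ x‖ ^ 2) +
        M * ∫ x in convexHull ℝ {p, a, b}, ‖gradient ψ x‖ ^ 2 := by
  have hc : IsCompact (convexHull ℝ ({p, a, b} : Set Plane)) :=
    (Set.toFinite _).isCompact_convexHull ℝ
  have hψc := hψ.continuous
  have hgc := gradient_continuous hψ
  have hsq : ContDiff ℝ 1 fun x => ψ x ^ 2 := (hψ.of_le (by simp)).pow 2
  have hd : ∀ x v, fderiv ℝ (fun x => ψ x ^ 2) x v = 2 * ψ x * inner ℝ (gradient ψ x) v := by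
    intro x v
    have hdx := (hψ.differentiable (by simp)) x
    have h1 := (hdx.hasGradientAt.hasFDerivAt.pow 2).fderiv
    rw [h1]
    simp
  -- The radial identity for `ψ²` has the integrand `2 ψ ∇ψ · (x - p) + 2 ψ²`. Young's inequality
  -- bounds it by `(M + 2) ψ² + M |∇ψ|²`.
  rw [← setIntegral_triangle_radial h hsq, ← integral_const_mul, ← integral_const_mul,
    ← integral_add]
  · refine setIntegral_mono_on ?_ ?_ hc.measurableSet fun x hx => ?_
    · exact (((hsq.continuous_fderiv (by simp)).clm_apply (by fun_prop)).add
        (by fun_prop)).continuousOn.integrableOn_compact hc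
    · exact (by fun_prop : Continuous fun x => (M + 2) * ‖ψ x‖ ^ 2 +
        M * ‖gradient ψ x‖ ^ 2).continuousOn.integrableOn_compact hc
    · rw [hd, Real.norm_eq_abs, sq_abs]
      have h1 := abs_real_inner_le_norm (gradient ψ x) (x - p)
      have h2 : ‖gradient ψ x‖ * ‖x - p‖ ≤ ‖gradient ψ x‖ * M :=
        mul_le_mul_of_nonneg_left (hM x hx) (norm_nonneg _)
      have hM0 : 0 ≤ M := (norm_nonneg _).trans (hM x hx)
      have h3 : ψ x * inner ℝ (gradient ψ x) (x - p) ≤ |ψ x| * (‖gradient ψ x‖ * M) := by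
        refine (le_abs_self _).trans ?_
        rw [abs_mul]
        exact mul_le_mul_of_nonneg_left (h1.trans h2) (abs_nonneg _)
      have h4 := mul_nonneg hM0 (sq_nonneg (|ψ x| - ‖gradient ψ x‖))
      have h5 := sq_abs (ψ x)
      nlinarith
  · exact (by fun_prop : Continuous fun x => (M + 2) * ‖ψ x‖ ^ 2).continuousOn.integrableOn_compact hc
  · exact (by fun_prop : Continuous fun x =>
      M * ‖gradient ψ x‖ ^ 2).continuousOn.integrableOn_compact hc

lemma gradient_affine (α : ℝ) (u x : Plane) :
    HasGradientAt (fun x : Plane => α + (u 0 * x 0 + u 1 * x 1)) u x := by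
  have e : (fun x : Plane => α + (u 0 * x 0 + u 1 * x 1)) = fun x => α + inner ℝ u x := by
    ext x
    simp [PiLp.inner_apply, Fin.sum_univ_two, mul_comm]
  rw [e, hasGradientAt_iff_hasFDerivAt]
  exact ((InnerProductSpace.toDual ℝ Plane u).hasFDerivAt (x := x)).const_add α

namespace Triangulation

variable {J : ℕ} {D : MultiplyConnectedPolygon J} (T : Triangulation D.domain) {K L : Finset Plane}

/-- Links the trace, given by approximation, to the pointwise values on an edge. The approximants `φ
n` converge on the cell in `H¹` to the affine polynomial, hence by the trace inequality in `L²` of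
the edge. On the part of the edge in `S` they also converge to `c`, and limits agree. -/
lemma ae_eq_of_hasTrace {w : L2 D.domain} {S : Set Plane} (hS : MeasurableSet S) {c : ℝ}
    (h : HasTrace D.domain w S fun _ => c) (hK : K ∈ T.cells) {a b : Plane} (ha : a ∈ K)
    (hb : b ∈ K) (hab : a ≠ b) {α : ℝ} {u : Plane}
    (hw : ∀ᵐ x ∂(volume.restrict D.domain), x ∈ convexHull ℝ (K : Set Plane) →
      w x = α + (u 0 * x 0 + u 1 * x 1)) :
    ∀ᵐ s : ℝ, s ∈ Icc (0 : ℝ) 1 → lineMap a b s ∈ S →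
      α + (u 0 * (lineMap a b s : Plane) 0 + u 1 * (lineMap a b s : Plane) 1) = c := by
  obtain ⟨g, hg, φ, hφ, h1, h2, h3⟩ := h
  obtain ⟨p, -, -, rfl, hd⟩ := T.exists_third_vertex hK ha hb hab
  have hgu : ∀ᵐ x ∂(volume.restrict D.domain),
      x ∈ convexHull ℝ (({p, a, b} : Finset Plane) : Set Plane) → g x = u :=
    ae_domain_of_interior _ (HasWeakGrad.ae_eq_of_affine isOpen_interior
      (T.interior_cell_subset hK) hg (a := α) (by
        filter_upwards [hw] with x hx hxK using hx (interior_subset hxK)))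
  have hw' := T.ae_restrict_cell hK hw
  have hgu' := T.ae_restrict_cell hK hgu
  have hle := T.restrict_cell_le hK
  have hc := isCompact_cell ({p, a, b} : Finset Plane)
  rw [coe_triangle] at hw' hgu' hle hc
  set f : Plane → ℝ := fun x => α + (u 0 * x 0 + u 1 * x 1)
  have hf : ContDiff ℝ ∞ f := contDiff_affine α (u 0) (u 1)
  set ψ : ℕ → Plane → ℝ := fun n x => φ n x - f x with hψdef
  have hψ : ∀ n, ContDiff ℝ ∞ (ψ n) := fun n => (hφ n).sub hf
  set γ : ℝ → Plane := fun s => (lineMap a b : ℝ →ᵃ[ℝ] Plane) s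
  have hγ : Continuous γ := lineMap_continuous
  have memLpK : ∀ {E : Type} [NormedAddCommGroup E] [SecondCountableTopologyEither Plane E]
      {f : Plane → E}, Continuous f → MemLp f 2 (volume.restrict (convexHull ℝ {p, a, b})) :=
    fun hf => (memLp_of_continuous D hf).mono_measure hle
  have hψ0 : Tendsto (fun n => ∫ x in convexHull ℝ {p, a, b}, ‖ψ n x‖ ^ 2) atTop (𝓝 0) := by
    refine tendsto_integral_sq_of_tendsto_eLpNorm (fun n => memLpK (hψ n).continuous) ?_
    refine tendsto_of_tendsto_of_tendsto_of_le_of_le tendsto_const_nhds h1 (fun _ => zero_le)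
      fun n => ?_
    refine le_trans (le_of_eq (eLpNorm_congr_ae ?_)) (eLpNorm_mono_measure _ hle)
    filter_upwards [hw'] with x hx
    rw [hx]
  have hψ1 : Tendsto (fun n => ∫ x in convexHull ℝ {p, a, b}, ‖gradient (ψ n) x‖ ^ 2) atTop
      (𝓝 0) := by
    refine tendsto_integral_sq_of_tendsto_eLpNorm
      (fun n => memLpK (gradient_continuous (hψ n))) ?_
    refine tendsto_of_tendsto_of_tendsto_of_le_of_le tendsto_const_nhds h2 (fun _ => zero_le)
      fun n => ?_
    refine le_trans (le_of_eq (eLpNorm_congr_ae ?_)) (eLpNorm_mono_measure _ hle)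
    filter_upwards [hgu'] with x hx
    have hdx := ((hφ n).differentiable (by simp)) x
    rw [hx]
    refine (HasGradientAt.gradient (hasGradientAt_iff_hasFDerivAt.2 ?_))
    rw [map_sub]
    exact hdx.hasGradientAt.hasFDerivAt.sub (gradient_affine α u x).hasFDerivAt
  obtain ⟨M, hM⟩ := hc.exists_bound_of_continuousOn (f := fun x => x - p) (by fun_prop)
  have hmean : Tendsto (fun n => ∫ s in Icc (0 : ℝ) 1, ψ n (γ s) ^ 2) atTop (𝓝 0) := by
    have hup := ((hψ0.const_mul (M + 2)).add (hψ1.const_mul M)).const_mul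
      |cross (a - p) (b - p)|⁻¹
    simp only [mul_zero, add_zero] at hup
    refine tendsto_of_tendsto_of_tendsto_of_le_of_le tendsto_const_nhds hup
      (fun n => integral_nonneg fun s => sq_nonneg _) fun n => ?_
    have h4 := edgeMean_sq_le hd (hψ n) hM
    rw [edgeMean, intervalIntegral.integral_of_le zero_le_one, ← integral_Icc_eq_integral_Ioc] at h4
    rwa [← div_eq_inv_mul, le_div_iff₀' (abs_pos.2 hd)]
  have hψc : ∀ n, Continuous fun s => ψ n (γ s) := fun n => (hψ n).continuous.comp hγ
  have hlim1 : Tendsto (fun n => eLpNorm (fun s => ψ n (γ s)) 2 (volume.restrict (Icc (0 : ℝ) 1)))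
      atTop (𝓝 0) := by
    refine tendsto_eLpNorm_of_tendsto_integral_sq (fun n => ?_) hmean
    obtain ⟨B, hB⟩ := isCompact_Icc.exists_bound_of_continuousOn (hψc n).continuousOn
    refine MemLp.of_bound (hψc n).aestronglyMeasurable B ?_
    filter_upwards [ae_restrict_mem measurableSet_Icc] with s hs using hB s hs
  have hlim2 : Tendsto (fun n => eLpNorm (fun s => φ n (γ s) - c) 2 (volume.restrict (γ ⁻¹' S)))
      atTop (𝓝 0) := by
    have hup := ENNReal.Tendsto.const_mul (a := ((nndist a b : ℝ≥0∞)⁻¹) ^ (1 / (2 : ℝ≥0∞).toReal))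
      h3 (Or.inr (ENNReal.rpow_ne_top_of_nonneg (by simp) (by simpa using hab)))
    rw [mul_zero] at hup
    refine tendsto_of_tendsto_of_tendsto_of_le_of_le tendsto_const_nhds hup (fun _ => zero_le)
      fun n => ?_
    have e : eLpNorm (fun s => φ n (γ s) - c) 2 (volume.restrict (γ ⁻¹' S)) =
        eLpNorm (fun x => φ n x - c) 2 (Measure.map γ (volume.restrict (γ ⁻¹' S))) :=
      (eLpNorm_map_measure ((hφ n).continuous.sub continuous_const).aestronglyMeasurable
        hγ.aemeasurable).symm
    rw [e]
    refine (eLpNorm_mono_measure _ (map_lineMap_restrict_le hab S)).trans (le_of_eq ?_)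
    rw [eLpNorm_smul_measure_of_ne_top (by norm_num), smul_eq_mul, ENNReal.toReal_div]
    simp
  set ν : Measure ℝ := volume.restrict (Icc (0 : ℝ) 1 ∩ γ ⁻¹' S)
  have hfc : Continuous fun s => f (γ s) - c := (hf.continuous.comp hγ).sub continuous_const
  have hzero : eLpNorm (fun s => f (γ s) - c) 2 ν = 0 := by
    refine le_antisymm (ge_of_tendsto' (by simpa using hlim1.add hlim2) fun n => ?_) zero_le
    have e : (fun s => f (γ s) - c) = (fun s => φ n (γ s) - c) - fun s => ψ n (γ s) := by
      ext s
      simp [hψdef]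
    have hφc : Continuous fun s => φ n (γ s) - c := ((hφ n).continuous.comp hγ).sub continuous_const
    rw [e]
    refine (eLpNorm_sub_le hφc.aestronglyMeasurable (hψc n).aestronglyMeasurable
      (by norm_num)).trans ?_
    rw [add_comm]
    exact add_le_add (eLpNorm_mono_measure _ (Measure.restrict_mono inter_subset_left le_rfl))
      (eLpNorm_mono_measure _ (Measure.restrict_mono inter_subset_right le_rfl))
  rw [eLpNorm_eq_zero_iff hfc.aestronglyMeasurable (by norm_num), Filter.EventuallyEq,
    ae_restrict_iff' (measurableSet_Icc.inter (hγ.measurable hS))] at hzero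
  filter_upwards [hzero] with s hs hs1 hs2
  have := hs ⟨hs1, hs2⟩
  simpa [sub_eq_zero] using this

end Triangulation

end

section

/-! ### Injectivity of the gradient -/

namespace Triangulation

variable {J : ℕ} {D : MultiplyConnectedPolygon J} (T : Triangulation D.domain) {K L : Finset Plane}

/-- Near `z` the fine mollifications of `w` are constant, while at suitable nearby points inside `K`
and inside `L` they equal `c K` and `c L`. A common vertex in the domain suffices. -/
lemma const_eq_of_mem_inter {w : L2 D.domain} (hw : HasWeakGrad D.domain w 0) {c : Finset Plane → ℝ}
    (hc : ∀ K ∈ T.cells, ∀ᵐ x ∂(volume.restrict D.domain),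
      x ∈ convexHull ℝ (K : Set Plane) → w x = c K) (hK : K ∈ T.cells) (hL : L ∈ T.cells)
    {z : Plane} (hzK : z ∈ convexHull ℝ (K : Set Plane)) (hzL : z ∈ convexHull ℝ (L : Set Plane))
    (hz : z ∈ D.domain) : c K = c L := by
  have hΩ := D.isOpen_domain.measurableSet
  obtain ⟨ε, hε, hb⟩ := isOpen_iff.1 D.isOpen_domain z hz
  have near : ∀ M ∈ T.cells, z ∈ convexHull ℝ (M : Set Plane) → ∃ y ∈ ball z (ε / 2),
      ∀ᶠ k : ℕ in atTop, mollify k (D.domain.indicator w) y = c M := by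
    intro M hM hzM
    rw [← T.closure_interior_cell hM, mem_closure_iff_nhds] at hzM
    obtain ⟨y, hy, hyM⟩ := hzM _ (ball_mem_nhds z (half_pos hε))
    obtain ⟨r, hr, hrM⟩ := isOpen_iff.1 isOpen_interior y hyM
    refine ⟨y, hy, ?_⟩
    filter_upwards [tendsto_one_div_nat_succ.eventually (eventually_le_nhds hr)] with k hk
    refine mollify_eq_const hk ?_
    have := hc M hM
    rw [ae_restrict_iff' hΩ] at this
    filter_upwards [this] with t ht htr
    have htM := hrM htr
    rw [indicator_of_mem (T.interior_cell_subset hM htM)]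
    exact ht (T.interior_cell_subset hM htM) (interior_subset htM)
  obtain ⟨y, hy, hyk⟩ := near K hK hzK
  obtain ⟨y', hy', hyk'⟩ := near L hL hzL
  obtain ⟨k, h1, h2, h3⟩ := (hyk.and (hyk'.and
    (tendsto_one_div_nat_succ.eventually (eventually_lt_nhds (half_pos hε))))).exists
  rw [← h1, ← h2]
  exact hw.mollify_eq hΩ (by rwa [mul_div_cancel₀ ε two_ne_zero]) h3 hy hy'

lemma hausdorffMeasure_segment_inter_eq_zero {a b : Plane} {S : Set Plane}
    (h : ∀ᵐ s : ℝ, s ∈ Icc (0 : ℝ) 1 → (lineMap a b s : Plane) ∉ S) :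
    Measure.hausdorffMeasure 1 (segment ℝ a b ∩ S) = 0 := by
  have hsub : segment ℝ a b ∩ S ⊆
      (lineMap a b : ℝ → Plane) '' {s | ¬(s ∈ Icc (0 : ℝ) 1 → (lineMap a b s : Plane) ∉ S)} := by
    rintro x ⟨hx, hxS⟩
    rw [segment_eq_image_lineMap] at hx
    obtain ⟨s, hs, rfl⟩ := hx
    exact ⟨s, fun h => h hs hxS, rfl⟩
  refine measure_mono_null hsub ?_
  rw [hausdorffMeasure_lineMap_image, hausdorffMeasure_real, ae_iff.1 h, smul_zero]

/-- A point of the outer curve lies in some cell, but not in its interior, which is part of the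
domain. -/
lemma frontier_outer_subset_edges : frontier D.outer ⊆ ⋃ K ∈ T.cells, ⋃ a ∈ K, ⋃ b ∈ K, ⋃ _ : a ≠ b,
    (segment ℝ a b ∩ frontier D.outer) := by
  intro z hz
  have h1 := D.frontier_outer_subset_closure hz
  rw [T.cover] at h1
  simp only [mem_iUnion] at h1 ⊢
  obtain ⟨K, hK, hzK⟩ := h1
  have h2 : z ∉ interior (convexHull ℝ (K : Set Plane)) := fun h =>
    disjoint_left.1 D.disjoint_domain_frontier_outer (T.interior_cell_subset hK h) hz
  obtain ⟨p, a, b, hpa, hpb, hab, rfl, hd⟩ := T.exists_vertices hK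
  rw [coe_triangle] at hzK h2
  rcases mem_edge_of_notMem_interior hd hzK h2 with h | h | h
  · exact ⟨_, hK, a, by simp, b, by simp, hab, h, hz⟩
  · exact ⟨_, hK, b, by simp, p, by simp, hpb.symm, h, hz⟩
  · exact ⟨_, hK, p, by simp, a, by simp, hpa, h, hz⟩

lemma exists_affine_of_mem_LhC {w : L2 D.domain} (hw : w ∈ LhC D T) {g : L2Vec D.domain}
    (hg : HasWeakGrad D.domain w g) : ∃ (α : Finset Plane → ℝ) (u : Finset Plane → Plane),
      ∀ K ∈ T.cells, (∀ᵐ x ∂(volume.restrict D.domain), x ∈ convexHull ℝ (K : Set Plane) →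
        w x = α K + (u K 0 * x 0 + u K 1 * x 1)) ∧
        ∀ᵐ x ∂(volume.restrict D.domain), x ∈ convexHull ℝ (K : Set Plane) → g x = u K := by
  choose! α u hu using hw.1.2
  refine ⟨α, u, fun K hK => ⟨hu K hK, ae_domain_of_interior K
    (HasWeakGrad.ae_eq_of_affine isOpen_interior (T.interior_cell_subset hK) hg (a := α K) ?_)⟩⟩
  filter_upwards [hu K hK] with x hx hxK using hx (interior_subset hxK)

/-- The function is constant on each cell, with a single constant by connectedness. If the constant
were nonzero, the zero trace would let the outer curve meet every edge in a set of length zero only,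
although the edges cover it and its length is positive. -/
lemma eq_zero_of_grad_eq_zero {w : L2 D.domain} (hw : w ∈ LhC D T)
    (hg : HasWeakGrad D.domain w 0) : w = 0 := by
  obtain ⟨α, u, hu⟩ := T.exists_affine_of_mem_LhC hw hg
  have hc : ∀ K ∈ T.cells, ∀ᵐ x ∂(volume.restrict D.domain),
      x ∈ convexHull ℝ (K : Set Plane) → w x = α K := by
    intro K hK
    obtain ⟨h1, h2⟩ := hu K hK
    have hu0 : u K = 0 := by
      refine T.eq_of_ae_interior_cell hK ?_
      filter_upwards [h2, Lp.coeFn_zero Plane 2 (volume.restrict D.domain)] with x h3 h4 hx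
      rw [← h3 (interior_subset hx), h4]
      rfl
    filter_upwards [h1] with x hx hxK
    rw [hx hxK, hu0]
    simp
  obtain ⟨K₀, hK₀⟩ := T.cells_nonempty
  have hconst : ∀ K ∈ T.cells, α K = α K₀ := by
    intro K hK
    by_contra h
    obtain ⟨M, hM, N, hN, hpM, hpN, z, ⟨hzM, hzN⟩, hz⟩ :=
      T.exists_adjacent (p := fun M => α M = α K₀) hK₀ rfl hK h
    exact hpN ((T.const_eq_of_mem_inter hg hc hM hN hzM hzN hz).symm.trans hpM)
  have hzero : α K₀ = 0 := by
    by_contra h0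
    refine D.outer_polygon.hausdorffMeasure_frontier_pos.ne' (measure_mono_null
      T.frontier_outer_subset_edges ?_)
    refine (measure_biUnion_null_iff T.cells.countable_toSet).2 fun K hK =>
      (measure_biUnion_null_iff K.countable_toSet).2 fun a ha =>
      (measure_biUnion_null_iff K.countable_toSet).2 fun b hb => measure_iUnion_null fun hab => ?_
    refine hausdorffMeasure_segment_inter_eq_zero ?_
    filter_upwards [T.ae_eq_of_hasTrace isClosed_frontier.measurableSet hw.2.2.1 hK ha hb hab
      (α := α K) (u := 0) (by
        filter_upwards [hc K hK] with x hx hxK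
        rw [hx hxK]
        simp)] with s hs hs1 hs2
    have := hs hs1 hs2
    simp only [PiLp.zero_apply, zero_mul, add_zero] at this
    exact h0 ((hconst K hK).symm.trans this)
  refine Lp.ext ?_
  have hc' : ∀ᵐ x ∂(volume.restrict D.domain), ∀ K ∈ T.cells, x ∈ convexHull ℝ (K : Set Plane) →
      w x = α K := (ae_ball_iff T.cells.countable_toSet).2 hc
  filter_upwards [hc', T.ae_exists_mem_interior_cell,
    Lp.coeFn_zero ℝ 2 (volume.restrict D.domain)] with x h1 ⟨K, hK, hxK⟩ h3
  rw [h1 K hK (interior_subset hxK), hconst K hK, hzero, h3]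
  rfl

/-! ### The gradient of an element of `L_{hC}` -/

/-- The contribution of a pair of vertices of a triangle to the rotation of a constant field. -/
def edgeCoeff (K : Finset Plane) (u : Plane) (a b : Plane) : ℝ :=
  -(1 / 2) * SignType.sign (cross (a - (∑ z ∈ K, z - a - b)) (b - (∑ z ∈ K, z - a - b))) *
    (u 0 * (b 0 - a 0) + u 1 * (b 1 - a 1))

/-- The orientation sign and the tangential component both change sign, so the coefficient belongs
to the unoriented edge. -/
lemma edgeCoeff_comm (K : Finset Plane) (u a b : Plane) : edgeCoeff K u a b = edgeCoeff K u b a := by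
  have e : ∑ z ∈ K, z - b - a = ∑ z ∈ K, z - a - b := by abel
  have h : ∀ v w : Plane, cross v w = -cross w v := fun v w => by unfold cross; ring
  unfold edgeCoeff
  rw [e, h, Left.sign_neg]
  push_cast
  ring

lemma edgeCoeff_self (K : Finset Plane) (u a : Plane) : edgeCoeff K u a a = 0 := by
  simp [edgeCoeff]

/-- In the definition, `a` and `b` are subtracted from the sum of all vertices, which leaves the
third vertex of the triangle. -/
lemma edgeCoeff_triangle {p a b : Plane} (hpa : p ≠ a) (hpb : p ≠ b) (hab : a ≠ b) (u : Plane) :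
    edgeCoeff {p, a, b} u a b = -(1 / 2) * SignType.sign (cross (a - p) (b - p)) *
      (u 0 * (b 0 - a 0) + u 1 * (b 1 - a 1)) := by
  have e : ∑ z ∈ ({p, a, b} : Finset Plane), z - a - b = p := by
    rw [Finset.sum_insert (by simp [hpa, hpb]), Finset.sum_pair hab]
    abel
  rw [edgeCoeff, e]

/-- A constant field is a combination of the three radial fields at the vertices, weighted by the
tangential components of `u` along the opposite edges. The factor `1 / 2` in `edgeCoeff` compensates
for counting each edge twice in the double sum. -/
lemma setIntegral_const_field {p a b : Plane} (hpa : p ≠ a) (hpb : p ≠ b) (hab : a ≠ b)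
    (h : cross (a - p) (b - p) ≠ 0) (u : Plane) {φ : Plane → ℝ} (hφ : IsTest univ φ) :
    ∫ x in convexHull ℝ {p, a, b}, (u 0 * partialD 1 φ x - u 1 * partialD 0 φ x) =
      ∑ x ∈ ({p, a, b} : Finset Plane), ∑ y ∈ ({p, a, b} : Finset Plane),
        edgeCoeff {p, a, b} u x y * edgeMean x y φ := by
  set d := cross (a - p) (b - p) with hd
  have h1 : cross (b - a) (p - a) = d := by
    simp only [hd, cross, PiLp.sub_apply]; ring
  have h2 : cross (p - b) (a - b) = d := by
    simp only [hd, cross, PiLp.sub_apply]; ring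
  have c1 : edgeCoeff {p, a, b} u a b = -(1 / 2) * SignType.sign d *
      (u 0 * (b 0 - a 0) + u 1 * (b 1 - a 1)) := edgeCoeff_triangle hpa hpb hab u
  have e1 : ({p, a, b} : Finset Plane) = {a, b, p} := by ext; simp; tauto
  have e2 : ({p, a, b} : Finset Plane) = {b, p, a} := by ext; simp; tauto
  have s1 : ({p, a, b} : Set Plane) = {a, b, p} := by ext; simp; tauto
  have s2 : ({p, a, b} : Set Plane) = {b, p, a} := by ext; simp; tauto
  have c2 : edgeCoeff {p, a, b} u b p = -(1 / 2) * SignType.sign d *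
      (u 0 * (p 0 - b 0) + u 1 * (p 1 - b 1)) := by
    rw [e1, edgeCoeff_triangle hab hpa.symm hpb.symm u, h1]
  have c3 : edgeCoeff {p, a, b} u p a = -(1 / 2) * SignType.sign d *
      (u 0 * (a 0 - p 0) + u 1 * (a 1 - p 1)) := by
    rw [e2, edgeCoeff_triangle hpb.symm hab.symm hpa u, h2]
  have k1 := setIntegral_triangle_radial h (φ := φ) (hφ.contDiff.of_le (by simp))
  have k2 := setIntegral_triangle_radial (h1 ▸ h) (φ := φ) (hφ.contDiff.of_le (by simp))
  have k3 := setIntegral_triangle_radial (h2 ▸ h) (φ := φ) (hφ.contDiff.of_le (by simp))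
  rw [h1, ← s1] at k2
  rw [h2, ← s2] at k3
  have hc : IsCompact (convexHull ℝ ({p, a, b} : Set Plane)) :=
    (Set.toFinite _).isCompact_convexHull ℝ
  have hint : ∀ q : Plane, IntegrableOn (fun x => fderiv ℝ φ x (x - q) + 2 * φ x)
      (convexHull ℝ {p, a, b}) := fun q =>
    (((hφ.contDiff.continuous_fderiv (by simp)).clm_apply (by fun_prop)).add
      (continuous_const.mul hφ.contDiff.continuous)).continuousOn.integrableOn_compact hc
  have lin : ∀ c₁ c₂ c₃ : ℝ, ∫ x in convexHull ℝ {p, a, b},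
      (c₁ * (fderiv ℝ φ x (x - p) + 2 * φ x) + c₂ * (fderiv ℝ φ x (x - a) + 2 * φ x) +
        c₃ * (fderiv ℝ φ x (x - b) + 2 * φ x)) =
      c₁ * (∫ x in convexHull ℝ {p, a, b}, (fderiv ℝ φ x (x - p) + 2 * φ x)) +
      c₂ * (∫ x in convexHull ℝ {p, a, b}, (fderiv ℝ φ x (x - a) + 2 * φ x)) +
      c₃ * ∫ x in convexHull ℝ {p, a, b}, (fderiv ℝ φ x (x - b) + 2 * φ x) := fun c₁ c₂ c₃ => by
    rw [integral_add, integral_add, integral_const_mul, integral_const_mul, integral_const_mul]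
    exacts [(hint p).const_mul _, (hint a).const_mul _,
      ((hint p).const_mul _).add ((hint a).const_mul _), (hint b).const_mul _]
  -- The three edge vectors add up to zero, so the terms `2 φ` and those with the position `x`
  -- cancel. What remains is `d` times the integrand for the constant field.
  have key : d * ∫ x in convexHull ℝ {p, a, b}, (u 0 * partialD 1 φ x - u 1 * partialD 0 φ x) =
      -((u 0 * (b 0 - a 0) + u 1 * (b 1 - a 1)) *
          (∫ x in convexHull ℝ {p, a, b}, (fderiv ℝ φ x (x - p) + 2 * φ x)) +
        (u 0 * (p 0 - b 0) + u 1 * (p 1 - b 1)) *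
          (∫ x in convexHull ℝ {p, a, b}, (fderiv ℝ φ x (x - a) + 2 * φ x)) +
        (u 0 * (a 0 - p 0) + u 1 * (a 1 - p 1)) *
          ∫ x in convexHull ℝ {p, a, b}, (fderiv ℝ φ x (x - b) + 2 * φ x)) := by
    rw [← lin, ← integral_const_mul, ← integral_neg]
    congr 1
    ext x
    simp only [fderiv_eq_partialD, hd, cross, PiLp.sub_apply]
    ring
  rw [k1, k2, k3] at key
  have key2 : d * ∫ x in convexHull ℝ {p, a, b}, (u 0 * partialD 1 φ x - u 1 * partialD 0 φ x) =
      d * -(SignType.sign d * ((u 0 * (b 0 - a 0) + u 1 * (b 1 - a 1)) * edgeMean a b φ +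
        (u 0 * (p 0 - b 0) + u 1 * (p 1 - b 1)) * edgeMean b p φ +
        (u 0 * (a 0 - p 0) + u 1 * (a 1 - p 1)) * edgeMean p a φ)) := by
    rw [key]
    have : |d| = SignType.sign d * d := (sign_mul_self d).symm
    rw [this]
    ring
  rw [mul_left_cancel₀ h key2, Finset.sum_insert (by simp [hpa, hpb]), Finset.sum_pair hab,
    Finset.sum_insert (by simp [hpa, hpb]), Finset.sum_pair hab, Finset.sum_insert (by simp [hpa, hpb]),
    Finset.sum_pair hab, Finset.sum_insert (by simp [hpa, hpb]), Finset.sum_pair hab]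
  rw [edgeCoeff_self, edgeCoeff_self, edgeCoeff_self, edgeCoeff_comm _ u p b, edgeCoeff_comm _ u a p,
    edgeCoeff_comm _ u b a, edgeMean_comm p b, edgeMean_comm a p, edgeMean_comm b a, c1, c2, c3]
  ring

end Triangulation

end

/-! ### Gradients of `L_{hC}` have zero tangential trace -/

section

namespace Triangulation

variable {J : ℕ} {D : MultiplyConnectedPolygon J} (T : Triangulation D.domain) {K L : Finset Plane}

/-- The tangential derivative vanishes along boundary edges. -/
lemma tangential_eq_zero {w : L2 D.domain} (hw : w ∈ LhC D T) (hK : K ∈ T.cells) {a b : Plane}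
    (ha : a ∈ K) (hb : b ∈ K) (hab : a ≠ b) (hd : Disjoint (openSegment ℝ a b) D.domain) {α : ℝ}
    {u : Plane} (hu : ∀ᵐ x ∂(volume.restrict D.domain), x ∈ convexHull ℝ (K : Set Plane) →
      w x = α + (u 0 * x 0 + u 1 * x 1)) :
    u 0 * (b 0 - a 0) + u 1 * (b 1 - a 1) = 0 := by
  obtain ⟨-, -, h0, hj⟩ := hw
  choose c hc using hj
  by_contra hm
  set m := u 0 * (b 0 - a 0) + u 1 * (b 1 - a 1)
  -- Each boundary point of the domain is on the outer curve or on a hole curve, so along the edge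
  -- `w` takes almost everywhere a value in this finite set. An affine function with nonzero slope
  -- attains it only finitely often. It need not be known which curve contains the edge.
  set C : Set ℝ := insert 0 (range c)
  have hCf : C.Finite := (finite_range c).insert 0
  set f : ℝ → ℝ := fun s => α + (u 0 * a 0 + u 1 * a 1) + s * m
  have hf : ∀ s : ℝ, α + (u 0 * (lineMap a b s : Plane) 0 + u 1 * (lineMap a b s : Plane) 1) =
      f s := by
    intro s
    simp only [lineMap_coord, f, m]
    ring
  have hinj : Function.Injective f := fun s t h => by
    have : s * m = t * m := by simpa [f] using h
    exact mul_right_cancel₀ hm this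
  have hfin : (f ⁻¹' C).Finite := hCf.preimage hinj.injOn
  have hae : ∀ᵐ s : ℝ, s ∈ Ioo (0 : ℝ) 1 → s ∈ f ⁻¹' C := by
    have hall := ae_all_iff.2 fun j =>
      T.ae_eq_of_hasTrace isClosed_frontier.measurableSet (hc j) hK ha hb hab hu
    filter_upwards [T.ae_eq_of_hasTrace isClosed_frontier.measurableSet h0 hK ha hb hab hu,
      hall] with s h1 h2 hs
    have hso : (lineMap a b s : Plane) ∈ openSegment ℝ a b := by
      rw [openSegment_eq_image_lineMap]
      exact ⟨s, hs, rfl⟩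
    have hsK : (lineMap a b s : Plane) ∈ convexHull ℝ (K : Set Plane) :=
      (convex_convexHull ℝ _).segment_subset (subset_convexHull ℝ _ ha) (subset_convexHull ℝ _ hb)
        (openSegment_subset_segment ℝ a b hso)
    have hfr : (lineMap a b s : Plane) ∈ frontier D.domain := by
      rw [frontier, D.isOpen_domain.interior_eq]
      exact ⟨T.cell_subset_closure hK hsK, disjoint_left.1 hd hso⟩
    have hs' := Ioo_subset_Icc_self hs
    rw [mem_preimage, ← hf]
    rcases D.frontier_domain_subset hfr with h | h
    · rw [h1 hs' h]
      exact mem_insert _ _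
    · obtain ⟨j, hj⟩ := mem_iUnion.1 h
      rw [h2 j hs' hj]
      exact mem_insert_of_mem _ (mem_range_self j)
  have hzero : volume (Ioo (0 : ℝ) 1) = 0 := by
    refine measure_eq_zero_iff_ae_notMem.2 ?_
    filter_upwards [hae, measure_eq_zero_iff_ae_notMem.1 (hfin.measure_zero volume)] with s h1 h2 h3
      using h2 (h1 h3)
  simp at hzero

/-- A combination of edge means that vanishes for all functions supported in `U` has vanishing
coefficients at the edges that meet `U`. -/
lemma edge_coefficient_eq_zero {U : Set Plane} (hU : IsOpen U) (V : Finset Plane)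
    {A : Plane → Plane → ℝ} (hA : ∀ x y, A x y = A y x)
    (hcell : ∀ x y, A x y ≠ 0 → ∃ K ∈ T.cells, x ∈ K ∧ y ∈ K)
    (hsum : ∀ φ, IsTest U φ → ∑ x ∈ V, ∑ y ∈ V, A x y * edgeMean x y φ = 0) {a b z : Plane}
    (ha : a ∈ V) (hb : b ∈ V) (hab : a ≠ b) (hz : z ∈ openSegment ℝ a b) (hzU : z ∈ U) :
    A a b = 0 := by
  classical
  by_contra h0
  obtain ⟨K, hK, haK, hbK⟩ := hcell a b h0
  -- The other pairs with nonzero coefficient. By conformity their segments avoid the relatively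
  -- interior point `z` of the edge `a b`.
  set P : Finset (Plane × Plane) := (V ×ˢ V).filter fun e =>
    A e.1 e.2 ≠ 0 ∧ e ≠ (a, b) ∧ e ≠ (b, a)
  set F : Set Plane := ⋃ e ∈ P, segment ℝ e.1 e.2
  have hF : IsClosed F := isClosed_biUnion_finset fun e _ => isClosed_segment e.1 e.2
  have hzF : z ∉ F := by
    intro h
    simp only [F, mem_iUnion] at h
    obtain ⟨⟨a', b'⟩, he, hze⟩ := h
    obtain ⟨-, hne, h1, h2⟩ := Finset.mem_filter.1 he
    obtain ⟨L, hL, ha', hb'⟩ := hcell _ _ hne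
    obtain ⟨h3, h4⟩ := T.pair_eq_of_mem_openSegment hK hL haK hbK hab ha' hb' hz hze
    simp only [mem_insert_iff, mem_singleton_iff] at h3 h4
    rcases h3 with rfl | rfl <;> rcases h4 with rfl | rfl
    · exact hab rfl
    · exact h1 rfl
    · exact h2 rfl
    · exact hab rfl
  obtain ⟨r, hr, hrU⟩ := isOpen_iff.1 (hU.sdiff hF) z ⟨hzU, hzF⟩
  -- A bump at `z` supported in `U` and off all those segments. Only `(a, b)` and `(b, a)` remain in
  -- the sum, both with the same coefficient and the same positive mean.
  set B : ContDiffBump z := ⟨r / 4, r / 2, by positivity, by linarith⟩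
  have hsupp : tsupport B ⊆ ball z r := by
    rw [B.tsupport_eq]
    exact closedBall_subset_ball (by change r / 2 < r; linarith)
  have hB : IsTest U B := ⟨B.contDiff, B.hasCompactSupport,
    hsupp.trans (hrU.trans sdiff_subset)⟩
  have hvan : ∀ e ∈ V ×ˢ V, e ∉ ({(a, b), (b, a)} : Finset (Plane × Plane)) →
      A e.1 e.2 * edgeMean e.1 e.2 B = 0 := by
    intro e he hne
    simp only [Finset.mem_insert, Finset.mem_singleton, not_or] at hne
    by_cases hAe : A e.1 e.2 = 0
    · rw [hAe, zero_mul]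
    · have heP : e ∈ P := Finset.mem_filter.2 ⟨he, hAe, hne⟩
      have : edgeMean e.1 e.2 B = 0 := by
        rw [edgeMean, intervalIntegral.integral_of_le zero_le_one]
        refine setIntegral_eq_zero_of_forall_eq_zero fun s hs => ?_
        refine image_eq_zero_of_notMem_tsupport fun h => (hrU (hsupp h)).2 ?_
        refine mem_biUnion heP ?_
        rw [segment_eq_image_lineMap]
        exact ⟨s, Ioc_subset_Icc_self hs, rfl⟩
      rw [this, mul_zero]
  have hs := hsum B hB
  rw [← Finset.sum_product', ← Finset.sum_subset (s₁ := {(a, b), (b, a)}) ?_ hvan,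
    Finset.sum_pair (by simp [hab]), edgeMean_comm b a, hA b a] at hs
  · have hpos : 0 < edgeMean a b B := by
      have hcont : Continuous fun s : ℝ => B (lineMap a b s) :=
        hB.contDiff.continuous.comp lineMap_continuous
      rw [openSegment_eq_image_lineMap] at hz
      obtain ⟨s, hs01, rfl⟩ := hz
      refine intervalIntegral.integral_pos zero_lt_one hcont.continuousOn (fun t _ => B.nonneg)
        ⟨s, Ioo_subset_Icc_self hs01, ?_⟩
      rw [B.one_of_mem_closedBall (mem_closedBall_self (by positivity))]
      exact one_pos
    have := mul_ne_zero h0 hpos.ne'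
    exact this (by linarith)
  · intro e he
    simp only [Finset.mem_insert, Finset.mem_singleton] at he
    rcases he with rfl | rfl <;> simp [ha, hb]

/-- Testing the piecewise constant gradient against any function of the plane gives a sum of edge
means with coefficients `A x y`, each collecting the contributions of all cells at the pair. Once
all coefficients vanish, Green's formula holds in the whole plane, which is the zero tangential
trace. -/
lemma grad_mem {w : L2 D.domain} (hw : w ∈ LhC D T) {g : L2Vec D.domain}
    (hg : HasWeakGrad D.domain w g) : g ∈ T.Rh0 := by
  classical
  obtain ⟨α, u, hu⟩ := T.exists_affine_of_mem_LhC hw hg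
  set V : Finset Plane := T.cells.biUnion id
  have hKV : ∀ K ∈ T.cells, K ⊆ V := fun K hK => Finset.subset_biUnion_of_mem id hK
  set A : Plane → Plane → ℝ := fun x y =>
    ∑ K ∈ T.cells, if x ∈ K ∧ y ∈ K then edgeCoeff K (u K) x y else 0
  have hzero : ∀ φ : Plane → ℝ, ∫ x in D.domain, (0 : L2 D.domain) x * φ x = 0 := by
    intro φ
    refine integral_eq_zero_of_ae ?_
    filter_upwards [Lp.coeFn_zero ℝ 2 (volume.restrict D.domain)] with x hx
    rw [hx]
    simp
  have hformula : ∀ φ, IsTest univ φ →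
      ∫ x in D.domain, (g x 0 * partialD 1 φ x - g x 1 * partialD 0 φ x) =
        ∑ x ∈ V, ∑ y ∈ V, A x y * edgeMean x y φ := by
    intro φ hφ
    rw [T.setIntegral_domain (GreenRot.integrable hφ g)]
    have e1 : ∀ K ∈ T.cells, ∫ x in convexHull ℝ (K : Set Plane),
        (g x 0 * partialD 1 φ x - g x 1 * partialD 0 φ x) =
        ∑ x ∈ V, ∑ y ∈ V, (if x ∈ K ∧ y ∈ K then edgeCoeff K (u K) x y else 0) *
          edgeMean x y φ := by
      intro K hK
      have e2 : ∫ x in convexHull ℝ (K : Set Plane),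
          (g x 0 * partialD 1 φ x - g x 1 * partialD 0 φ x) =
          ∫ x in convexHull ℝ (K : Set Plane),
            (u K 0 * partialD 1 φ x - u K 1 * partialD 0 φ x) := by
        refine integral_congr_ae ?_
        filter_upwards [T.ae_restrict_cell hK (hu K hK).2] with x hx
        rw [hx]
      have e3 : ∫ x in convexHull ℝ (K : Set Plane),
          (u K 0 * partialD 1 φ x - u K 1 * partialD 0 φ x) =
          ∑ x ∈ K, ∑ y ∈ K, edgeCoeff K (u K) x y * edgeMean x y φ := by
        obtain ⟨p, a, b, hpa, hpb, hab, e, hd⟩ := T.exists_vertices hK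
        generalize u K = v
        subst e
        rw [coe_triangle]
        exact setIntegral_const_field hpa hpb hab hd v hφ
      have e4 : ∀ f : Plane → ℝ, ∑ x ∈ K, f x = ∑ x ∈ V, if x ∈ K then f x else 0 := fun f => by
        rw [← Finset.sum_filter, Finset.filter_mem_eq_inter, Finset.inter_eq_right.2 (hKV K hK)]
      rw [e2, e3, e4]
      refine Finset.sum_congr rfl fun x _ => ?_
      rw [e4]
      by_cases hx : x ∈ K <;> simp [hx, ite_mul]
    rw [Finset.sum_congr rfl e1, Finset.sum_comm]
    refine Finset.sum_congr rfl fun x _ => ?_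
    rw [Finset.sum_comm]
    refine Finset.sum_congr rfl fun y _ => ?_
    rw [Finset.sum_mul]
  have hrot : HasWeakRot D.domain g 0 := hg.hasWeakRot
  have hAzero : ∀ x ∈ V, ∀ y ∈ V, A x y = 0 := by
    intro x hx y hy
    by_cases hxy : x = y
    · subst hxy
      exact Finset.sum_eq_zero fun K _ => by simp [edgeCoeff_self]
    -- Off the domain the boundary values make each cell's contribution vanish separately. For a
    -- segment that enters the domain only the total over the cells vanishes, by irrotationality.
    by_cases hd : Disjoint (openSegment ℝ x y) D.domain
    · refine Finset.sum_eq_zero fun K hK => ?_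
      split_ifs with h
      · rw [edgeCoeff, T.tangential_eq_zero hw hK h.1 h.2 hxy hd (hu K hK).1, mul_zero]
      · rfl
    · obtain ⟨z, hz, hzD⟩ := not_disjoint_iff.1 hd
      refine T.edge_coefficient_eq_zero D.isOpen_domain V (A := A) (fun x y => ?_)
        (fun x y h => ?_) (fun φ hφ => ?_) hx hy hxy hz hzD
      · refine Finset.sum_congr rfl fun K _ => ?_
        simp only [edgeCoeff_comm K (u K) x y, and_comm (a := x ∈ K)]
      · obtain ⟨K, hK, h2⟩ := Finset.exists_ne_zero_of_sum_ne_zero h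
        exact ⟨K, hK, by by_contra h3; simp [h3] at h2⟩
      · rw [← hformula φ (hφ.mono (subset_univ _)), hrot φ hφ, hzero]
  have hgreen : GreenRot D.domain univ g 0 := by
    intro φ hφ
    rw [hformula φ hφ, hzero]
    exact Finset.sum_eq_zero fun x hx => Finset.sum_eq_zero fun y hy => by
      rw [hAzero x hx y hy, zero_mul]
  refine ⟨⟨⟨0, hrot⟩, fun K hK => ⟨u K, 0, ?_⟩⟩, 0, hrot, hgreen⟩
  filter_upwards [(hu K hK).2] with x hx hxK
  rw [hx hxK, zero_smul, add_zero]

end Triangulation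

end

end PlateComplex

end

/-! ### The exact sequence -/

theorem mainTheorem9 {J : ℕ} (D : PlateComplex.MultiplyConnectedPolygon J)
    (T : PlateComplex.Triangulation D.domain) :
    ∃ (grad : PlateComplex.LhC D T →ₗ[ℝ] T.Rh0) (rot : T.Rh0 →ₗ[ℝ] PlateComplex.L0h0 D T),
      (∀ w : PlateComplex.LhC D T, PlateComplex.HasWeakGrad D.domain w (grad w)) ∧
      (∀ τ : T.Rh0, PlateComplex.HasWeakRot D.domain τ (rot τ)) ∧
      Function.Injective grad ∧
      Function.Exact grad rot ∧
      Function.Surjective rot := by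
  have hΩ := D.isOpen_domain
  -- The weak derivatives are picked by choice; their uniqueness makes the resulting maps linear.
  choose G hG using fun w : PlateComplex.LhC D T => w.2.1.1
  choose R hR using fun τ : T.Rh0 => τ.2.1.1
  let grad : PlateComplex.LhC D T →ₗ[ℝ] T.Rh0 :=
    { toFun := fun w => ⟨G w, T.grad_mem w.2 (hG w)⟩
      map_add' := fun w w' => Subtype.ext ((hG (w + w')).unique hΩ ((hG w).add (hG w')))
      map_smul' := fun c w => Subtype.ext ((hG (c • w)).unique hΩ ((hG w).smul c)) }
  let rot : T.Rh0 →ₗ[ℝ] PlateComplex.L0h0 D T :=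
    { toFun := fun τ => ⟨R τ, T.rot_mem τ.2 (hR τ)⟩
      map_add' := fun τ τ' => Subtype.ext
        (PlateComplex.HasWeakRot.unique hΩ (hR (τ + τ')) ((hR τ).add (hR τ')))
      map_smul' := fun c τ => Subtype.ext
        (PlateComplex.HasWeakRot.unique hΩ (hR (c • τ)) ((hR τ).smul c)) }
  refine ⟨grad, rot, hG, hR, ?_, fun τ => ⟨fun h => ?_, ?_⟩, fun q => ?_⟩
  · refine (injective_iff_map_eq_zero grad).2 fun w hw => Subtype.ext ?_
    have h0 : G w = 0 := congrArg Subtype.val hw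
    exact T.eq_zero_of_grad_eq_zero w.2 (h0 ▸ hG w)
  · have h0 : R τ = 0 := congrArg Subtype.val h
    obtain ⟨w, hw, hwg⟩ := T.exists_grad_eq τ.2 (h0 ▸ hR τ)
    exact ⟨⟨w, hw⟩, Subtype.ext ((hG ⟨w, hw⟩).unique hΩ hwg)⟩
  · rintro ⟨w, rfl⟩
    exact Subtype.ext (PlateComplex.HasWeakRot.unique hΩ (hR (grad w)) (hG w).hasWeakRot)
  · obtain ⟨τ, hτ, h⟩ := T.mem_rotRange q.2
    exact ⟨⟨τ, hτ⟩, Subtype.ext (PlateComplex.HasWeakRot.unique hΩ (hR ⟨τ, hτ⟩) h)⟩
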